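/- Let $S^2\subset\mathbb R^3$ be the unit sphere with round metric $\sigma_{AB}$, Levi-Civita connection $\nabla$, area measure, and coordinate functions $\tilde X^k$, $k=1,2,3$. A set of vacuum null infinity data on $\mathbb R\times S^2$ consists of a function $m$, a 1-form $N_A$ and a symmetric traceless 2-tensor $C_{AB}$ on $S^2$, depending smoothly on $(u,x)$, such that with the news $N_{AB}=\partial_uC_{AB}$ $$\partial_u m=-\tfrac18N_{AB}N^{AB}+\tfrac14\nabla^A\nabla^BN_{AB},$$ $$\partial_uN_A=\nabla_Am-\tfrac14\nabla^D(\nabla_D\nabla^EC_{EA}-\nabla_A\nabla^EC_{ED})+\tfrac14\nabla_A(C_{BE}N^{BE})-\tfrac14\nabla_B(C^{BD}N_{DA})+\tfrac12C_{AB}\nabla_DN^{DB}.$$ Put $E=\int_{S^2}2m$, $P^k=\int_{S^2}2m\tilde X^k$, and let the classical center of mass be $$\tilde C^k=\int_{S^2}\nabla^A\tilde X^k\Big[N_A-u\nabla_Am-\tfrac14C_A{}^D\nabla^BC_{DB}-\tfrac1{16}\nabla_A(C_{DE}C^{DE})\Big].$$ The total flux of a function $Q(u)$ is $Q(+)-Q(-)$,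 where $Q(\pm)=\lim_{u\to\pm\infty}Q(u)$. For a smooth function $f$ on $S^2$, the supertranslation $u=\bar u+f(x)$ leads to vacuum data $(\bar m,\bar N_A,\bar C_{AB})$ in the coordinates $(\bar u,x)$ with $$\bar m=m+\tfrac12\nabla^BN_{BD}\nabla^Df+\tfrac14\partial_uN_{BD}\nabla^Bf\nabla^Df+\tfrac14N_{BD}\nabla^B\nabla^Df,\qquad \bar C_{AB}=C_{AB}-2\nabla_A\nabla_Bf+\Delta f\,\sigma_{AB},$$ the right-hand sides being evaluated at $(\bar u+f(x),x)$ (and with $\bar N_A$ any solution of its evolution equation, which suffices to determine total fluxes); $\tilde C^k_f$ denotes their center of mass. The total flux of $\tilde C^k$ is called supertranslation invariant if, for every smooth $f=\alpha_0+\sum_i\alpha_i\tilde X^i+f_{\ell\ge2}$ with $f_{\ell\ge2}$ orthogonal to $1$ and to all $\tilde X^i$ in $L^2(S^2)$, and for $k=1,2,3$, $$\big(\tilde C^k_f(+)-\tilde C^k_f(-)\big)-\big(\tilde C^k(+)-\tilde C^k(-)\big)=\alpha_0\big(P^k(+)-P^k(-)\big)+\alpha_k\big(E(+)-E(-)\big);$$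 that is, it is invariant under the higher modes and equivariant under ordinary translations. **Theorem.** Let $(m,N_A,C_{AB})$ be vacuum null infinity data on $\mathbb R\times S^2$ and suppose that, for some $\varepsilon>0$, $N_{AB}(u,x)=O(|u|^{-1-\varepsilon})$ as $u\to\pm\infty$, uniformly in $x$ and together with its derivatives of order at most $2$ along $S^2$. Then the limits $m(\pm)(x)=\lim_{u\to\pm\infty}m(u,x)$, $\tilde C^k(\pm)$ and $\tilde C^k_f(\pm)$ exist, and the total flux of the classical center of mass is supertranslation invariant if and only if $m(+)-m(-)$ is a constant function on $S^2$. Moreover, writing $\delta m=m(+)-m(-)$, for every smooth $f$ and $k=1,2,3$ $$\big(\tilde C^k_f(+)-\tilde C^k_f(-)\big)-\big(\tilde C^k(+)-\tilde C^k(-)\big)=\int_{S^2}\big(2\tilde X^kf+2\nabla^A\tilde X^k\nabla_Af\big)\,\delta m,$$ and, if $\delta m$ is $C^1$, this equals $\int_{S^2}\big(6\tilde X^k\delta m-2\nabla^A\tilde X^k\nabla_A\delta m\big)f$. -/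

import Mathlib

open MeasureTheory Filter Topology
open scoped Manifold ContDiff

noncomputable section

namespace NullInfinity

/-! ### Tensor calculus on the unit sphere

Tensor fields on the unit sphere of `ℝ³` are given by their Cartesian components: a 1-form is a map
`S2 → Fin 3 → ℝ` annihilating the normal `x`, and likewise for 2-tensors. All indices are raised,
lowered and contracted with the induced round metric, which on tangential tensors is the Euclidean
contraction. The Levi-Civita derivative is the tangential projection of the flat derivative. -/

/-- The unit sphere in `ℝ³`. -/
abbrev S2 : Type := Metric.sphere (0 : EuclideanSpace ℝ (Fin 3)) 1

/-- The area measure of the standard round metric (total mass `4π`). -/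
abbrev area : Measure S2 := (volume : Measure (EuclideanSpace ℝ (Fin 3))).toSphere

/-- The restrictions `X̃^k` of the coordinate functions of `ℝ³`. -/
def X (k : Fin 3) (x : S2) : ℝ := x.1 k

/-- The extension of a function on the sphere to `ℝ³ ∖ {0}` that is constant along rays. -/
def radialExt (g : S2 → ℝ) (y : EuclideanSpace ℝ (Fin 3)) : ℝ :=
  if h : y = 0 then 0
  else g ⟨‖y‖⁻¹ • y, by simp [norm_smul, inv_mul_cancel₀ (norm_ne_zero_iff.mpr h)]⟩

/-- The `i`-th Cartesian component of the tangential gradient of a function on the sphere. (The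
radial derivative of the extension vanishes, so its gradient is tangential.) -/
def pd (i : Fin 3) (g : S2 → ℝ) (x : S2) : ℝ :=
  fderiv ℝ (radialExt g) x.1 (EuclideanSpace.single i 1)

/-- The round metric `σ` in Cartesian components, which is the projection to the tangent plane. -/
def σ (x : S2) (i j : Fin 3) : ℝ := (if i = j then 1 else 0) - x.1 i * x.1 j

/-- `∇_i g`. -/
def grad (g : S2 → ℝ) (x : S2) (i : Fin 3) : ℝ := pd i g x

/-- `∇_i w_j` for a 1-form `w`. -/
def covForm (w : S2 → Fin 3 → ℝ) (x : S2) (i j : Fin 3) : ℝ :=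
  ∑ l, σ x j l * pd i (fun y => w y l) x

/-- `∇_i T_{jk}` for a 2-tensor `T`. -/
def covTensor (T : S2 → Fin 3 → Fin 3 → ℝ) (x : S2) (i j k : Fin 3) : ℝ :=
  ∑ a, ∑ b, σ x j a * σ x k b * pd i (fun y => T y a b) x

/-- `∇^i w_i`. -/
def divForm (w : S2 → Fin 3 → ℝ) (x : S2) : ℝ := ∑ i, covForm w x i i

/-- `∇^i T_{ij}`. -/
def divTensor (T : S2 → Fin 3 → Fin 3 → ℝ) (x : S2) (j : Fin 3) : ℝ := ∑ i, covTensor T x i i j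

/-- `∇_i ∇_j g`. -/
def hess (g : S2 → ℝ) : S2 → Fin 3 → Fin 3 → ℝ := covForm (grad g)

/-- The Laplace-Beltrami operator `Δ`. -/
def lap (g : S2 → ℝ) (x : S2) : ℝ := divForm (grad g) x

/-- The pairing `S_{ij} T^{ij}`. -/
def pair (S T : Fin 3 → Fin 3 → ℝ) : ℝ := ∑ i, ∑ j, S i j * T i j

/-- Smooth functions on the sphere. -/
def SmoothOnS2 (g : S2 → ℝ) : Prop := ContMDiff (𝓡 2) 𝓘(ℝ, ℝ) ∞ g

/-- Smooth functions of `(u, x)` on `ℝ × S²`. -/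
def SmoothOnScri (g : ℝ → S2 → ℝ) : Prop :=
  ContMDiff (𝓘(ℝ, ℝ).prod (𝓡 2)) 𝓘(ℝ, ℝ) ∞ (fun p : ℝ × S2 => g p.1 p.2)

/-- `f` is supported in the modes `ℓ ≥ 2`: it is `L²`-orthogonal to the constants (`ℓ = 0`) and to
the coordinate functions (`ℓ = 1`). -/
def SupportedInHigherModes (f : S2 → ℝ) : Prop :=
  ∫ x, f x ∂area = 0 ∧ ∀ i, ∫ x, f x * X i x ∂area = 0

/-! ### Null infinity data -/

/-- Mass aspect `m`, angular momentum aspect `N_A` and shear `C_{AB}` on `ℝ × S²`, as functions of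
the retarded time `u` and the point `x`. -/
structure Data where
  m : ℝ → S2 → ℝ
  NA : ℝ → S2 → Fin 3 → ℝ
  C : ℝ → S2 → Fin 3 → Fin 3 → ℝ

namespace Data

variable (D : Data)

/-- The news tensor `N_{AB} = ∂_u C_{AB}`. -/
def news (u : ℝ) (x : S2) (i j : Fin 3) : ℝ := deriv (fun s => D.C s x i j) u

/-- The data consist of a smooth function, a smooth 1-form and a smooth symmetric traceless 2-tensor
on the sphere, depending smoothly on `u`, and satisfy the evolution equations of null infinity
implied by the vacuum Einstein equation:
`∂_u m = -⅛ N_{AB} N^{AB} + ¼ ∇^A ∇^B N_{AB}` and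
`∂_u N_A = ∇_A m - ¼ ∇^D (∇_D ∇^E C_{EA} - ∇_A ∇^E C_{ED}) + ¼ ∇_A (C_{BE} N^{BE})
  - ¼ ∇_B (C^{BD} N_{DA}) + ½ C_{AB} ∇_D N^{DB}`. -/
structure IsVacuum : Prop where
  smooth_m : SmoothOnScri D.m
  smooth_NA : ∀ i, SmoothOnScri fun u x => D.NA u x i
  smooth_C : ∀ i j, SmoothOnScri fun u x => D.C u x i j
  tangential_NA : ∀ u x, ∑ i, x.1 i * D.NA u x i = 0
  tangential_C : ∀ u x j, ∑ i, x.1 i * D.C u x i j = 0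
  symm_C : ∀ u x i j, D.C u x i j = D.C u x j i
  traceless_C : ∀ u x, ∑ i, D.C u x i i = 0
  evolution_m : ∀ u x, deriv (fun s => D.m s x) u =
    -(1 / 8) * pair (D.news u x) (D.news u x) + 1 / 4 * divForm (divTensor (D.news u)) x
  evolution_NA : ∀ u x i, deriv (fun s => D.NA s x i) u =
    grad (D.m u) x i
      - 1 / 4 * divTensor (fun y d a =>
          covForm (divTensor (D.C u)) y d a - covForm (divTensor (D.C u)) y a d) x i
      + 1 / 4 * grad (fun y => pair (D.C u y) (D.news u y)) x i
      - 1 / 4 * divTensor (fun y b a => ∑ d, D.C u y b d * D.news u y d a) x i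
      + 1 / 2 * ∑ b, D.C u x i b * divTensor (D.news u) x b

/-- The news is `O(|u|^{-1-ε})` as `u → ±∞` for some `ε > 0`, uniformly on the sphere and together
with its derivatives of order at most two along the sphere. (Bounds on iterated tangential
derivatives of the Cartesian components are equivalent to bounds on covariant derivatives.) -/
def NewsDecay : Prop :=
  ∃ ε K R : ℝ, 0 < ε ∧ ∀ u : ℝ, R ≤ |u| → 0 < |u| → ∀ (x : S2) (i j : Fin 3),
    |D.news u x i j| ≤ K * |u| ^ (-1 - ε) ∧
    (∀ a, |pd a (fun y => D.news u y i j) x| ≤ K * |u| ^ (-1 - ε)) ∧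
    (∀ a b, |pd a (pd b (fun y => D.news u y i j)) x| ≤ K * |u| ^ (-1 - ε))

/-- The energy `E = ∫ 2m`. -/
def energy (u : ℝ) : ℝ := ∫ x, 2 * D.m u x ∂area

/-- The linear momentum `P^k = ∫ 2m X̃^k`. -/
def momentum (k : Fin 3) (u : ℝ) : ℝ := ∫ x, 2 * D.m u x * X k x ∂area

/-- The classical center of mass
`C̃^k = ∫ ∇^A X̃^k [N_A - u ∇_A m - ¼ C_A^D ∇^B C_{DB} - (1/16) ∇_A (C_{DE} C^{DE})]`. -/
def centerOfMass (k : Fin 3) (u : ℝ) : ℝ :=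
  ∫ x, ∑ i, grad (X k) x i *
    (D.NA u x i - u * grad (D.m u) x i
      - 1 / 4 * ∑ d, D.C u x i d * divTensor (D.C u) x d
      - 1 / 16 * grad (fun y => pair (D.C u y) (D.C u y)) x i) ∂area

/-- `D'` is a set of vacuum data in the coordinates `(ū, x)` that are related to the coordinates
`(u, x)` of `D` by the supertranslation `u = ū + f(x)`:
`m̄(ū, x) = m + ½ (∇^B N_{BD}) ∇^D f + ¼ (∂_u N_{BD}) ∇^B f ∇^D f + ¼ N_{BD} ∇^B ∇^D f` and
`C̄_{AB}(ū, x) = C_{AB} - 2 ∇_A ∇_B f + Δf σ_{AB}`, the right-hand sides taken at `(ū + f(x), x)`.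
The angular momentum aspect of `D'` may be any solution of its evolution equation; any two of them
differ by a 1-form independent of `ū`, which does not affect total fluxes. -/
structure IsSupertranslate (f : S2 → ℝ) (D' : Data) : Prop where
  vacuum : D'.IsVacuum
  m_eq : ∀ u x, D'.m u x = D.m (u + f x) x
    + 1 / 2 * ∑ d, divTensor (D.news (u + f x)) x d * grad f x d
    + 1 / 4 * ∑ b, ∑ d,
        deriv (fun s => D.news s x b d) (u + f x) * grad f x b * grad f x d
    + 1 / 4 * pair (D.news (u + f x) x) (hess f x)
  C_eq : ∀ u x i j, D'.C u x i j = D.C (u + f x) x i j - 2 * hess f x i j + lap f x * σ x i j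

end Data

/-- `F` is the total flux `Q(+) - Q(-)` of the quantity `Q`; in particular both limits exist. -/
def HasTotalFlux (Q : ℝ → ℝ) (F : ℝ) : Prop :=
  ∃ a b : ℝ, Tendsto Q atTop (𝓝 a) ∧ Tendsto Q atBot (𝓝 b) ∧ F = a - b

/-- The total flux of the classical center of mass is supertranslation invariant: for a
supertranslation `f = α₀ + ∑ αᵢ X̃^i + f_{ℓ ≥ 2}`, it does not depend on `f_{ℓ ≥ 2}` and it
transforms under the translation `α₀ + ∑ αᵢ X̃^i` by
`α₀ (P^k(+) - P^k(-)) + α_k (E(+) - E(-))`. -/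
def Data.CenterOfMassFluxInvariant (D : Data) : Prop :=
  ∃ (F P : Fin 3 → ℝ) (E : ℝ),
    (∀ k, HasTotalFlux (D.centerOfMass k) (F k)) ∧
    (∀ k, HasTotalFlux (D.momentum k) (P k)) ∧
    HasTotalFlux D.energy E ∧
    ∀ (α₀ : ℝ) (α : Fin 3 → ℝ) (h : S2 → ℝ), SmoothOnS2 h → SupportedInHigherModes h →
      ∀ D' : Data, D.IsSupertranslate (fun x => α₀ + ∑ i, α i * X i x + h x) D' →
        ∀ k, HasTotalFlux (D'.centerOfMass k) (F k + α₀ * P k + α k * E)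

end NullInfinity

end

noncomputable section

namespace NullInfinity

/-! Write N for the news, `H = -2 ∇∇f + Δf σ` for the change of the shear (`shearShift`), `φ = X̃^k
f + ∇X̃^k · ∇f` (`translationKernel`), B for a u-primitive of |N|², and δ for the difference between
the limits at `u → +∞` and `u → -∞`.

Modulo divergences on the sphere, the u-derivative of the center of mass density is `(u/4) X̃^k |N|²
- ½ N_k · div C` plus a quarter of the u-derivative of `C_k · div C`
(`integral_deriv_comDensity_sub`, `centerOfMass_sub`). Under `u = ū + f` the news is merely
translated, while `div C` picks up `N · ∇f + div H`. The square of a symmetric traceless tensor in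
two dimensions is pure trace (`IsSTF.sum_mul_self`), so the flux density is translated and changes
by `-¼ φ |N|² - ½ N_k · div H` (`IsSupertranslate.fluxDensity_eq`). All terms have u-primitives
evaluated at `u + f(x)`, and the limits `u → ±∞` do not see this shift. The flux therefore changes
by the integral of `-¼ φ δB + ¼ (H_k · δ(div C) - δC_k · div H)`. Integration by parts replaces the
bracket by `2 φ δ(div div C)` (`integral_shearShift_mul_divTensor`), and the integrated mass loss
formula `δm = -⅛ δB + ¼ δ(div div C)` (`mass_eq`) turns the result into `∫ 2 φ δm`.

If δm is constant, only `∫ φ = 3 ∫ X̃^k f` matters, which depends on the ℓ = 1 modes alone.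
Conversely, invariance makes δm orthogonal to φ for all higher modes f. The choices `f = X̃^k g`,
summed over k, give `∑ φ = 3 g` (`sum_translationKernel_coord_mul`), so after removal of the low
modes δm is orthogonal to enough test functions to be constant. This direction also needs
supertranslated data to exist (`isSupertranslate_supertranslate`).

Calculus on the sphere is flat calculus on extensions homogeneous of degree 0; its one integral
identity is `∫ ∂_i g = 2 ∫ x_i g` (`integral_pd`). -/

/-- The ambient Euclidean space. -/
abbrev E3 : Type := EuclideanSpace ℝ (Fin 3)

/-! ### Radial extensions and smoothness on `S2` and `ℝ × S2`. -/

instance : Fact (Module.finrank ℝ E3 = 2 + 1) := ⟨finrank_euclideanSpace_fin⟩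

/-- The point `y / ‖y‖` of the sphere, for `y ≠ 0`. -/
def toS2 (y : E3) (hy : y ≠ 0) : S2 :=
  ⟨‖y‖⁻¹ • y, by simp [norm_smul, inv_mul_cancel₀ (norm_ne_zero_iff.mpr hy)]⟩

theorem radialExt_of_ne {g : S2 → ℝ} {y : E3} (hy : y ≠ 0) : radialExt g y = g (toS2 y hy) := by
  simp [radialExt, hy, toS2]

theorem S2.norm_coe (x : S2) : ‖x.1‖ = 1 := by simp

theorem S2.coe_ne_zero (x : S2) : x.1 ≠ 0 := by
  intro h; have := S2.norm_coe x; simp [h] at this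

theorem S2.sum_sq (x : S2) : ∑ i, x.1 i * x.1 i = 1 := by
  have h := EuclideanSpace.norm_sq_eq x.1
  rw [S2.norm_coe] at h
  simp only [Real.norm_eq_abs, sq_abs] at h
  simp only [one_pow] at h
  simpa only [sq] using h.symm

theorem toS2_coe (x : S2) : toS2 x.1 (S2.coe_ne_zero x) = x := by
  apply Subtype.ext; simp [toS2]

theorem radialExt_coe (g : S2 → ℝ) (x : S2) : radialExt g x.1 = g x := by
  rw [radialExt_of_ne (S2.coe_ne_zero x), toS2_coe]

theorem toS2_smul {r : ℝ} (hr : 0 < r) (y : E3) (hy : y ≠ 0) (hry : r • y ≠ 0) :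
    toS2 (r • y) hry = toS2 y hy := by
  apply Subtype.ext
  simp only [toS2, norm_smul, Real.norm_eq_abs, abs_of_pos hr, smul_smul]
  congr 1
  field_simp

theorem radialExt_smul (g : S2 → ℝ) {r : ℝ} (hr : 0 < r) (y : E3) :
    radialExt g (r • y) = radialExt g y := by
  by_cases hy : y = 0
  · simp [hy]
  · have hry : r • y ≠ 0 := smul_ne_zero hr.ne' hy
    rw [radialExt_of_ne hry, radialExt_of_ne hy, toS2_smul hr y hy hry]

/-- Near a nonzero point, the radial projection to the sphere agrees with a smooth map that is
defined on the whole space. -/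
theorem exists_contMDiff_eventuallyEq_toS2 (y₀ : E3) (h₀ : y₀ ≠ 0) :
    ∃ ν : E3 → S2, ContMDiff 𝓘(ℝ, E3) (𝓡 2) ∞ ν ∧ ∀ᶠ y in 𝓝 y₀, ∃ hy : y ≠ 0, ν y = toS2 y hy := by
  have hpos : 0 < ‖y₀‖ := norm_pos_iff.mpr h₀
  -- Cutting off the displacement `y - y₀` beyond distance ‖y₀‖/2 keeps φ away from 0 everywhere,
  -- while φ is the identity near `y₀`; normalizing φ is then globally smooth.
  let β : ContDiffBump y₀ := ⟨‖y₀‖ / 4, ‖y₀‖ / 2, by linarith, by linarith⟩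
  let φ : E3 → E3 := fun y => y₀ + β y • (y - y₀)
  have hφ : ContDiff ℝ ∞ φ := contDiff_const.add (β.contDiff.smul (contDiff_id.sub contDiff_const))
  have hφ0 : ∀ y, φ y ≠ 0 := by
    intro y hy
    have h1 : ‖β y • (y - y₀)‖ < ‖y₀‖ := by
      by_cases hb : y ∈ Metric.ball y₀ (‖y₀‖ / 2)
      · rw [norm_smul, Real.norm_eq_abs, abs_of_nonneg β.nonneg]
        have h2 : ‖y - y₀‖ < ‖y₀‖ / 2 := by simpa [dist_eq_norm] using hb
        have h3 : β y ≤ 1 := β.le_one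
        nlinarith [norm_nonneg (y - y₀), β.nonneg (x := y)]
      · have : β y = 0 := by
          apply β.zero_of_le_dist
          simpa using hb
        simpa [this] using hpos
    have h2 := congrArg norm (eq_neg_of_add_eq_zero_left hy)
    rw [norm_neg] at h2
    linarith
  have hs : ∀ y, ‖φ y‖⁻¹ • φ y ∈ Metric.sphere (0 : E3) 1 := by
    intro y
    simp [norm_smul, inv_mul_cancel₀ (norm_ne_zero_iff.mpr (hφ0 y))]
  have hsm : ContDiff ℝ ∞ (fun y => ‖φ y‖⁻¹ • φ y) :=
    (((hφ.norm ℝ hφ0).inv fun y => norm_ne_zero_iff.mpr (hφ0 y))).smul hφ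
  refine ⟨Set.codRestrict _ _ hs, hsm.contMDiff.codRestrict_sphere hs, ?_⟩
  have hball : Metric.ball y₀ (‖y₀‖ / 4) ∈ 𝓝 y₀ := Metric.ball_mem_nhds _ (by linarith)
  filter_upwards [hball, isOpen_compl_singleton.mem_nhds h₀] with y hy hy0
  refine ⟨hy0, Subtype.ext ?_⟩
  have hβ : β y = 1 := β.one_of_mem_closedBall (Metric.ball_subset_closedBall hy)
  have hφy : φ y = y := by simp [φ, hβ]
  simp [hφy, toS2]

/-- A `C^n` function on the sphere has a `C^n` extension that is constant along rays. -/
theorem contDiffAt_radialExt {n : ℕ∞} {g : S2 → ℝ} (hg : ContMDiff (𝓡 2) 𝓘(ℝ, ℝ) n g)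
    {y : E3} (hy : y ≠ 0) : ContDiffAt ℝ n (radialExt g) y := by
  obtain ⟨ν, hν, hev⟩ := exists_contMDiff_eventuallyEq_toS2 y hy
  have h1 : ContDiff ℝ n (g ∘ ν) :=
    (hg.comp (hν.of_le (by exact_mod_cast le_top))).contDiff
  refine h1.contDiffAt.congr_of_eventuallyEq ?_
  filter_upwards [hev] with z ⟨hz, hz'⟩
  rw [radialExt_of_ne hz, ← hz']; rfl

/-- The set `ℝ × (ℝ³ ∖ {0})`. -/
def punctured : Set (ℝ × E3) := {p | p.2 ≠ 0}

theorem isOpen_punctured : IsOpen punctured := isOpen_ne.preimage continuous_snd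

/-- Smoothness on the manifold becomes smoothness on an open subset of a vector space: one direction
composes with the map of `exists_contMDiff_eventuallyEq_toS2`, the other restricts to the sphere. It
lets all derivatives in (u, x) be treated as flat Fréchet derivatives. -/
theorem smoothOnScri_iff {g : ℝ → S2 → ℝ} :
    SmoothOnScri g ↔ ContDiffOn ℝ ∞ (fun p : ℝ × E3 => radialExt (g p.1) p.2) punctured := by
  constructor
  · intro hg p hp
    obtain ⟨ν, hν, hev⟩ := exists_contMDiff_eventuallyEq_toS2 p.2 hp
    have h1 : ContMDiff 𝓘(ℝ, ℝ × E3) (𝓘(ℝ, ℝ).prod (𝓡 2)) ∞ (fun p : ℝ × E3 => (p.1, ν p.2)) :=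
      ContMDiff.prodMk contDiff_fst.contMDiff (hν.comp contDiff_snd.contMDiff)
    have h2 : ContDiff ℝ ∞ (fun p : ℝ × E3 => g p.1 (ν p.2)) := (ContMDiff.comp hg h1).contDiff
    refine (h2.contDiffAt.congr_of_eventuallyEq ?_).contDiffWithinAt
    filter_upwards [continuous_snd.continuousAt.eventually hev] with z ⟨hz, hz'⟩
    rw [radialExt_of_ne hz, ← hz']
  · intro h
    have hc : ContMDiff (𝓘(ℝ, ℝ).prod (𝓡 2)) 𝓘(ℝ, ℝ × E3) ∞
        (fun p : ℝ × S2 => (p.1, (p.2 : E3))) :=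
      ContMDiff.prodMk_space contMDiff_fst (contMDiff_coe_sphere.comp contMDiff_snd)
    have h2 := h.contMDiffOn.comp_contMDiff hc fun p => S2.coe_ne_zero p.2
    refine h2.congr fun p => ?_
    exact (radialExt_coe (g p.1) p.2).symm

theorem SmoothOnScri.contDiffAt {g : ℝ → S2 → ℝ} (hg : SmoothOnScri g) (u : ℝ) {y : E3}
    (hy : y ≠ 0) : ContDiffAt ℝ ∞ (fun p : ℝ × E3 => radialExt (g p.1) p.2) (u, y) :=
  (smoothOnScri_iff.1 hg).contDiffAt (isOpen_punctured.mem_nhds hy)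

theorem SmoothOnS2.const_u {g : S2 → ℝ} (hg : SmoothOnS2 g) : SmoothOnScri fun _ => g :=
  ContMDiff.comp hg contMDiff_snd

theorem SmoothOnScri.slice {g : ℝ → S2 → ℝ} (hg : SmoothOnScri g) (u : ℝ) : SmoothOnS2 (g u) :=
  ContMDiff.comp (g := fun p : ℝ × S2 => g p.1 p.2) hg (contMDiff_const.prodMk contMDiff_id)

/-- Continuously differentiable functions on the sphere. -/
abbrev C1 (g : S2 → ℝ) : Prop := ContMDiff (𝓡 2) 𝓘(ℝ, ℝ) 1 g

theorem SmoothOnS2.c1 {g : S2 → ℝ} (hg : SmoothOnS2 g) : C1 g := hg.of_le (by norm_cast)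

theorem C1.differentiableAt {g : S2 → ℝ} (hg : C1 g) {y : E3} (hy : y ≠ 0) :
    DifferentiableAt ℝ (radialExt g) y :=
  (contDiffAt_radialExt (n := 1) (by exact_mod_cast hg) hy).differentiableAt (by norm_num)

theorem C1.continuous {g : S2 → ℝ} (hg : C1 g) : Continuous g := ContMDiff.continuous hg

section Algebra

variable {g h : S2 → ℝ}

theorem C1.add (hg : C1 g) (hh : C1 h) : C1 fun x => g x + h x := ContMDiff.add hg hh
theorem C1.sub (hg : C1 g) (hh : C1 h) : C1 fun x => g x - h x := ContMDiff.sub hg hh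
theorem C1.neg (hg : C1 g) : C1 fun x => - g x := ContMDiff.neg hg
theorem C1.mul (hg : C1 g) (hh : C1 h) : C1 fun x => g x * h x := ContMDiff.mul hg hh
theorem C1.const (c : ℝ) : C1 fun _ => c := contMDiff_const
theorem C1.sum {ι : Type*} {s : Finset ι} {g : ι → S2 → ℝ} (hg : ∀ i ∈ s, C1 (g i)) :
    C1 fun x => ∑ i ∈ s, g i x := contMDiff_finsetSum hg

theorem SmoothOnS2.add (hg : SmoothOnS2 g) (hh : SmoothOnS2 h) : SmoothOnS2 fun x => g x + h x :=
  ContMDiff.add hg hh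
theorem SmoothOnS2.sub (hg : SmoothOnS2 g) (hh : SmoothOnS2 h) : SmoothOnS2 fun x => g x - h x :=
  ContMDiff.sub hg hh
theorem SmoothOnS2.mul (hg : SmoothOnS2 g) (hh : SmoothOnS2 h) : SmoothOnS2 fun x => g x * h x :=
  ContMDiff.mul hg hh
theorem SmoothOnS2.const (c : ℝ) : SmoothOnS2 fun _ => c := contMDiff_const
theorem SmoothOnS2.sum {ι : Type*} {s : Finset ι} {g : ι → S2 → ℝ}
    (hg : ∀ i ∈ s, SmoothOnS2 (g i)) : SmoothOnS2 fun x => ∑ i ∈ s, g i x := contMDiff_finsetSum hg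

theorem smoothOnS2_X (k : Fin 3) : SmoothOnS2 (X k) :=
  (EuclideanSpace.proj (𝕜 := ℝ) k : E3 →L[ℝ] ℝ).contDiff.contMDiff.comp contMDiff_coe_sphere

theorem smoothOnS2_coord (k : Fin 3) : SmoothOnS2 fun x => x.1 k := smoothOnS2_X k

end Algebra

section Scri

variable {g h : ℝ → S2 → ℝ}

theorem SmoothOnScri.add (hg : SmoothOnScri g) (hh : SmoothOnScri h) :
    SmoothOnScri fun u x => g u x + h u x := ContMDiff.add hg hh
theorem SmoothOnScri.sub (hg : SmoothOnScri g) (hh : SmoothOnScri h) :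
    SmoothOnScri fun u x => g u x - h u x := ContMDiff.sub hg hh
theorem SmoothOnScri.mul (hg : SmoothOnScri g) (hh : SmoothOnScri h) :
    SmoothOnScri fun u x => g u x * h u x := ContMDiff.mul hg hh
theorem SmoothOnScri.const (c : ℝ) : SmoothOnScri fun _ _ => c := contMDiff_const
theorem SmoothOnScri.sum {ι : Type*} {s : Finset ι} {g : ι → ℝ → S2 → ℝ}
    (hg : ∀ i ∈ s, SmoothOnScri (g i)) : SmoothOnScri fun u x => ∑ i ∈ s, g i u x :=
  contMDiff_finsetSum hg
theorem smoothOnScri_coord (k : Fin 3) : SmoothOnScri fun _ x => x.1 k :=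
  (smoothOnS2_coord k).const_u
theorem smoothOnScri_u : SmoothOnScri fun u _ => u := contMDiff_fst
theorem SmoothOnScri.continuous (hg : SmoothOnScri g) : Continuous fun p : ℝ × S2 => g p.1 p.2 :=
  ContMDiff.continuous hg

theorem SmoothOnScri.shift {f : S2 → ℝ} (hg : SmoothOnScri g) (hf : SmoothOnS2 f) :
    SmoothOnScri fun u x => g (u + f x) x :=
  ContMDiff.comp hg ((contMDiff_fst.add (ContMDiff.comp hf contMDiff_snd)).prodMk contMDiff_snd)

end Scri

/-! ### Tangential derivatives of functions on the sphere. -/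

section PD

variable {g h : S2 → ℝ}

theorem pd_add (i : Fin 3) (hg : C1 g) (hh : C1 h) (x : S2) :
    pd i (fun y => g y + h y) x = pd i g x + pd i h x := by
  have : radialExt (fun y => g y + h y) = fun y => radialExt g y + radialExt h y := by
    funext y; by_cases hy : y = 0 <;> simp [radialExt, hy]
  simp only [pd, this]
  rw [fderiv_fun_add (hg.differentiableAt (S2.coe_ne_zero x)) (hh.differentiableAt (S2.coe_ne_zero x))]
  rfl

theorem pd_mul (i : Fin 3) (hg : C1 g) (hh : C1 h) (x : S2) :
    pd i (fun y => g y * h y) x = pd i g x * h x + g x * pd i h x := by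
  have : radialExt (fun y => g y * h y) = fun y => radialExt g y * radialExt h y := by
    funext y; by_cases hy : y = 0 <;> simp [radialExt, hy]
  simp only [pd, this]
  rw [fderiv_fun_mul (hg.differentiableAt (S2.coe_ne_zero x)) (hh.differentiableAt (S2.coe_ne_zero x))]
  simp [radialExt_coe]
  ring

theorem pd_const (i : Fin 3) (c : ℝ) (x : S2) : pd i (fun _ => c) x = 0 := by
  have : radialExt (fun _ => c) =ᶠ[𝓝 x.1] fun _ => c := by
    filter_upwards [isOpen_compl_singleton.mem_nhds (S2.coe_ne_zero x)] with y hy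
    have : y ≠ 0 := hy
    simp [radialExt, this]
  simp [pd, this.fderiv_eq]

theorem pd_const_mul (i : Fin 3) (c : ℝ) (hg : C1 g) (x : S2) :
    pd i (fun y => c * g y) x = c * pd i g x := by
  rw [pd_mul i (C1.const c) hg, pd_const]; ring

theorem pd_neg (i : Fin 3) (hg : C1 g) (x : S2) : pd i (fun y => - g y) x = - pd i g x := by
  have := pd_const_mul i (-1) hg x
  simpa using this

theorem pd_sub (i : Fin 3) (hg : C1 g) (hh : C1 h) (x : S2) :
    pd i (fun y => g y - h y) x = pd i g x - pd i h x := by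
  simp only [sub_eq_add_neg]
  rw [pd_add i hg hh.neg, pd_neg i hh]

theorem pd_sum {ι : Type*} (s : Finset ι) (i : Fin 3) {g : ι → S2 → ℝ} (hg : ∀ a ∈ s, C1 (g a))
    (x : S2) : pd i (fun y => ∑ a ∈ s, g a y) x = ∑ a ∈ s, pd i (g a) x := by
  classical
  induction s using Finset.induction_on with
  | empty => simpa using pd_const i 0 x
  | insert a s ha ih =>
    simp only [Finset.sum_insert ha]
    rw [pd_add i (hg a (Finset.mem_insert_self a s))
      (C1.sum fun b hb => hg b (Finset.mem_insert_of_mem hb)),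
      ih fun b hb => hg b (Finset.mem_insert_of_mem hb)]

/-- Euler's relation: the extension is constant along rays, so its radial derivative vanishes. -/
theorem sum_coord_mul_pd (hg : C1 g) (x : S2) : ∑ i, x.1 i * pd i g x = 0 := by
  have hd := hg.differentiableAt (S2.coe_ne_zero x)
  have h1 : ∑ i, x.1 i * pd i g x = fderiv ℝ (radialExt g) x.1 x.1 := by
    have h := congrArg (fderiv ℝ (radialExt g) x.1)
      ((EuclideanSpace.basisFun (Fin 3) ℝ).sum_repr x.1)
    rw [map_sum] at h
    simpa [pd] using h
  rw [h1]
  have h2 : HasDerivAt (fun t : ℝ => radialExt g (x.1 + t • x.1)) (fderiv ℝ (radialExt g) x.1 x.1) 0 :=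
    hd.hasFDerivAt.hasLineDerivAt x.1
  have h3 : (fun t : ℝ => radialExt g (x.1 + t • x.1)) =ᶠ[𝓝 0] fun _ => g x := by
    filter_upwards [Ioi_mem_nhds (show (-1 : ℝ) < 0 by norm_num)] with t ht
    have : x.1 + t • x.1 = (1 + t) • x.1 := by rw [add_smul, one_smul]
    rw [this, radialExt_smul g (by linarith [Set.mem_Ioi.1 ht]), radialExt_coe]
  exact h2.unique ((hasDerivAt_const _ _).congr_of_eventuallyEq h3)

theorem pd_coord (i j : Fin 3) (x : S2) : pd i (fun y => y.1 j) x = σ x i j := by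
  have h0 := S2.coe_ne_zero x
  have h1 : radialExt (fun y => y.1 j) =ᶠ[𝓝 x.1] fun y => ‖y‖⁻¹ * y j := by
    filter_upwards [isOpen_compl_singleton.mem_nhds h0] with y hy
    rw [radialExt_of_ne hy]; simp [toS2]
  have h2 : HasFDerivAt (fun y : E3 => ‖y‖) (innerSL ℝ x.1) x.1 := by
    have := (hasStrictFDerivAt_norm_sq x.1).hasFDerivAt.sqrt (by simp)
    simp only [Real.sqrt_sq (norm_nonneg _)] at this
    refine this.congr_fderiv ?_
    ext v; simp
  have h3 : HasFDerivAt (fun y : E3 => ‖y‖⁻¹) (-(innerSL ℝ x.1)) x.1 := by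
    refine ((hasDerivAt_inv (by simp : ‖x.1‖ ≠ 0)).comp_hasFDerivAt x.1 h2).congr_fderiv ?_
    ext v; simp
  have h4 : HasFDerivAt (fun y : E3 => y j) (EuclideanSpace.proj (𝕜 := ℝ) j : E3 →L[ℝ] ℝ) x.1 :=
    (EuclideanSpace.proj (𝕜 := ℝ) j : E3 →L[ℝ] ℝ).hasFDerivAt
  have h5 : HasFDerivAt (fun y : E3 => ‖y‖⁻¹ * y j) _ x.1 := h3.mul h4
  rw [pd, h1.fderiv_eq, h5.fderiv]
  simp [σ, EuclideanSpace.inner_single_right, eq_comm]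
  ring

end PD

/-! ### Derivatives in u and x together, and their commutators. -/

/-- The homogeneous extension of a function on `ℝ × S²`. -/
def scriExt (g : ℝ → S2 → ℝ) (p : ℝ × E3) : ℝ := radialExt (g p.1) p.2

section

variable {g : ℝ → S2 → ℝ}

theorem SmoothOnScri.contDiffAt_scriExt (hg : SmoothOnScri g) (u : ℝ) {y : E3} (hy : y ≠ 0) :
    ContDiffAt ℝ ∞ (scriExt g) (u, y) := hg.contDiffAt u hy

theorem SmoothOnScri.differentiableAt (hg : SmoothOnScri g) (u : ℝ) {y : E3} (hy : y ≠ 0) :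
    DifferentiableAt ℝ (scriExt g) (u, y) :=
  (hg.contDiffAt_scriExt u hy).differentiableAt (by norm_num)

theorem SmoothOnScri.hasFDerivAt_radialExt (hg : SmoothOnScri g) (u : ℝ) {y : E3} (hy : y ≠ 0) :
    HasFDerivAt (radialExt (g u))
      ((fderiv ℝ (scriExt g) (u, y)).comp (ContinuousLinearMap.inr ℝ ℝ E3)) y :=
  (hg.differentiableAt u hy).hasFDerivAt.comp y (hasFDerivAt_prodMk_right u y)

theorem SmoothOnScri.hasDerivAt_radialExt (hg : SmoothOnScri g) (u : ℝ) {y : E3} (hy : y ≠ 0) :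
    HasDerivAt (fun s => radialExt (g s) y) (fderiv ℝ (scriExt g) (u, y) (1, 0)) u := by
  have h := (hg.differentiableAt u hy).hasFDerivAt.comp_hasDerivAt u
    ((hasDerivAt_id u).prodMk (hasDerivAt_const u y))
  exact h

theorem SmoothOnScri.hasDerivAt (hg : SmoothOnScri g) (u : ℝ) (x : S2) :
    HasDerivAt (fun s => g s x) (deriv (fun s => g s x) u) u := by
  have h := hg.hasDerivAt_radialExt u (S2.coe_ne_zero x)
  simp only [radialExt_coe] at h
  exact h.differentiableAt.hasDerivAt

theorem SmoothOnScri.deriv_eq (hg : SmoothOnScri g) (u : ℝ) (x : S2) :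
    deriv (fun s => g s x) u = fderiv ℝ (scriExt g) (u, x.1) (1, 0) := by
  have h := hg.hasDerivAt_radialExt u (S2.coe_ne_zero x)
  simp only [radialExt_coe] at h
  exact h.deriv

theorem SmoothOnScri.pd_eq (hg : SmoothOnScri g) (i : Fin 3) (u : ℝ) (x : S2) :
    pd i (g u) x = fderiv ℝ (scriExt g) (u, x.1) (0, EuclideanSpace.single i 1) := by
  rw [pd, (hg.hasFDerivAt_radialExt u (S2.coe_ne_zero x)).fderiv]
  rfl

/-- The flat gradient of a function homogeneous of degree 0 has degree -1; the factor ‖y‖ restores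
degree 0. -/
theorem radialExt_pd (i : Fin 3) (g : S2 → ℝ) {y : E3} (hy : y ≠ 0) :
    radialExt (pd i g) y = ‖y‖ * fderiv ℝ (radialExt g) y (EuclideanSpace.single i 1) := by
  have hr : 0 < ‖y‖ := norm_pos_iff.mpr hy
  rw [radialExt_of_ne hy, pd]
  have h1 : radialExt g = fun z => radialExt g (‖y‖ • z) := by
    funext z; rw [radialExt_smul g hr]
  conv_lhs => rw [h1]
  rw [fderiv_comp_smul]
  have h2 : ‖y‖ • (toS2 y hy).1 = y := by
    simp [toS2, smul_smul, hr.ne']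
  rw [h2]; rfl

theorem scriExt_pd (hg : SmoothOnScri g) (i : Fin 3) {p : ℝ × E3} (hp : p ∈ punctured) :
    scriExt (fun u => pd i (g u)) p
      = ‖p.2‖ * fderiv ℝ (scriExt g) p (0, EuclideanSpace.single i 1) := by
  rw [scriExt, radialExt_pd i _ hp, (hg.hasFDerivAt_radialExt p.1 hp).fderiv]
  rfl

theorem scriExt_deriv (hg : SmoothOnScri g) {p : ℝ × E3} (hp : p ∈ punctured) :
    scriExt (fun u x => deriv (fun s => g s x) u) p = fderiv ℝ (scriExt g) p (1, 0) := by
  have h := (hg.hasDerivAt_radialExt p.1 hp).deriv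
  have hp' : p.2 ≠ 0 := hp
  simp only [scriExt, radialExt_of_ne hp'] at h ⊢
  exact h

theorem SmoothOnScri.contDiffOn_fderiv (hg : SmoothOnScri g) (v : ℝ × E3) :
    ContDiffOn ℝ ∞ (fun p => fderiv ℝ (scriExt g) p v) punctured :=
  ((smoothOnScri_iff.1 hg).fderiv_of_isOpen isOpen_punctured (by norm_num)).clm_apply
    contDiffOn_const

theorem SmoothOnScri.pd (hg : SmoothOnScri g) (i : Fin 3) : SmoothOnScri fun u => pd i (g u) := by
  rw [smoothOnScri_iff]
  have hn : ContDiffOn ℝ ∞ (fun p : ℝ × E3 => ‖p.2‖) punctured :=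
    fun p hp => (contDiff_snd.contDiffAt.norm ℝ hp).contDiffWithinAt
  exact (hn.mul (hg.contDiffOn_fderiv _)).congr fun p hp => scriExt_pd hg i hp

theorem SmoothOnScri.deriv (hg : SmoothOnScri g) :
    SmoothOnScri fun u x => deriv (fun s => g s x) u := by
  rw [smoothOnScri_iff]
  exact (hg.contDiffOn_fderiv _).congr fun p hp => scriExt_deriv hg hp

theorem SmoothOnS2.pd {g : S2 → ℝ} (hg : SmoothOnS2 g) (i : Fin 3) : SmoothOnS2 (pd i g) :=
  (hg.const_u.pd i).slice 0

theorem SmoothOnScri.second_fderiv (hg : SmoothOnScri g) (u : ℝ) {y : E3} (hy : y ≠ 0)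
    (v w : ℝ × E3) :
    fderiv ℝ (fun p => fderiv ℝ (scriExt g) p v) (u, y) w
      = fderiv ℝ (fun p => fderiv ℝ (scriExt g) p w) (u, y) v := by
  have hc := hg.contDiffAt_scriExt u hy
  have hd : DifferentiableAt ℝ (fderiv ℝ (scriExt g)) (u, y) :=
    (hc.fderiv_right (m := 1) (by norm_cast)).differentiableAt (by norm_num)
  have hs := hc.isSymmSndFDerivAt (by simp; norm_cast)
  rw [fderiv_clm_apply hd (by fun_prop), fderiv_clm_apply hd (by fun_prop)]
  simp
  exact hs w v

/-- Symmetry of the flat second derivative; the factor ‖y‖ of `radialExt_pd` does not depend on u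
and passes through. -/
theorem SmoothOnScri.deriv_pd (hg : SmoothOnScri g) (i : Fin 3) (u : ℝ) (x : S2) :
    _root_.deriv (fun s => NullInfinity.pd i (g s) x) u
      = NullInfinity.pd i (fun y => _root_.deriv (fun s => g s y) u) x := by
  have h0 := S2.coe_ne_zero x
  have hmem : punctured ∈ 𝓝 (u, x.1) := isOpen_punctured.mem_nhds h0
  rw [(hg.pd i).deriv_eq, hg.deriv.pd_eq]
  have h1 : scriExt (fun u x => _root_.deriv (fun s => g s x) u)
      =ᶠ[𝓝 (u, x.1)] fun p => fderiv ℝ (scriExt g) p (1, 0) := by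
    filter_upwards [hmem] with p hp using scriExt_deriv hg hp
  have h2 : scriExt (fun u => NullInfinity.pd i (g u))
      =ᶠ[𝓝 (u, x.1)] fun p => ‖p.2‖ * fderiv ℝ (scriExt g) p (0, EuclideanSpace.single i 1) := by
    filter_upwards [hmem] with p hp using scriExt_pd hg i hp
  rw [h1.fderiv_eq, h2.fderiv_eq, hg.second_fderiv u h0]
  have hd : DifferentiableAt ℝ
      (fun p => fderiv ℝ (scriExt g) p (0, EuclideanSpace.single i 1)) (u, x.1) :=
    ((hg.contDiffOn_fderiv _).contDiffAt hmem).differentiableAt (by norm_num)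
  have hn : DifferentiableAt ℝ (fun p : ℝ × E3 => ‖p.2‖) (u, x.1) :=
    differentiableAt_snd.norm ℝ h0
  rw [fderiv_fun_mul hn hd]
  have h3 : fderiv ℝ (fun p : ℝ × E3 => ‖p.2‖) (u, x.1) (1, 0) = 0 := by
    have : HasFDerivAt (fun p : ℝ × E3 => ‖p.2‖)
        ((fderiv ℝ (fun y : E3 => ‖y‖) x.1).comp (ContinuousLinearMap.snd ℝ ℝ E3)) (u, x.1) :=
      HasFDerivAt.comp (u, x.1) ((differentiableAt_id.norm ℝ h0).hasFDerivAt) hasFDerivAt_snd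
    rw [this.fderiv]; simp
  simp [h3]

/-- The flat derivatives commute, but differentiating the factor ‖y‖ of `radialExt_pd` leaves an
extra `x_j ∂_i g`, and its antisymmetrization is the commutator. -/
theorem pd_comm {g : S2 → ℝ} (hg : SmoothOnS2 g) (i j : Fin 3) (x : S2) :
    pd j (pd i g) x - pd i (pd j g) x = x.1 j * pd i g x - x.1 i * pd j g x := by
  have h0 := S2.coe_ne_zero x
  have hG := hg.const_u
  have key : ∀ i j, pd j (pd i g) x = x.1 j * pd i g x
      + fderiv ℝ (fun p => fderiv ℝ (scriExt fun _ => g) p (0, EuclideanSpace.single i 1)) (0, x.1)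
          (0, EuclideanSpace.single j 1) := by
    intro i j
    have hmem : punctured ∈ 𝓝 ((0 : ℝ), x.1) := isOpen_punctured.mem_nhds h0
    rw [(hG.pd i).pd_eq j 0 x]
    have h2 : scriExt (fun u => NullInfinity.pd i ((fun _ => g) u))
        =ᶠ[𝓝 ((0 : ℝ), x.1)] fun p => ‖p.2‖ *
          fderiv ℝ (scriExt fun _ => g) p (0, EuclideanSpace.single i 1) := by
      filter_upwards [hmem] with p hp using scriExt_pd hG i hp
    have hd : DifferentiableAt ℝ
        (fun p => fderiv ℝ (scriExt fun _ => g) p (0, EuclideanSpace.single i 1)) ((0 : ℝ), x.1) :=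
      ((hG.contDiffOn_fderiv _).contDiffAt hmem).differentiableAt (by norm_num)
    have hn : HasFDerivAt (fun p : ℝ × E3 => ‖p.2‖)
        ((innerSL ℝ x.1).comp (ContinuousLinearMap.snd ℝ ℝ E3)) ((0 : ℝ), x.1) := by
      have := (hasStrictFDerivAt_norm_sq x.1).hasFDerivAt.sqrt (by simp)
      simp only [Real.sqrt_sq (norm_nonneg _)] at this
      refine (HasFDerivAt.comp ((0 : ℝ), x.1) this hasFDerivAt_snd).congr_fderiv ?_
      ext v <;> simp
    have hm : HasFDerivAt (fun p : ℝ × E3 => ‖p.2‖ *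
        fderiv ℝ (scriExt fun _ => g) p (0, EuclideanSpace.single i 1)) _ _ := hn.mul hd.hasFDerivAt
    rw [h2.fderiv_eq, hm.fderiv]
    rw [hG.pd_eq i 0 x]
    simp [EuclideanSpace.inner_single_right]
    ring
  rw [key i j, key j i, hG.second_fderiv 0 h0]
  ring

theorem SmoothOnScri.pd_shift (hg : SmoothOnScri g) {f : S2 → ℝ} (hf : C1 f) (i : Fin 3)
    (u : ℝ) (x : S2) :
    NullInfinity.pd i (fun y => g (u + f y) y) x
      = NullInfinity.pd i (g (u + f x)) x
        + _root_.deriv (fun s => g s x) (u + f x) * NullInfinity.pd i f x := by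
  have h0 := S2.coe_ne_zero x
  have h1 : radialExt (fun y => g (u + f y) y)
      =ᶠ[𝓝 x.1] fun y => scriExt g (u + radialExt f y, y) := by
    filter_upwards [isOpen_compl_singleton.mem_nhds h0] with y hy
    have hy' : y ≠ 0 := hy
    simp [scriExt, radialExt_of_ne hy']
  have h2 : HasFDerivAt (fun y => (u + radialExt f y, y))
      ((fderiv ℝ (radialExt f) x.1).prod (ContinuousLinearMap.id ℝ E3)) x.1 :=
    ((hf.differentiableAt h0).hasFDerivAt.const_add u).prodMk (hasFDerivAt_id x.1)
  have h3 : HasFDerivAt (scriExt g) (fderiv ℝ (scriExt g) (u + f x, x.1))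
      (u + radialExt f x.1, x.1) := by
    rw [radialExt_coe]; exact (hg.differentiableAt _ h0).hasFDerivAt
  have h5 : HasFDerivAt (fun y => scriExt g (u + radialExt f y, y)) _ x.1 :=
    HasFDerivAt.comp x.1 (g := scriExt g) (f := fun y => (u + radialExt f y, y)) h3 h2
  rw [NullInfinity.pd, h1.fderiv_eq, h5.fderiv, hg.pd_eq, hg.deriv_eq]
  simp only [NullInfinity.pd, ContinuousLinearMap.comp_apply, ContinuousLinearMap.prod_apply,
    ContinuousLinearMap.id_apply]
  have h4 : ((fderiv ℝ (radialExt f) x.1) (EuclideanSpace.single i 1), EuclideanSpace.single i 1)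
      = ((0 : ℝ), (EuclideanSpace.single i 1 : E3))
        + ((fderiv ℝ (radialExt f) x.1) (EuclideanSpace.single i 1)) • ((1 : ℝ), (0 : E3)) := by
    simp
  rw [h4, map_add, map_smul]
  simp [mul_comm]

end

/-! ### The divergence theorem on the sphere. -/

theorem C1.continuous_pd {g : S2 → ℝ} (hg : C1 g) (i : Fin 3) : Continuous (pd i g) := by
  have h : ContinuousOn (fun y => fderiv ℝ (radialExt g) y (EuclideanSpace.single i 1)) {y : E3 | y ≠ 0} := by
    have h1 : ContDiffOn ℝ 1 (radialExt g) {y : E3 | y ≠ 0} := fun y hy =>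
      (contDiffAt_radialExt (n := 1) (by exact_mod_cast hg) hy).contDiffWithinAt
    exact (h1.continuousOn_fderiv_of_isOpen isOpen_ne (by norm_num)).clm_apply continuousOn_const
  exact h.comp_continuous continuous_subtype_val fun x => S2.coe_ne_zero x

theorem Continuous.integrable_area {g : S2 → ℝ} (hg : Continuous g) : Integrable g area :=
  hg.integrable_of_hasCompactSupport (HasCompactSupport.of_compactSpace g)

/-- In polar coordinates the volume is the product of `area` and r² dr, so a radial factor splits
off from a factor of degree 0. -/
theorem integral_polar (h : ℝ → ℝ) (k : S2 → ℝ) :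
    ∫ y : E3, h ‖y‖ * radialExt k y
      = (∫ r : Set.Ioi (0 : ℝ), h r ∂Measure.volumeIoiPow 2) * ∫ x, k x ∂area := by
  have hd : Module.finrank ℝ E3 - 1 = 2 := by simp
  calc ∫ y : E3, h ‖y‖ * radialExt k y
      = ∫ y : ({(0)}ᶜ : Set E3), h ‖y.1‖ * radialExt k y.1 ∂((volume : Measure E3).comap (↑)) := by
        rw [integral_subtype_comap (measurableSet_singleton _).compl
          fun y => h ‖y‖ * radialExt k y, MeasureTheory.restrict_compl_singleton]
    _ = ∫ p : S2 × Set.Ioi (0 : ℝ), k p.1 * h p.2 ∂area.prod (.volumeIoiPow 2) := by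
        rw [← hd, ← (volume : Measure E3).measurePreserving_homeomorphUnitSphereProd.integral_comp
          (Homeomorph.measurableEmbedding _)]
        refine integral_congr_ae (ae_of_all _ fun y => ?_)
        have hy : y.1 ≠ 0 := y.2
        simp only [homeomorphUnitSphereProd_apply_snd_coe, radialExt_of_ne hy]
        rw [mul_comm]
        congr 2
        exact Subtype.ext (by simp [toS2, homeomorphUnitSphereProd, homeomorphSphereProd])
    _ = _ := by rw [integral_prod_mul (fun x => k x) (fun r : Set.Ioi (0:ℝ) => h r), mul_comm]

/-- Flat integration by parts of a radial cutoff against the radial extension of g. The gradient of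
the cutoff points along y, which produces `x_i g`; the gradient of the extension produces `∂_i g`.
The radial integrals a and b do not depend on g and need not be computed. -/
theorem exists_integral_pd_relation : ∃ a b : ℝ, 0 < b ∧ ∀ (g : S2 → ℝ), C1 g → ∀ i,
    b * ∫ x, pd i g x ∂area = a * ∫ x, x.1 i * g x ∂area := by
  -- As a function of ‖y‖² the cutoff lives in [1/2, 3/2], away from the origin, where the extension
  -- is singular.
  let ψ : ContDiffBump (1 : ℝ) := ⟨1 / 4, 1 / 2, by norm_num, by norm_num⟩
  let Φ : E3 → ℝ := fun y => ψ (‖y‖ ^ 2)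
  have hΦ : ContDiff ℝ ∞ Φ := ψ.contDiff.comp (contDiff_norm_sq ℝ)
  have hsub : Function.support Φ ⊆ {y : E3 | 1 / 2 ≤ ‖y‖ ^ 2 ∧ ‖y‖ ^ 2 ≤ 3 / 2} := by
    intro y hy
    have : ‖y‖ ^ 2 ∈ Function.support ψ := hy
    rw [ψ.support_eq] at this
    have h1 : |‖y‖ ^ 2 - 1| < 1 / 2 := by
      rwa [Metric.mem_ball, Real.dist_eq] at this
    rw [abs_lt] at h1
    constructor <;> linarith
  have hcl : IsClosed {y : E3 | 1 / 2 ≤ ‖y‖ ^ 2 ∧ ‖y‖ ^ 2 ≤ 3 / 2} :=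
    (isClosed_le continuous_const (continuous_norm.pow 2)).inter
      (isClosed_le (continuous_norm.pow 2) continuous_const)
  have hts : tsupport Φ ⊆ {y : E3 | 1 / 2 ≤ ‖y‖ ^ 2 ∧ ‖y‖ ^ 2 ≤ 3 / 2} :=
    closure_minimal hsub hcl
  have hts0 : ∀ y ∈ tsupport Φ, y ≠ 0 := by
    rintro y hy rfl
    have := (hts hy).1
    norm_num at this
  have hcomp : HasCompactSupport Φ := by
    refine HasCompactSupport.of_support_subset_isCompact (isCompact_closedBall (0 : E3) 2) ?_
    intro y hy
    have := (hsub hy).2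
    rw [mem_closedBall_zero_iff]
    nlinarith [norm_nonneg y]
  have hcont : ∀ q : E3 → ℝ, (∀ y, y ≠ 0 → ContinuousAt q y) →
      Continuous fun y => Φ y * q y := by
    intro q hq
    refine continuous_of_tsupport fun y hy => ?_
    exact hΦ.continuous.continuousAt.mul (hq y (hts0 y (tsupport_mul_subset_left hy)))
  let h1 : ℝ → ℝ := fun r => ψ (r ^ 2) * r⁻¹
  let h2 : ℝ → ℝ := fun r => deriv ψ (r ^ 2) * (2 * r)
  let b := ∫ r : Set.Ioi (0 : ℝ), h1 r ∂Measure.volumeIoiPow 2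
  let a := - ∫ r : Set.Ioi (0 : ℝ), h2 r ∂Measure.volumeIoiPow 2
  refine ⟨a, b, ?_, ?_⟩
  · have hp : 0 < ∫ y : E3, h1 ‖y‖ * radialExt (fun _ => 1) y := by
      have he : (fun y : E3 => h1 ‖y‖ * radialExt (fun _ => 1) y) = fun y => Φ y * ‖y‖⁻¹ := by
        funext y
        by_cases hy : y = 0
        · simp [h1, hy]
        · simp [h1, Φ, radialExt, hy]
      rw [he]
      refine Continuous.integral_pos_of_hasCompactSupport_nonneg_nonzero
        (x := EuclideanSpace.single 0 1) ?_ ?_ ?_ ?_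
      · exact hcont _ fun y hy => continuous_norm.continuousAt.inv₀ (norm_ne_zero_iff.mpr hy)
      · exact hcomp.mul_right
      · intro y; exact mul_nonneg ψ.nonneg (by positivity)
      · have : ψ 1 = 1 := ψ.one_of_mem_closedBall (by simp [ψ])
        simp [Φ, this]
    rw [integral_polar] at hp
    have hA : 0 ≤ ∫ x : S2, (1 : ℝ) ∂area := integral_nonneg fun _ => zero_le_one
    exact pos_of_mul_pos_left hp hA
  · intro g hg i
    have hd : ∀ y ∈ tsupport Φ, DifferentiableAt ℝ (radialExt g) y := fun y hy =>
      hg.differentiableAt (hts0 y hy)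
    have hGc : ∀ y, y ≠ 0 → ContinuousAt (radialExt g) y := fun y hy =>
      (hg.differentiableAt hy).continuousAt
    have hG'c : ∀ y, y ≠ 0 →
        ContinuousAt (fun y => fderiv ℝ (radialExt g) y (EuclideanSpace.single i 1)) y := by
      intro y hy
      have h1 : ContDiffOn ℝ 1 (radialExt g) {y : E3 | y ≠ 0} := fun y hy =>
        (contDiffAt_radialExt (n := 1) (by exact_mod_cast hg) hy).contDiffWithinAt
      exact ((h1.continuousOn_fderiv_of_isOpen isOpen_ne (by norm_num)).clm_apply
        continuousOn_const).continuousAt (isOpen_ne.mem_nhds hy)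
    have hΦ' : ∀ y : E3, fderiv ℝ Φ y (EuclideanSpace.single i 1)
        = deriv ψ (‖y‖ ^ 2) * (2 * y i) := by
      intro y
      have hψ : HasDerivAt ψ (deriv ψ (‖y‖ ^ 2)) (‖y‖ ^ 2) :=
        ((ψ.contDiff (n := 1)).differentiable (by norm_num) _).hasDerivAt
      have := hψ.comp_hasFDerivAt y (hasStrictFDerivAt_norm_sq y).hasFDerivAt
      have h' : HasFDerivAt Φ _ y := this
      rw [h'.fderiv]
      simp [EuclideanSpace.inner_single_right]
    have hΦ'c : Continuous fun y => fderiv ℝ Φ y (EuclideanSpace.single i 1) :=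
      (hΦ.continuous_fderiv (by norm_num)).clm_apply continuous_const
    have hΦ's : HasCompactSupport fun y => fderiv ℝ Φ y (EuclideanSpace.single i 1) :=
      hcomp.fderiv_apply ℝ _
    have hibp := integral_mul_fderiv_eq_neg_fderiv_mul_of_integrable (μ := (volume : Measure E3))
      (f := Φ) (g := radialExt g) (v := EuclideanSpace.single i 1) ?_ ?_ ?_
      (fun y _ => hΦ.differentiable (by norm_num) y) hd
    · have e1 : ∀ y : E3, Φ y * fderiv ℝ (radialExt g) y (EuclideanSpace.single i 1)
          = h1 ‖y‖ * radialExt (pd i g) y := by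
        intro y
        by_cases hy : y = 0
        · have : Φ y = 0 := by
            by_contra h
            exact hts0 y (subset_tsupport _ h) hy
          rw [this, hy]; simp [h1]
        · rw [radialExt_pd i g hy]
          simp only [Φ, h1]
          field_simp [norm_ne_zero_iff.mpr hy]
      have e2 : ∀ y : E3, fderiv ℝ Φ y (EuclideanSpace.single i 1) * radialExt g y
          = h2 ‖y‖ * radialExt (fun x => x.1 i * g x) y := by
        intro y
        rw [hΦ']
        by_cases hy : y = 0
        · simp [hy, h2]
        · simp only [h2, radialExt_of_ne hy, toS2]
          simp
          field_simp [norm_ne_zero_iff.mpr hy]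
      simp only [e1, e2] at hibp
      rw [integral_polar, integral_polar] at hibp
      simp only [a, b]
      linarith
    · refine Continuous.integrable_of_hasCompactSupport ?_ hΦ's.mul_right
      refine continuous_of_tsupport fun y hy => hΦ'c.continuousAt.mul (hGc y (hts0 y ?_))
      exact (tsupport_fderiv_apply_subset ℝ _) (tsupport_mul_subset_left hy)
    · exact (hcont _ hG'c).integrable_of_hasCompactSupport hcomp.mul_right
    · exact (hcont _ hGc).integrable_of_hasCompactSupport hcomp.mul_right

/-- The total area of the sphere. -/
def totalArea : ℝ := area.real Set.univ

theorem totalArea_pos : 0 < totalArea := by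
  rw [totalArea, measureReal_def, ENNReal.toReal_pos_iff]
  exact ⟨Measure.measure_univ_pos.2 (Measure.toSphere_ne_zero _), measure_lt_top _ _⟩

theorem C1.integrable {g : S2 → ℝ} (hg : C1 g) : Integrable g area :=
  Continuous.integrable_area hg.continuous

theorem c1_coord (k : Fin 3) : C1 fun x => x.1 k := (smoothOnS2_coord k).c1

/-- The divergence theorem for the tangential gradient. -/
theorem integral_pd {g : S2 → ℝ} (hg : C1 g) (i : Fin 3) :
    ∫ x, pd i g x ∂area = 2 * ∫ x, x.1 i * g x ∂area := by
  obtain ⟨a, b, hb, h⟩ := exists_integral_pd_relation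
  -- The ratio of a and b comes from testing on the coordinate functions: with `g = x_j`, `i = j`
  -- and a sum over j, the left integrand is tr σ = 2 and the right one is |x|² = 1.
  have hsum : b * (2 * totalArea) = a * totalArea := by
    have h1 : ∀ j, b * ∫ x, σ x j j ∂area = a * ∫ x, x.1 j * x.1 j ∂area := by
      intro j
      have := h (fun x => x.1 j) (c1_coord j) j
      simpa only [pd_coord] using this
    have hc : ∀ j : Fin 3, Continuous fun x : S2 => x.1 j * x.1 j := fun j =>
      ((c1_coord j).mul (c1_coord j)).continuous
    have hσ : ∀ j : Fin 3, Continuous fun x : S2 => σ x j j := fun j => by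
      simp only [σ, if_true]; exact continuous_const.sub (hc j)
    have h2 := Finset.sum_congr (rfl : (Finset.univ : Finset (Fin 3)) = Finset.univ)
      fun j _ => h1 j
    rw [← Finset.mul_sum, ← Finset.mul_sum,
      ← integral_finsetSum _ fun j _ => Continuous.integrable_area (hσ j),
      ← integral_finsetSum _ fun j _ => Continuous.integrable_area (hc j)] at h2
    simp only [S2.sum_sq, σ, Finset.sum_sub_distrib] at h2
    simpa [totalArea, show (3 : ℝ) - 1 = 2 by norm_num, mul_comm] using h2
  have hab : a = 2 * b := by
    have := totalArea_pos
    have h3 : (a - 2 * b) * totalArea = 0 := by linarith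
    rcases mul_eq_zero.1 h3 with h4 | h4
    · linarith
    · exact absurd h4 this.ne'
  have := h g hg i
  rw [hab] at this
  have h5 : b * (∫ x, pd i g x ∂area - 2 * ∫ x, x.1 i * g x ∂area) = 0 := by linarith
  rcases mul_eq_zero.1 h5 with h6 | h6
  · exact absurd h6 hb.ne'
  · linarith

/-! ### Projection algebra and covariant derivatives in Cartesian components. -/

section Pointwise

variable (x : S2)

theorem σ_symm (i j : Fin 3) : σ x i j = σ x j i := by
  simp only [σ, eq_comm, mul_comm]

theorem sum_σ_mul (j : Fin 3) (v : Fin 3 → ℝ) :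
    ∑ a, σ x j a * v a = v j - x.1 j * ∑ a, x.1 a * v a := by
  simp only [σ, sub_mul, Finset.sum_sub_distrib, ite_mul, one_mul, zero_mul, Finset.sum_ite_eq,
    Finset.mem_univ, if_true, Finset.mul_sum, mul_assoc]

theorem sum_σ_mul_of_tangential (j : Fin 3) {v : Fin 3 → ℝ} (hv : ∑ a, x.1 a * v a = 0) :
    ∑ a, σ x j a * v a = v j := by
  rw [sum_σ_mul, hv]; ring

theorem sum_coord_mul_σ (i : Fin 3) : ∑ j, x.1 j * σ x i j = 0 := by
  have h := sum_σ_mul x i fun a => x.1 a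
  rw [S2.sum_sq] at h
  simp only [mul_comm (x.1 _)]
  rw [h]; ring

theorem sum_σ_self : ∑ i, σ x i i = 2 := by
  simp only [σ, if_true, Finset.sum_sub_distrib, S2.sum_sq]
  norm_num

/-- The gradient of `X k` is a row of the tangential projection, so contracting it with a tangential
vector reads off the k-th component. This reduces the center of mass to a single component of its
integrand. -/
theorem sum_grad_X_mul (k : Fin 3) {v : Fin 3 → ℝ} (hv : ∑ a, x.1 a * v a = 0) :
    ∑ i, grad (X k) x i * v i = v k := by
  have : ∀ i, grad (X k) x i = σ x k i := fun i => by rw [σ_symm]; exact pd_coord i k x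
  simp only [this, sum_σ_mul_of_tangential x k hv]

end Pointwise

theorem smoothOnS2_σ (i j : Fin 3) : SmoothOnS2 fun x => σ x i j :=
  (SmoothOnS2.const _).sub ((smoothOnS2_coord i).mul (smoothOnS2_coord j))

/-- The projection in `covForm` is invisible in the trace, since `pd` is already tangential in its
derivative index. -/
theorem divForm_eq {w : S2 → Fin 3 → ℝ} (hw : ∀ l, C1 fun y => w y l) (x : S2) :
    divForm w x = ∑ l, pd l (fun y => w y l) x := by
  simp only [divForm, covForm]
  rw [Finset.sum_comm]
  refine Finset.sum_congr rfl fun l _ => ?_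
  simp only [σ_symm x _ l]
  exact sum_σ_mul_of_tangential x l (sum_coord_mul_pd (hw l) x)

/-- The derivative of `∑ x_b w_b = 0`. -/
theorem sum_coord_mul_pd_of_tangential {w : S2 → Fin 3 → ℝ} (hw : ∀ l, C1 fun y => w y l)
    (ht : ∀ x, ∑ b, x.1 b * w x b = 0) (i : Fin 3) (x : S2) :
    ∑ b, x.1 b * pd i (fun y => w y b) x = - w x i := by
  have h : pd i (fun y => ∑ b, y.1 b * w y b) x = 0 := by simp only [ht, pd_const]
  rw [pd_sum _ _ fun b _ => (c1_coord b).mul (hw b)] at h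
  simp only [pd_mul i (c1_coord _) (hw _), pd_coord, Finset.sum_add_distrib,
    sum_σ_mul_of_tangential x i (ht x)] at h
  linarith

/-- Projecting removes the normal component of the flat derivative, and that component is `-w_i` by
differentiating `x · w = 0`. -/
theorem covForm_eq {w : S2 → Fin 3 → ℝ} (hw : ∀ l, C1 fun y => w y l)
    (ht : ∀ x, ∑ b, x.1 b * w x b = 0) (x : S2) (i j : Fin 3) :
    covForm w x i j = pd i (fun y => w y j) x + x.1 j * w x i := by
  rw [covForm, sum_σ_mul, sum_coord_mul_pd_of_tangential hw ht]; ring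

theorem covForm_tangential_right (w : S2 → Fin 3 → ℝ) (x : S2) (i : Fin 3) :
    ∑ j, x.1 j * covForm w x i j = 0 := by
  simp only [covForm, Finset.mul_sum]
  rw [Finset.sum_comm]
  refine Finset.sum_eq_zero fun l _ => ?_
  simp only [← mul_assoc, ← Finset.sum_mul, σ_symm x _ l, sum_coord_mul_σ, zero_mul]

theorem covForm_tangential_left {w : S2 → Fin 3 → ℝ} (hw : ∀ l, C1 fun y => w y l) (x : S2)
    (j : Fin 3) : ∑ i, x.1 i * covForm w x i j = 0 := by
  simp only [covForm, Finset.mul_sum]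
  rw [Finset.sum_comm]
  refine Finset.sum_eq_zero fun l _ => ?_
  simp only [mul_left_comm _ (σ x j l), ← Finset.mul_sum, sum_coord_mul_pd (hw l), mul_zero]

/-- As in `covForm_eq`; the normal components sum to the trace of T, so for traceless tensors the
Cartesian divergence needs no correction. -/
theorem divTensor_eq {T : S2 → Fin 3 → Fin 3 → ℝ} (hT : ∀ a b, C1 fun y => T y a b)
    (ht : ∀ x a, ∑ b, x.1 b * T x a b = 0) (x : S2) (j : Fin 3) :
    divTensor T x j = ∑ i, pd i (fun y => T y i j) x + x.1 j * ∑ i, T x i i := by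
  have h1 : divTensor T x j = ∑ a, ∑ b, σ x j b * ∑ i, σ x a i * pd i (fun y => T y a b) x := by
    simp only [divTensor, covTensor, Finset.mul_sum]
    rw [Finset.sum_comm]
    refine Finset.sum_congr rfl fun a _ => ?_
    rw [Finset.sum_comm]
    refine Finset.sum_congr rfl fun b _ => Finset.sum_congr rfl fun i _ => ?_
    rw [σ_symm x a i]; ring
  simp only [h1, sum_σ_mul_of_tangential x _ (sum_coord_mul_pd (hT _ _) x)]
  rw [Finset.mul_sum, ← Finset.sum_add_distrib]
  refine Finset.sum_congr rfl fun a _ => ?_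
  rw [sum_σ_mul, sum_coord_mul_pd_of_tangential (hT a) (fun x => ht x a)]
  ring

theorem divTensor_tangential (T : S2 → Fin 3 → Fin 3 → ℝ) (x : S2) :
    ∑ j, x.1 j * divTensor T x j = 0 := by
  simp only [divTensor, covTensor, Finset.mul_sum]
  rw [Finset.sum_comm]
  refine Finset.sum_eq_zero fun i _ => ?_
  rw [Finset.sum_comm]
  refine Finset.sum_eq_zero fun a _ => ?_
  rw [Finset.sum_comm]
  refine Finset.sum_eq_zero fun b _ => ?_
  have := sum_coord_mul_σ x b
  simp only [σ_symm x _ b]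
  calc _ = (∑ j, x.1 j * σ x b j) * (σ x i a * pd i (fun y => T y a b) x) := by
        rw [Finset.sum_mul]; exact Finset.sum_congr rfl fun j _ => by ring
    _ = 0 := by rw [this, zero_mul]

theorem grad_tangential {g : S2 → ℝ} (hg : C1 g) (x : S2) : ∑ i, x.1 i * grad g x i = 0 :=
  sum_coord_mul_pd hg x

theorem hess_eq {f : S2 → ℝ} (hf : SmoothOnS2 f) (x : S2) (i j : Fin 3) :
    hess f x i j = pd i (pd j f) x + x.1 j * pd i f x :=
  covForm_eq (w := grad f) (fun l => (hf.pd l).c1) (grad_tangential hf.c1) x i j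

theorem lap_eq {f : S2 → ℝ} (hf : SmoothOnS2 f) (x : S2) : lap f x = ∑ i, pd i (pd i f) x :=
  divForm_eq (w := grad f) (fun l => (hf.pd l).c1) x

/-! ### Symmetric traceless tensors and the change of the shear. -/

/-- A symmetric traceless 3 × 3 matrix M that kills the unit vector n = (p, q, r) has eigenvalues 0,
λ, -λ. Hence M² = λ² (1 - n nᵀ) with λ² = |M|²/2; this is a diagonal entry of that identity, and
`sq_offDiag_of_stf` is an off-diagonal one. -/
theorem sq_diag_of_stf {a b c d e f p q r : ℝ} (hx : p * p + q * q + r * r = 1)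
    (h0 : p * a + q * b + r * c = 0) (h1 : p * b + q * d + r * e = 0)
    (h2 : p * c + q * e + r * f = 0) (htr : a + d + f = 0) :
    a * a + b * b + c * c
      = (a * a + d * d + f * f + 2 * b * b + 2 * c * c + 2 * e * e) / 2 * (1 - p * p) := by
  grind

theorem sq_offDiag_of_stf {a b c d e f p q r : ℝ} (hx : p * p + q * q + r * r = 1)
    (h0 : p * a + q * b + r * c = 0) (h1 : p * b + q * d + r * e = 0)
    (h2 : p * c + q * e + r * f = 0) (htr : a + d + f = 0) :
    a * b + b * d + c * e
      = (a * a + d * d + f * f + 2 * b * b + 2 * c * c + 2 * e * e) / 2 * (0 - p * q) := by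
  grind

/-- Smooth symmetric traceless tangential 2-tensors on the sphere. -/
structure IsSTF (T : S2 → Fin 3 → Fin 3 → ℝ) : Prop where
  smooth : ∀ i j, SmoothOnS2 fun x => T x i j
  tangential : ∀ x j, ∑ i, x.1 i * T x i j = 0
  symm : ∀ x i j, T x i j = T x j i
  traceless : ∀ x, ∑ i, T x i i = 0

theorem smoothOnS2_hess {f : S2 → ℝ} (hf : SmoothOnS2 f) (i j : Fin 3) :
    SmoothOnS2 fun x => hess f x i j := by
  simp only [hess_eq hf]
  exact ((hf.pd j).pd i).add ((smoothOnS2_coord j).mul (hf.pd i))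

theorem smoothOnS2_lap {f : S2 → ℝ} (hf : SmoothOnS2 f) : SmoothOnS2 (lap f) := by
  have : lap f = fun x => ∑ i, pd i (pd i f) x := funext fun x => lap_eq hf x
  rw [this]
  exact SmoothOnS2.sum fun i _ => (hf.pd i).pd i

/-- The change of the shear under the supertranslation `f`. -/
def shearShift (f : S2 → ℝ) (x : S2) (i j : Fin 3) : ℝ := - 2 * hess f x i j + lap f x * σ x i j

theorem isSTF_shearShift {f : S2 → ℝ} (hf : SmoothOnS2 f) : IsSTF (shearShift f) where
  smooth i j := ((SmoothOnS2.const _).mul (smoothOnS2_hess hf i j)).add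
    ((smoothOnS2_lap hf).mul (smoothOnS2_σ i j))
  tangential x j := by
    have h1 : ∑ i, x.1 i * hess f x i j = 0 :=
      covForm_tangential_left (w := grad f) (fun l => (hf.pd l).c1) x j
    have h2 : ∑ i, x.1 i * σ x i j = 0 := by simpa only [σ_symm x _ j] using sum_coord_mul_σ x j
    have : ∀ i, x.1 i * shearShift f x i j
        = -2 * (x.1 i * hess f x i j) + lap f x * (x.1 i * σ x i j) := fun i => by
      rw [shearShift]; ring
    simp only [this, Finset.sum_add_distrib, ← Finset.mul_sum, h1, h2]
    ring
  symm x i j := by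
    have := pd_comm hf i j x
    simp only [shearShift, hess_eq hf, σ_symm x i j]
    linear_combination 2 * this
  traceless x := by
    have h1 : ∑ i, hess f x i i = lap f x := rfl
    simp only [shearShift, Finset.sum_add_distrib, ← Finset.mul_sum, h1, sum_σ_self]
    ring

namespace IsSTF

variable {T : S2 → Fin 3 → Fin 3 → ℝ} (hT : IsSTF T)
include hT

theorem c1 (i j : Fin 3) : C1 fun x => T x i j := (hT.smooth i j).c1

theorem tangential_right (x : S2) (i : Fin 3) : ∑ j, x.1 j * T x i j = 0 := by
  simpa only [hT.symm x i] using hT.tangential x i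

theorem divTensor_eq (x : S2) (j : Fin 3) : divTensor T x j = ∑ i, pd i (fun y => T y i j) x := by
  rw [NullInfinity.divTensor_eq hT.c1 hT.tangential_right, hT.traceless]; ring

theorem smoothOnS2_divTensor (j : Fin 3) : SmoothOnS2 fun x => divTensor T x j := by
  simp only [hT.divTensor_eq]
  exact SmoothOnS2.sum fun i _ => (hT.smooth i j).pd i

/-- In two dimensions the square of a symmetric traceless tensor is pure trace. -/
theorem sum_mul_self (x : S2) (k i : Fin 3) :
    ∑ d, T x k d * T x i d = 1 / 2 * pair (T x) (T x) * σ x k i := by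
  have hx := S2.sum_sq x
  have h10 := hT.symm x 1 0
  have h20 := hT.symm x 2 0
  have h21 := hT.symm x 2 1
  have t0 := hT.tangential x 0
  have t1 := hT.tangential x 1
  have t2 := hT.tangential x 2
  have htr := hT.traceless x
  simp only [pair, Fin.sum_univ_three, h10, h20, h21] at hx t0 t1 t2 htr ⊢
  have d0 := sq_diag_of_stf hx t0 t1 t2 htr
  -- The other entries follow from (0,0) and (0,1) by permuting the coordinates.
  have d1 := sq_diag_of_stf (a := T x 1 1) (b := T x 0 1) (c := T x 1 2) (d := T x 0 0)
    (e := T x 0 2) (f := T x 2 2) (p := x.1 1) (q := x.1 0) (r := x.1 2)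
    (by linarith) (by linarith) (by linarith) (by linarith) (by linarith)
  have d2 := sq_diag_of_stf (a := T x 2 2) (b := T x 1 2) (c := T x 0 2) (d := T x 1 1)
    (e := T x 0 1) (f := T x 0 0) (p := x.1 2) (q := x.1 1) (r := x.1 0)
    (by linarith) (by linarith) (by linarith) (by linarith) (by linarith)
  have o01 := sq_offDiag_of_stf hx t0 t1 t2 htr
  have o02 := sq_offDiag_of_stf (a := T x 0 0) (b := T x 0 2) (c := T x 0 1) (d := T x 2 2)
    (e := T x 1 2) (f := T x 1 1) (p := x.1 0) (q := x.1 2) (r := x.1 1)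
    (by linarith) (by linarith) (by linarith) (by linarith) (by linarith)
  have o12 := sq_offDiag_of_stf (a := T x 1 1) (b := T x 1 2) (c := T x 0 1) (d := T x 2 2)
    (e := T x 0 2) (f := T x 0 0) (p := x.1 1) (q := x.1 2) (r := x.1 0)
    (by linarith) (by linarith) (by linarith) (by linarith) (by linarith)
  fin_cases k <;> fin_cases i <;> simp [σ, h10, h20, h21] <;> linarith

end IsSTF

/-- The divergence theorem for tangential vector fields. -/
theorem integral_sum_pd_of_tangential {w : S2 → Fin 3 → ℝ} (hw : ∀ i, C1 fun x => w x i)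
    (ht : ∀ x, ∑ i, x.1 i * w x i = 0) : ∫ x, ∑ i, pd i (fun y => w y i) x ∂area = 0 := by
  rw [integral_finsetSum _ fun i _ => Continuous.integrable_area ((hw i).continuous_pd i)]
  simp only [integral_pd (hw _)]
  rw [← Finset.mul_sum, ← integral_finsetSum _ fun i _ => ((c1_coord i).mul (hw i)).integrable]
  simp [ht]

theorem integral_pd_sub {q : S2 → ℝ} (hq : C1 q) (k : Fin 3) :
    ∫ x, (pd k q x - 2 * (x.1 k * q x)) ∂area = 0 := by
  rw [integral_sub (Continuous.integrable_area (hq.continuous_pd k))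
    (((c1_coord k).mul hq).integrable.const_mul 2), integral_const_mul, integral_pd hq, sub_self]

theorem integral_coord (k : Fin 3) : ∫ x : S2, x.1 k ∂area = 0 := by
  have h := integral_pd (C1.const 1) k
  simp only [pd_const, mul_one, integral_zero] at h
  linarith

/-- For `g = x_j` the divergence theorem reads δ_ij · area - I = 2 I, where I is the integral
sought. -/
theorem integral_coord_mul_coord (i j : Fin 3) :
    ∫ x : S2, x.1 i * x.1 j ∂area = if i = j then totalArea / 3 else 0 := by
  have h := integral_pd (c1_coord j) i
  simp only [pd_coord, σ] at h
  rw [integral_sub (integrable_const _) ((c1_coord i).mul (c1_coord j)).integrable] at h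
  have h1 : ∫ _ : S2, (if i = j then (1 : ℝ) else 0) ∂area = if i = j then totalArea else 0 := by
    split_ifs <;> simp [totalArea]
  rw [h1] at h
  split_ifs at h ⊢ <;> linarith

/-! ### The integral identity between the shear and its supertranslation. -/

section Shear

variable {f : S2 → ℝ} (hf : SmoothOnS2 f)
include hf

/-- The Cartesian form of commuting Δ with ∇: `pd_comm` is used once inside and once outside to
bring `pd j` to the front. -/
theorem sum_pd_pd_pd (x : S2) (j : Fin 3) :
    ∑ i, pd i (pd i (pd j f)) x = pd j (lap f) x - 2 * x.1 j * lap f x := by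
  have hl : lap f = fun x => ∑ i, pd i (pd i f) x := funext fun x => lap_eq hf x
  have h1 : pd j (lap f) x = ∑ i, pd j (pd i (pd i f)) x := by
    rw [hl, pd_sum _ _ fun i _ => ((hf.pd i).pd i).c1]
  have h2 : ∀ i, pd i (pd i (pd j f)) x = pd j (pd i (pd i f)) x
      + (x.1 i * pd j (pd i f) x - x.1 j * pd i (pd i f) x)
      + (σ x i i * pd j f x + x.1 i * pd i (pd j f) x
        - (σ x i j * pd i f x + x.1 j * pd i (pd i f) x)) := by
    intro i
    have h3 : pd i (pd j f) = fun y => pd j (pd i f) y + (y.1 i * pd j f y - y.1 j * pd i f y) := by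
      funext y
      have := pd_comm hf j i y
      linarith
    have h4 := pd_comm (hf.pd i) j i x
    have h5 : pd i (pd i (pd j f)) x = _ := congrArg (fun g => pd i g x) h3
    rw [h5, pd_add i ((hf.pd i).pd j).c1 (((c1_coord i).mul (hf.pd j).c1).sub
        ((c1_coord j).mul (hf.pd i).c1)),
      pd_sub i ((c1_coord i).mul (hf.pd j).c1) ((c1_coord j).mul (hf.pd i).c1),
      pd_mul i (c1_coord i) (hf.pd j).c1, pd_mul i (c1_coord j) (hf.pd i).c1, pd_coord, pd_coord]
    linarith
  have t1 : ∑ i, x.1 i * pd j (pd i f) x = - pd j f x :=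
    sum_coord_mul_pd_of_tangential (w := grad f) (fun l => (hf.pd l).c1)
      (grad_tangential hf.c1) j x
  have t2 : ∑ i, x.1 i * pd i (pd j f) x = 0 := sum_coord_mul_pd (hf.pd j).c1 x
  have t3 : ∑ i, σ x i j * pd i f x = pd j f x := by
    simp only [σ_symm x _ j]
    exact sum_σ_mul_of_tangential x j (sum_coord_mul_pd hf.c1 x)
  have t4 := sum_σ_self x
  have t5 := lap_eq hf x
  rw [Finset.sum_congr rfl fun i _ => h2 i, h1, t5]
  simp only [Finset.sum_add_distrib, Finset.sum_sub_distrib, ← Finset.mul_sum, ← Finset.sum_mul,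
    t1, t2, t3, t4]
  ring

/-- The unit sphere has Ricci curvature σ, so div ∇∇f = ∇Δf + ∇f, and the divergence sought is -2
(∇Δf + ∇f) + ∇Δf. The result is exact: it is -∇ψ with ψ = Δf + 2f. -/
theorem divTensor_shearShift (x : S2) (j : Fin 3) :
    divTensor (shearShift f) x j = - pd j (lap f) x - 2 * pd j f x := by
  have hL := smoothOnS2_lap hf
  rw [(isSTF_shearShift hf).divTensor_eq]
  have h1 : ∀ i, pd i (fun y => shearShift f y i j) x
      = -2 * (pd i (pd i (pd j f)) x + (σ x i j * pd i f x + x.1 j * pd i (pd i f) x))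
        + (σ x i j * pd i (lap f) x - lap f x * (σ x i i * x.1 j + x.1 i * σ x i j)) := by
    intro i
    have e1 : pd i (fun y => hess f y i j) x
        = pd i (pd i (pd j f)) x + (σ x i j * pd i f x + x.1 j * pd i (pd i f) x) := by
      simp only [hess_eq hf]
      rw [pd_add i ((hf.pd j).pd i).c1 ((c1_coord j).mul (hf.pd i).c1),
        pd_mul i (c1_coord j) (hf.pd i).c1, pd_coord]
    have e2 : pd i (fun y => σ y i j) x = - (σ x i i * x.1 j + x.1 i * σ x i j) := by
      simp only [σ]
      rw [pd_sub i (C1.const _) ((c1_coord i).mul (c1_coord j)), pd_const,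
        pd_mul i (c1_coord i) (c1_coord j), pd_coord, pd_coord]
      simp only [σ]; ring
    simp only [shearShift]
    rw [pd_add i ((C1.const _).mul (smoothOnS2_hess hf i j).c1) (hL.c1.mul (smoothOnS2_σ i j).c1),
      pd_const_mul i _ (smoothOnS2_hess hf i j).c1, pd_mul i hL.c1 (smoothOnS2_σ i j).c1, e1, e2]
    ring
  have t3 : ∀ g, C1 g → ∑ i, σ x i j * pd i g x = pd j g x := fun g hg => by
    simp only [σ_symm x _ j]
    exact sum_σ_mul_of_tangential x j (sum_coord_mul_pd hg x)
  have t6 : ∑ i, x.1 i * σ x i j = 0 := by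
    simpa only [σ_symm x _ j] using sum_coord_mul_σ x j
  rw [Finset.sum_congr rfl fun i _ => h1 i]
  simp only [Finset.sum_add_distrib, Finset.sum_sub_distrib, ← Finset.mul_sum, ← Finset.sum_mul,
    t3 f hf.c1, t3 _ hL.c1, t6, sum_σ_self, sum_pd_pd_pd hf x j, ← lap_eq hf x]
  ring

/-- The identity behind the transformation law of the center of mass flux. -/
theorem integral_shearShift_mul_divTensor {T : S2 → Fin 3 → Fin 3 → ℝ} (hT : IsSTF T)
    (k : Fin 3) :
    ∫ x, (∑ j, (shearShift f x k j * divTensor T x j - T x k j * divTensor (shearShift f) x j)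
      - 2 * (x.1 k * f x + pd k f x) * ∑ j, pd j (fun y => divTensor T y j) x) ∂area = 0 := by
  have hL := smoothOnS2_lap hf
  have hc := hT.smoothOnS2_divTensor
  have hφ : SmoothOnS2 fun y => y.1 k * f y + pd k f y :=
    ((smoothOnS2_coord k).mul hf).add (hf.pd k)
  have hψ : SmoothOnS2 fun y => 2 * f y + lap f y := ((SmoothOnS2.const 2).mul hf).add hL
  -- With φ = x_k f + ∂_k f and ψ = 2f + Δf one has `H_k = -2 ∇φ + ψ σ_k` and `div H = -∇ψ`. So H_k
  -- · div T - T_k · div H is -2 ∇φ · div T + ψ (div T)_k + T_k · ∇ψ, which is the divergence of w =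
  -- -2 φ div T + ψ T_k plus 2 φ div div T.
  let w : S2 → Fin 3 → ℝ := fun y i =>
    -2 * ((y.1 k * f y + pd k f y) * divTensor T y i) + (2 * f y + lap f y) * T y i k
  have hw : ∀ i, C1 fun x => w x i := fun i =>
    ((C1.const (-2)).mul (hφ.c1.mul (hc i).c1)).add (hψ.c1.mul (hT.c1 i k))
  have ht : ∀ x, ∑ i, x.1 i * w x i = 0 := by
    intro x
    have e : ∀ i, x.1 i * w x i = -2 * (x.1 k * f x + pd k f x) * (x.1 i * divTensor T x i)
        + (2 * f x + lap f x) * (x.1 i * T x i k) := fun i => by simp only [w]; ring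
    simp only [e, Finset.sum_add_distrib, ← Finset.mul_sum, divTensor_tangential, hT.tangential]
    ring
  rw [← integral_sum_pd_of_tangential hw ht]
  refine integral_congr_ae (ae_of_all _ fun x => ?_)
  have h1 : ∀ i, pd i (fun y => w y i) x
      = -2 * ((σ x i k * f x + x.1 k * pd i f x + pd i (pd k f) x) * divTensor T x i
          + (x.1 k * f x + pd k f x) * pd i (fun y => divTensor T y i) x)
        + ((2 * pd i f x + pd i (lap f) x) * T x i k
          + (2 * f x + lap f x) * pd i (fun y => T y i k) x) := by
    intro i
    simp only [w]
    rw [pd_add i ((C1.const (-2)).mul (hφ.c1.mul (hc i).c1)) (hψ.c1.mul (hT.c1 i k)),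
      pd_const_mul i _ (hφ.c1.mul (hc i).c1), pd_mul i hφ.c1 (hc i).c1,
      pd_mul i hψ.c1 (hT.c1 i k), pd_add i ((c1_coord k).mul hf.c1) (hf.pd k).c1,
      pd_mul i (c1_coord k) hf.c1, pd_coord, pd_add i ((C1.const 2).mul hf.c1) hL.c1,
      pd_const_mul i 2 hf.c1]
  have t1 : ∑ i, σ x i k * divTensor T x i = divTensor T x k := by
    simp only [σ_symm x _ k]
    exact sum_σ_mul_of_tangential x k (divTensor_tangential T x)
  have hh : ∀ i, hess f x k i = pd i (pd k f) x + x.1 k * pd i f x := by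
    intro i
    have := pd_comm hf i k x
    rw [hess_eq hf]; linarith
  have h2 : ∀ i, (shearShift f x k i * divTensor T x i - T x k i * divTensor (shearShift f) x i)
      - 2 * (x.1 k * f x + pd k f x) * pd i (fun y => divTensor T y i) x
      = pd i (fun y => w y i) x + (lap f x + 2 * f x) * (σ x i k * divTensor T x i
        - pd i (fun y => T y i k) x) := by
    intro i
    rw [h1, divTensor_shearShift hf, hT.symm x k i, shearShift, hh, σ_symm x k i]
    ring
  simp only
  rw [Finset.mul_sum, ← Finset.sum_sub_distrib, Finset.sum_congr rfl fun i _ => h2 i]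
  rw [Finset.sum_add_distrib, ← Finset.mul_sum, Finset.sum_sub_distrib, t1, ← hT.divTensor_eq]
  ring

end Shear

theorem integral_intervalIntegral_comm {F : ℝ → S2 → ℝ}
    (hF : Continuous fun p : ℝ × S2 => F p.1 p.2) (a b : ℝ) :
    ∫ x, (∫ s in a..b, F s x) ∂area = ∫ s in a..b, (∫ x, F s x ∂area) := by
  simp only [intervalIntegral.intervalIntegral_eq_integral_uIoc]
  rw [integral_smul]
  congr 1
  refine integral_integral_swap (f := fun x s => F s x) ?_
  have hc : IsCompact ((Set.univ : Set S2) ×ˢ Set.uIcc a b) := isCompact_univ.prod isCompact_uIcc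
  have hcont : Continuous fun p : S2 × ℝ => F p.2 p.1 := hF.comp continuous_swap
  have h1 : IntegrableOn (fun p : S2 × ℝ => F p.2 p.1) ((Set.univ : Set S2) ×ˢ Set.uIcc a b)
      (area.prod volume) := hcont.continuousOn.integrableOn_compact hc
  have h2 := h1.mono_set (Set.prod_mono (Set.Subset.refl Set.univ) Set.uIoc_subset_uIcc)
  rw [IntegrableOn, ← Measure.prod_restrict, Measure.restrict_univ] at h2
  exact h2

/-! ### Vacuum data: regularity and derivatives in u. -/

namespace Data.IsVacuum

variable {D : Data} (hD : D.IsVacuum)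
include hD

theorem isSTF_C (u : ℝ) : IsSTF (D.C u) where
  smooth i j := (hD.smooth_C i j).slice u
  tangential := hD.tangential_C u
  symm := hD.symm_C u
  traceless := hD.traceless_C u

theorem smooth_news (i j : Fin 3) : SmoothOnScri fun u x => D.news u x i j :=
  (hD.smooth_C i j).deriv

theorem hasDerivAt_C (u : ℝ) (x : S2) (i j : Fin 3) :
    HasDerivAt (fun s => D.C s x i j) (D.news u x i j) u := (hD.smooth_C i j).hasDerivAt u x

theorem isSTF_news (u : ℝ) : IsSTF (D.news u) where
  smooth i j := (hD.smooth_news i j).slice u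
  tangential x j := by
    have h : HasDerivAt (fun s => ∑ i, x.1 i * D.C s x i j) (∑ i, x.1 i * D.news u x i j) u :=
      HasDerivAt.fun_sum fun i _ => (hD.hasDerivAt_C u x i j).const_mul _
    simp only [hD.tangential_C] at h
    exact h.unique (hasDerivAt_const u 0)
  symm x i j := by simp only [Data.news, hD.symm_C _ x i j]
  traceless x := by
    have h : HasDerivAt (fun s => ∑ i, D.C s x i i) (∑ i, D.news u x i i) u :=
      HasDerivAt.fun_sum fun i _ => hD.hasDerivAt_C u x i i
    simp only [hD.traceless_C] at h
    exact h.unique (hasDerivAt_const u 0)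

theorem smooth_divC (j : Fin 3) : SmoothOnScri fun u x => divTensor (D.C u) x j := by
  simp only [(hD.isSTF_C _).divTensor_eq]
  exact SmoothOnScri.sum fun i _ => (hD.smooth_C i j).pd i

theorem smooth_divNews (j : Fin 3) : SmoothOnScri fun u x => divTensor (D.news u) x j := by
  simp only [(hD.isSTF_news _).divTensor_eq]
  exact SmoothOnScri.sum fun i _ => (hD.smooth_news i j).pd i

theorem hasDerivAt_pd_C (a : Fin 3) (u : ℝ) (x : S2) (i j : Fin 3) :
    HasDerivAt (fun s => pd a (fun y => D.C s y i j) x) (pd a (fun y => D.news u y i j) x) u := by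
  have h := ((hD.smooth_C i j).pd a).hasDerivAt u x
  rwa [(hD.smooth_C i j).deriv_pd] at h

theorem hasDerivAt_divC (u : ℝ) (x : S2) (j : Fin 3) :
    HasDerivAt (fun s => divTensor (D.C s) x j) (divTensor (D.news u) x j) u := by
  simp only [(hD.isSTF_C _).divTensor_eq, (hD.isSTF_news _).divTensor_eq]
  exact HasDerivAt.fun_sum fun i _ => hD.hasDerivAt_pd_C i u x i j

theorem smooth_pair_C : SmoothOnScri fun u x => pair (D.C u x) (D.C u x) :=
  SmoothOnScri.sum fun i _ => SmoothOnScri.sum fun j _ => (hD.smooth_C i j).mul (hD.smooth_C i j)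

theorem smooth_pair_news : SmoothOnScri fun u x => pair (D.news u x) (D.news u x) :=
  SmoothOnScri.sum fun i _ => SmoothOnScri.sum fun j _ =>
    (hD.smooth_news i j).mul (hD.smooth_news i j)

theorem smooth_pair_C_news : SmoothOnScri fun u x => pair (D.C u x) (D.news u x) :=
  SmoothOnScri.sum fun i _ => SmoothOnScri.sum fun j _ => (hD.smooth_C i j).mul (hD.smooth_news i j)

theorem deriv_pair_C (u : ℝ) (x : S2) :
    deriv (fun s => pair (D.C s x) (D.C s x)) u = 2 * pair (D.C u x) (D.news u x) := by
  have h : HasDerivAt (fun s => pair (D.C s x) (D.C s x))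
      (∑ i, ∑ j, (D.news u x i j * D.C u x i j + D.C u x i j * D.news u x i j)) u :=
    HasDerivAt.fun_sum fun i _ => HasDerivAt.fun_sum fun j _ =>
      (hD.hasDerivAt_C u x i j).mul (hD.hasDerivAt_C u x i j)
  rw [h.deriv, pair, Finset.mul_sum]
  refine Finset.sum_congr rfl fun i _ => ?_
  rw [Finset.mul_sum]
  exact Finset.sum_congr rfl fun j _ => by ring

end Data.IsVacuum

/-! ### The rate of change of the center of mass. -/

namespace Data

variable (D : Data)

/-- `C_k^d ∇^b C_{db}`. -/
def shearStress (k : Fin 3) (u : ℝ) (x : S2) : ℝ := ∑ d, D.C u x k d * divTensor (D.C u) x d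

/-- The integrand of the center of mass. -/
def comDensity (k : Fin 3) (u : ℝ) (x : S2) : ℝ :=
  D.NA u x k - u * pd k (D.m u) x - 1 / 4 * D.shearStress k u x
    - 1 / 16 * pd k (fun y => pair (D.C u y) (D.C u y)) x

/-- The density of the center of mass flux, up to total derivatives. -/
def fluxDensity (k : Fin 3) (u : ℝ) (x : S2) : ℝ :=
  u / 4 * (x.1 k * pair (D.news u x) (D.news u x))
    - 1 / 2 * ∑ d, D.news u x k d * divTensor (D.C u) x d

namespace IsVacuum

variable {D} (hD : D.IsVacuum)
include hD

theorem centerOfMass_eq (k : Fin 3) (u : ℝ) :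
    D.centerOfMass k u = ∫ x, D.comDensity k u x ∂area := by
  refine integral_congr_ae (ae_of_all _ fun x => ?_)
  simp only
  rw [sum_grad_X_mul x k]
  · rfl
  · have h1 := hD.tangential_NA u x
    have h2 := grad_tangential (hD.smooth_m.slice u).c1 x
    have h3 := grad_tangential (hD.smooth_pair_C.slice u).c1 x
    have h4 : ∑ i, x.1 i * ∑ d, D.C u x i d * divTensor (D.C u) x d = 0 := by
      simp only [Finset.mul_sum]
      rw [Finset.sum_comm]
      simp only [← mul_assoc, ← Finset.sum_mul, hD.tangential_C, zero_mul, Finset.sum_const_zero]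
    have e : ∀ i, x.1 i * (D.NA u x i - u * grad (D.m u) x i
        - 1 / 4 * ∑ d, D.C u x i d * divTensor (D.C u) x d
        - 1 / 16 * grad (fun y => pair (D.C u y) (D.C u y)) x i)
        = x.1 i * D.NA u x i - u * (x.1 i * grad (D.m u) x i)
          - 1 / 4 * (x.1 i * ∑ d, D.C u x i d * divTensor (D.C u) x d)
          - 1 / 16 * (x.1 i * grad (fun y => pair (D.C u y) (D.C u y)) x i) := fun i => by ring
    rw [Finset.sum_congr rfl fun i _ => e i]
    simp only [Finset.sum_sub_distrib]
    rw [← Finset.mul_sum, ← Finset.mul_sum, ← Finset.mul_sum, h1, h2, h3, h4]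
    ring

theorem smooth_shearStress (k : Fin 3) : SmoothOnScri (D.shearStress k) :=
  SmoothOnScri.sum fun d _ => (hD.smooth_C k d).mul (hD.smooth_divC d)

theorem smooth_comDensity (k : Fin 3) : SmoothOnScri (D.comDensity k) :=
  (((hD.smooth_NA k).sub (smoothOnScri_u.mul (hD.smooth_m.pd k))).sub
    ((SmoothOnScri.const _).mul (hD.smooth_shearStress k))).sub
    ((SmoothOnScri.const _).mul (hD.smooth_pair_C.pd k))

theorem smooth_fluxDensity (k : Fin 3) : SmoothOnScri (D.fluxDensity k) := by
  have h : SmoothOnScri fun u x => (1 / 4 * u) * (x.1 k * pair (D.news u x) (D.news u x))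
      - 1 / 2 * ∑ d, D.news u x k d * divTensor (D.C u) x d :=
    (((SmoothOnScri.const _).mul smoothOnScri_u).mul
      ((smoothOnScri_coord k).mul hD.smooth_pair_news)).sub
    ((SmoothOnScri.const _).mul (SmoothOnScri.sum fun d _ => (hD.smooth_news k d).mul
      (hD.smooth_divC d)))
  convert h using 2
  funext x
  rw [fluxDensity]; ring

theorem deriv_comDensity (k : Fin 3) (u : ℝ) (x : S2) :
    deriv (fun s => D.comDensity k s x) u = deriv (fun s => D.NA s x k) u
      - (pd k (D.m u) x + u * pd k (fun y => deriv (fun s => D.m s y) u) x)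
      - 1 / 4 * deriv (fun s => D.shearStress k s x) u
      - 1 / 8 * pd k (fun y => pair (D.C u y) (D.news u y)) x := by
  have h1 := (hD.smooth_NA k).hasDerivAt u x
  have h2 := (hD.smooth_m.pd k).hasDerivAt u x
  rw [hD.smooth_m.deriv_pd] at h2
  have h3 := (hD.smooth_shearStress k).hasDerivAt u x
  have h4 := (hD.smooth_pair_C.pd k).hasDerivAt u x
  rw [hD.smooth_pair_C.deriv_pd] at h4
  simp only [hD.deriv_pair_C] at h4
  rw [pd_const_mul k 2 (hD.smooth_pair_C_news.slice u).c1] at h4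
  have h := ((h1.sub ((hasDerivAt_id u).mul h2)).sub (h3.const_mul (1 / 4))).sub
    (h4.const_mul (1 / 16))
  have h' : HasDerivAt (fun s => D.comDensity k s x) _ u := h
  rw [h'.deriv]
  simp only [id]
  ring

theorem deriv_shearStress (k : Fin 3) (u : ℝ) (x : S2) :
    deriv (fun s => D.shearStress k s x) u
      = ∑ d, (D.news u x k d * divTensor (D.C u) x d + D.C u x k d * divTensor (D.news u) x d) := by
  have h : HasDerivAt (fun s => D.shearStress k s x) _ u :=
    HasDerivAt.fun_sum fun d _ => (hD.hasDerivAt_C u x k d).mul (hD.hasDerivAt_divC u x d)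
  exact h.deriv

/-- The rate of change of the center of mass. -/
theorem integral_deriv_comDensity_sub (k : Fin 3) (u : ℝ) :
    ∫ x, (deriv (fun s => D.comDensity k s x) u
      - 1 / 4 * deriv (fun s => D.shearStress k s x) u - D.fluxDensity k u x) ∂area = 0 := by
  have hC := hD.isSTF_C u
  have hN := hD.isSTF_news u
  set c := divTensor (D.C u) with hc
  set n := divTensor (D.news u) with hn
  have hcs := hC.smoothOnS2_divTensor
  have hns := hN.smoothOnS2_divTensor
  set B : S2 → Fin 3 → Fin 3 → ℝ := fun y d a => covForm c y d a - covForm c y a d with hB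
  have hcov : ∀ d a, SmoothOnS2 fun y => covForm c y d a := by
    intro d a
    exact SmoothOnS2.sum fun l _ => (smoothOnS2_σ a l).mul ((hcs l).pd d)
  have hBs : ∀ d a, SmoothOnS2 fun y => B y d a := fun d a => (hcov d a).sub (hcov a d)
  have hcl : ∀ x a, ∑ d, x.1 d * covForm c x d a = 0 :=
    covForm_tangential_left fun l => (hcs l).c1
  have hBt : ∀ x a, ∑ d, x.1 d * B x d a = 0 := by
    intro x a
    simp only [hB, mul_sub, Finset.sum_sub_distrib, covForm_tangential_right, hcl, sub_zero]
  have hBt' : ∀ x d, ∑ a, x.1 a * B x d a = 0 := by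
    intro x a
    simp only [hB, mul_sub, Finset.sum_sub_distrib, covForm_tangential_right, hcl, sub_zero]
  set Q : S2 → Fin 3 → Fin 3 → ℝ := fun y b a => ∑ d, D.C u y b d * D.news u y d a with hQ
  have hQs : ∀ b a, SmoothOnS2 fun y => Q y b a := fun b a =>
    SmoothOnS2.sum fun d _ => (hC.smooth b d).mul (hN.smooth d a)
  have hQt : ∀ x a, ∑ b, x.1 b * Q x b a = 0 := by
    intro x a
    simp only [hQ, Finset.mul_sum]
    rw [Finset.sum_comm]
    simp only [← mul_assoc, ← Finset.sum_mul, hC.tangential, zero_mul, Finset.sum_const_zero]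
  have hQt' : ∀ x b, ∑ a, x.1 a * Q x b a = 0 := by
    intro x b
    simp only [hQ, Finset.mul_sum]
    rw [Finset.sum_comm]
    simp only [mul_left_comm _ (D.C u x b _), ← Finset.mul_sum, hN.tangential_right, mul_zero,
      Finset.sum_const_zero]
  set q : S2 → ℝ := fun y => pair (D.C u y) (D.news u y) with hq
  have hqs : SmoothOnS2 q := hD.smooth_pair_C_news.slice u
  have hQtr : ∀ x, ∑ b, Q x b b = q x := by
    intro x
    simp only [hQ, hq, pair]
    exact Finset.sum_congr rfl fun b _ => Finset.sum_congr rfl fun d _ => by rw [hN.symm x d b]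
  set μ : S2 → ℝ := fun y => deriv (fun s => D.m s y) u with hμ
  have hμs : SmoothOnS2 μ := hD.smooth_m.deriv.slice u
  -- All divergence terms are gathered in w. The traceless B contributes the divergence of its k-th
  -- column. Q contributes likewise, up to `x_k q`, which completes `⅛ ∂_k q` to a multiple of `∂_k
  -- q - 2 x_k q`, of integral zero. The term `-u ∂_k μ` is completed in the same way; the `x_k μ`
  -- this leaves is rewritten by the evolution of m, and its second-derivative part is a divergence
  -- because `x_k div n = div (x_k n - N_k)`.
  let w : S2 → Fin 3 → ℝ := fun y i => -(1 / 4) * (B y i k + Q y i k)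
    - u / 2 * (y.1 k * n y i - D.news u y i k)
  have hw1 : ∀ i, C1 fun y => B y i k + Q y i k := fun i => (hBs i k).c1.add (hQs i k).c1
  have hw2 : ∀ i, C1 fun y => y.1 k * n y i - D.news u y i k := fun i =>
    ((c1_coord k).mul (hns i).c1).sub (hN.c1 i k)
  have hw : ∀ i, C1 fun y => w y i := fun i =>
    ((C1.const _).mul (hw1 i)).sub ((C1.const _).mul (hw2 i))
  have ht : ∀ x, ∑ i, x.1 i * w x i = 0 := by
    intro x
    have e : ∀ i, x.1 i * w x i = -(1 / 4) * (x.1 i * B x i k + x.1 i * Q x i k)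
        - u / 2 * (x.1 k * (x.1 i * n x i) - x.1 i * D.news u x i k) := fun i => by
      simp only [w]; ring
    rw [Finset.sum_congr rfl fun i _ => e i]
    simp only [Finset.sum_add_distrib, Finset.sum_sub_distrib, ← Finset.mul_sum, hBt, hQt,
      hN.tangential, hn, divTensor_tangential]
    ring
  have key : ∀ x, deriv (fun s => D.comDensity k s x) u
      - 1 / 4 * deriv (fun s => D.shearStress k s x) u - D.fluxDensity k u x
      = 1 / 8 * (pd k q x - 2 * (x.1 k * q x)) - u * (pd k μ x - 2 * (x.1 k * μ x))
        + ∑ i, pd i (fun y => w y i) x := by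
    intro x
    have hpw : ∀ i, pd i (fun y => w y i) x
        = -(1 / 4) * (pd i (fun y => B y i k) x + pd i (fun y => Q y i k) x)
          - u / 2 * (σ x i k * n x i + x.1 k * pd i (fun y => n y i) x
            - pd i (fun y => D.news u y i k) x) := by
      intro i
      simp only [w]
      rw [pd_sub i ((C1.const _).mul (hw1 i)) ((C1.const _).mul (hw2 i)),
        pd_const_mul i _ (hw1 i), pd_const_mul i _ (hw2 i), pd_add i (hBs i k).c1 (hQs i k).c1,
        pd_sub i ((c1_coord k).mul (hns i).c1) (hN.c1 i k), pd_mul i (c1_coord k) (hns i).c1,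
        pd_coord]
    have t1 : ∑ i, σ x i k * n x i = n x k := by
      simp only [σ_symm x _ k]
      exact sum_σ_mul_of_tangential x k (divTensor_tangential _ x)
    have t2 : ∑ i, pd i (fun y => D.news u y i k) x = n x k := (hN.divTensor_eq x k).symm
    have t3 : divTensor B x k = ∑ i, pd i (fun y => B y i k) x := by
      rw [divTensor_eq (fun a b => (hBs a b).c1) hBt']
      simp [hB]
    have t4 : divTensor Q x k = ∑ i, pd i (fun y => Q y i k) x + x.1 k * q x := by
      rw [divTensor_eq (fun a b => (hQs a b).c1) hQt', hQtr]
    have t5 : μ x = -(1 / 8) * pair (D.news u x) (D.news u x)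
        + 1 / 4 * ∑ i, pd i (fun y => n y i) x := by
      rw [hμ]
      simp only
      rw [hD.evolution_m, divForm_eq fun l => (hns l).c1]
    have t6 := hD.evolution_NA u x k
    rw [hD.deriv_comDensity, hD.deriv_shearStress, fluxDensity, t6]
    rw [Finset.sum_congr rfl fun i _ => hpw i]
    simp only [Finset.sum_add_distrib, Finset.sum_sub_distrib, ← Finset.mul_sum, t1, t2]
    simp only [grad, ← hc, ← hn, ← hB, ← hQ, ← hq, t3, t4, ← hμ]
    rw [t5]
    ring
  simp only [key]
  have i1 : Integrable (fun x => pd k q x - 2 * (x.1 k * q x)) area :=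
    (Continuous.integrable_area (hqs.c1.continuous_pd k)).sub
      (((c1_coord k).mul hqs.c1).integrable.const_mul 2)
  have i2 : Integrable (fun x => pd k μ x - 2 * (x.1 k * μ x)) area :=
    (Continuous.integrable_area (hμs.c1.continuous_pd k)).sub
      (((c1_coord k).mul hμs.c1).integrable.const_mul 2)
  have i3 : Integrable (fun x => ∑ i, pd i (fun y => w y i) x) area :=
    integrable_finsetSum _ fun i _ => Continuous.integrable_area ((hw i).continuous_pd i)
  have i4 : Integrable (fun x => 1 / 8 * (pd k q x - 2 * (x.1 k * q x))
      - u * (pd k μ x - 2 * (x.1 k * μ x))) area := (i1.const_mul _).sub (i2.const_mul _)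
  rw [integral_add i4 i3, integral_sub (i1.const_mul _) (i2.const_mul _), integral_const_mul,
    integral_const_mul,
    integral_pd_sub hqs.c1, integral_pd_sub hμs.c1, integral_sum_pd_of_tangential hw ht]
  ring

/-- Taking a quarter of the shear stress as a boundary term removes C · div N from the flux density.
The news then enters undifferentiated, and a supertranslation merely translates it. -/
theorem centerOfMass_sub (k : Fin 3) (a b : ℝ) :
    D.centerOfMass k b - D.centerOfMass k a
      = ∫ x, ((∫ s in a..b, D.fluxDensity k s x)
        + 1 / 4 * (D.shearStress k b x - D.shearStress k a x)) ∂area := by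
  have hq := hD.smooth_comDensity k
  have hs := hD.smooth_shearStress k
  have hf := hD.smooth_fluxDensity k
  let G : ℝ → S2 → ℝ := fun u x => deriv (fun s => D.comDensity k s x) u
      - 1 / 4 * deriv (fun s => D.shearStress k s x) u - D.fluxDensity k u x
  have hG : SmoothOnScri G := (hq.deriv.sub ((SmoothOnScri.const _).mul hs.deriv)).sub hf
  have hslice : ∀ {g : ℝ → S2 → ℝ}, SmoothOnScri g → ∀ x, Continuous fun u => g u x :=
    fun hg x => hg.continuous.comp (continuous_id.prodMk continuous_const)
  have hFTC : ∀ {g : ℝ → S2 → ℝ}, SmoothOnScri g → ∀ x,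
      ∫ s in a..b, deriv (fun s => g s x) s = g b x - g a x := fun hg x =>
    intervalIntegral.integral_eq_sub_of_hasDerivAt (fun s _ => hg.hasDerivAt s x)
      ((hslice hg.deriv x).intervalIntegrable _ _)
  have h0 : ∫ x, (∫ s in a..b, G s x) ∂area = 0 := by
    rw [integral_intervalIntegral_comm hG.continuous]
    simp only [G, hD.integral_deriv_comDensity_sub]
    simp
  have h1 : ∀ x, ∫ s in a..b, G s x = (D.comDensity k b x - D.comDensity k a x)
      - ((∫ s in a..b, D.fluxDensity k s x)
        + 1 / 4 * (D.shearStress k b x - D.shearStress k a x)) := by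
    intro x
    simp only [G]
    rw [intervalIntegral.integral_sub, intervalIntegral.integral_sub,
      intervalIntegral.integral_const_mul, hFTC hq, hFTC hs]
    · ring
    · exact (hslice hq.deriv x).intervalIntegrable _ _
    · exact ((hslice hs.deriv x).const_mul _).intervalIntegrable _ _
    · exact ((hslice hq.deriv x).sub ((hslice hs.deriv x).const_mul _)).intervalIntegrable _ _
    · exact (hslice hf x).intervalIntegrable _ _
  have iq : ∀ u, Integrable (D.comDensity k u) area := fun u => (hq.slice u).c1.integrable
  have is : ∀ u, Integrable (D.shearStress k u) area := fun u => (hs.slice u).c1.integrable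
  have iI : Integrable (fun x => ∫ s in a..b, D.fluxDensity k s x) area := by
    refine Continuous.integrable_area ?_
    exact intervalIntegral.continuous_parametric_intervalIntegral_of_continuous'
      (f := fun x s => D.fluxDensity k s x) (hf.continuous.comp continuous_swap) a b
  simp only [h1] at h0
  have i1 : Integrable (fun x => D.comDensity k b x - D.comDensity k a x) area := (iq b).sub (iq a)
  have i2 : Integrable (fun x => (∫ s in a..b, D.fluxDensity k s x)
      + 1 / 4 * (D.shearStress k b x - D.shearStress k a x)) area :=
    iI.add (((is b).sub (is a)).const_mul _)
  rw [integral_sub i1 i2, integral_sub (iq b) (iq a), ← hD.centerOfMass_eq, ← hD.centerOfMass_eq] at h0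
  linarith

end IsVacuum

end Data

/-! ### Decay in u, bounded convergence, and limits of primitives. -/

/-- Uniform decay of order `|u|^{-1-ε}`. -/
def Decays (ε : ℝ) (g : ℝ → S2 → ℝ) : Prop :=
  ∃ K : ℝ, 0 ≤ K ∧ ∀ u x, |g u x| ≤ K * (1 + |u|) ^ (-1 - ε)

/-- Uniform boundedness on `ℝ × S²`. -/
def BoundedOnScri (g : ℝ → S2 → ℝ) : Prop := ∃ K : ℝ, 0 ≤ K ∧ ∀ u x, |g u x| ≤ K

/-- Bounded convergence to `gl` along the filter `l`. -/
structure Conv (l : Filter ℝ) (g : ℝ → S2 → ℝ) (gl : S2 → ℝ) : Prop where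
  bdd : BoundedOnScri g
  tendsto : ∀ x, Tendsto (fun u => g u x) l (𝓝 (gl x))

section Bounded

variable {g h : ℝ → S2 → ℝ}

theorem BoundedOnScri.add (hg : BoundedOnScri g) (hh : BoundedOnScri h) :
    BoundedOnScri fun u x => g u x + h u x := by
  obtain ⟨K, hK, h1⟩ := hg
  obtain ⟨L, hL, h2⟩ := hh
  exact ⟨K + L, add_nonneg hK hL, fun u x => (abs_add_le _ _).trans (add_le_add (h1 u x) (h2 u x))⟩

theorem BoundedOnScri.mul (hg : BoundedOnScri g) (hh : BoundedOnScri h) :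
    BoundedOnScri fun u x => g u x * h u x := by
  obtain ⟨K, hK, h1⟩ := hg
  obtain ⟨L, hL, h2⟩ := hh
  refine ⟨K * L, mul_nonneg hK hL, fun u x => ?_⟩
  rw [abs_mul]
  exact mul_le_mul (h1 u x) (h2 u x) (abs_nonneg _) hK

theorem exists_bound_of_continuous {f : S2 → ℝ} (hf : Continuous f) :
    ∃ K : ℝ, 0 ≤ K ∧ ∀ x, |f x| ≤ K := by
  obtain ⟨K, hK⟩ := isCompact_univ.exists_bound_of_continuousOn hf.continuousOn
  exact ⟨max K 0, le_max_right _ _, fun x => (hK x (Set.mem_univ x)).trans (le_max_left _ _)⟩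

theorem BoundedOnScri.of_continuous {f : S2 → ℝ} (hf : Continuous f) :
    BoundedOnScri fun _ => f := by
  obtain ⟨K, hK, h⟩ := exists_bound_of_continuous hf
  exact ⟨K, hK, fun _ x => h x⟩

end Bounded

namespace Conv

variable {l : Filter ℝ} {g h : ℝ → S2 → ℝ} {gl hl : S2 → ℝ}

theorem add (hg : Conv l g gl) (hh : Conv l h hl) :
    Conv l (fun u x => g u x + h u x) (fun x => gl x + hl x) :=
  ⟨hg.bdd.add hh.bdd, fun x => (hg.tendsto x).add (hh.tendsto x)⟩

theorem mul (hg : Conv l g gl) (hh : Conv l h hl) :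
    Conv l (fun u x => g u x * h u x) (fun x => gl x * hl x) :=
  ⟨hg.bdd.mul hh.bdd, fun x => (hg.tendsto x).mul (hh.tendsto x)⟩

theorem of_continuous {f : S2 → ℝ} (hf : Continuous f) : Conv l (fun _ => f) f :=
  ⟨BoundedOnScri.of_continuous hf, fun _ => tendsto_const_nhds⟩

theorem const (c : ℝ) : Conv l (fun _ _ => c) fun _ => c := of_continuous continuous_const

theorem sub (hg : Conv l g gl) (hh : Conv l h hl) :
    Conv l (fun u x => g u x - h u x) (fun x => gl x - hl x) := by
  have := hg.add ((const (-1)).mul hh)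
  simpa [sub_eq_add_neg] using this

theorem sum {ι : Type*} {s : Finset ι} {g : ι → ℝ → S2 → ℝ} {gl : ι → S2 → ℝ}
    (hg : ∀ i ∈ s, Conv l (g i) (gl i)) :
    Conv l (fun u x => ∑ i ∈ s, g i u x) (fun x => ∑ i ∈ s, gl i x) := by
  classical
  induction s using Finset.induction_on with
  | empty => simpa using const (l := l) 0
  | insert a s ha ih =>
    simp only [Finset.sum_insert ha]
    exact (hg a (Finset.mem_insert_self a s)).add
      (ih fun b hb => hg b (Finset.mem_insert_of_mem hb))

/-- For fixed x the shift f(x) is a constant, so neither the pointwise limit nor the uniform bound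
changes. This is why f drops out of the arguments of all limits. -/
theorem shift (hl : ∀ c : ℝ, Tendsto (fun u => u + c) l l) (hg : Conv l g gl) (f : S2 → ℝ) :
    Conv l (fun u x => g (u + f x) x) gl :=
  ⟨let ⟨K, hK, h⟩ := hg.bdd; ⟨K, hK, fun _ x => h _ x⟩,
    fun x => (hg.tendsto x).comp (hl (f x))⟩

theorem tendsto_integral [l.IsCountablyGenerated] (hg : Conv l g gl)
    (hc : ∀ u, Continuous (g u)) :
    Tendsto (fun u => ∫ x, g u x ∂area) l (𝓝 (∫ x, gl x ∂area)) := by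
  obtain ⟨K, hK, h⟩ := hg.bdd
  exact tendsto_integral_filter_of_dominated_convergence (fun _ => K)
    (Eventually.of_forall fun u => (hc u).aestronglyMeasurable)
    (Eventually.of_forall fun u => ae_of_all _ fun x => h u x) (integrable_const K)
    (ae_of_all _ hg.tendsto)

theorem integrable [l.IsCountablyGenerated] [l.NeBot] (hg : Conv l g gl)
    (hc : ∀ u, Continuous (g u)) : Integrable gl area := by
  obtain ⟨K, hK, h⟩ := hg.bdd
  obtain ⟨v, hv⟩ := l.exists_seq_tendsto
  have hm : AEStronglyMeasurable gl area :=
    aestronglyMeasurable_of_tendsto_ae atTop (f := fun n => g (v n))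
      (fun n => (hc _).aestronglyMeasurable) (ae_of_all _ fun x => (hg.tendsto x).comp hv)
  refine Integrable.of_bound hm K (ae_of_all _ fun x => ?_)
  exact le_of_tendsto ((hg.tendsto x).abs) (Eventually.of_forall fun u => h u x)

end Conv

section Decay

variable {ε : ℝ} {g h : ℝ → S2 → ℝ}

theorem Decays.add (hg : Decays ε g) (hh : Decays ε h) : Decays ε fun u x => g u x + h u x := by
  obtain ⟨K, hK, h1⟩ := hg
  obtain ⟨L, hL, h2⟩ := hh
  refine ⟨K + L, add_nonneg hK hL, fun u x => (abs_add_le _ _).trans ?_⟩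
  rw [add_mul]
  exact add_le_add (h1 u x) (h2 u x)

theorem Decays.bounded_mul (hg : BoundedOnScri g) (hh : Decays ε h) :
    Decays ε fun u x => g u x * h u x := by
  obtain ⟨K, hK, h1⟩ := hg
  obtain ⟨L, hL, h2⟩ := hh
  refine ⟨K * L, mul_nonneg hK hL, fun u x => ?_⟩
  rw [abs_mul, mul_assoc]
  exact mul_le_mul (h1 u x) (h2 u x) (abs_nonneg _) hK

theorem Decays.const_mul (c : ℝ) (hh : Decays ε h) : Decays ε fun u x => c * h u x :=
  Decays.bounded_mul (BoundedOnScri.of_continuous continuous_const) hh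

theorem Decays.sum {ι : Type*} {s : Finset ι} {g : ι → ℝ → S2 → ℝ}
    (hg : ∀ i ∈ s, Decays ε (g i)) : Decays ε fun u x => ∑ i ∈ s, g i u x := by
  classical
  induction s using Finset.induction_on with
  | empty => exact ⟨0, le_rfl, fun u x => by simp⟩
  | insert a s ha ih =>
    simp only [Finset.sum_insert ha]
    exact (hg a (Finset.mem_insert_self a s)).add
      (ih fun b hb => hg b (Finset.mem_insert_of_mem hb))

theorem Decays.bounded (hε : 0 < ε) (hg : Decays ε g) : BoundedOnScri g := by
  obtain ⟨K, hK, h1⟩ := hg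
  refine ⟨K, hK, fun u x => (h1 u x).trans ?_⟩
  have : (1 + |u|) ^ (-1 - ε) ≤ 1 :=
    Real.rpow_le_one_of_one_le_of_nonpos (by linarith [abs_nonneg u]) (by linarith)
  nlinarith

/-- One of the two decaying factors absorbs u, because |u| (1 + |u|)^(-1-ε) ≤ 1. It serves the term
u |N|² of the flux density. -/
theorem Decays.u_mul_mul (hε : 0 < ε) (hg : Decays ε g) (hh : Decays ε h) :
    Decays ε fun u x => u * (g u x * h u x) := by
  obtain ⟨K, hK, h1⟩ := hg
  obtain ⟨L, hL, h2⟩ := hh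
  refine ⟨K * L, mul_nonneg hK hL, fun u x => ?_⟩
  have hp : 0 < 1 + |u| := by positivity
  set w := (1 + |u|) ^ (-1 - ε) with hw
  have hw0 : 0 ≤ w := by positivity
  have h3 : |u| * w ≤ 1 := by
    have h4 : (1 + |u|) * w = (1 + |u|) ^ (-ε) := by
      rw [hw, ← Real.rpow_one_add' hp.le (by linarith)]
      congr 1; ring
    have h5 : (1 + |u|) ^ (-ε) ≤ 1 :=
      Real.rpow_le_one_of_one_le_of_nonpos (by linarith [abs_nonneg u]) (by linarith)
    nlinarith
  rw [abs_mul, abs_mul]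
  calc |u| * (|g u x| * |h u x|) ≤ |u| * ((K * w) * (L * w)) := by
        gcongr
        · exact h1 u x
        · exact h2 u x
    _ = (|u| * w) * (K * L * w) := by ring
    _ ≤ 1 * (K * L * w) := by
        gcongr
    _ = K * L * w := one_mul _

/-- Bounded u are handled by compactness of [-R', R'] × S²; the weight 1 + |u| avoids the
singularity of |u|^(-1-ε) at 0. -/
theorem Decays.of_eventually (hε : 0 < ε) (hg : Continuous fun p : ℝ × S2 => g p.1 p.2) {K R : ℝ}
    (h : ∀ u, R ≤ |u| → 0 < |u| → ∀ x, |g u x| ≤ K * |u| ^ (-1 - ε)) : Decays ε g := by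
  set R' := max R 1 with hR'
  have hR1 : 1 ≤ R' := le_max_right _ _
  have hc : IsCompact (Set.Icc (-R') R' ×ˢ (Set.univ : Set S2)) := isCompact_Icc.prod isCompact_univ
  obtain ⟨M, hM⟩ := hc.exists_bound_of_continuousOn hg.continuousOn
  -- The factor 2^(1+ε) comes from 1 + |u| ≤ 2 |u| when |u| ≥ 1; the factor (1 + R')^(1+ε) bounds
  -- the inverse weight on the compact part.
  refine ⟨|K| * 2 ^ (1 + ε) + |M| * (1 + R') ^ (1 + ε), by positivity, fun u x => ?_⟩
  have hp : 0 < 1 + |u| := by positivity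
  have hw : 0 ≤ (1 + |u|) ^ (-1 - ε) := by positivity
  rw [add_mul]
  rcases le_total R' |u| with hu | hu
  · have hu1 : 1 ≤ |u| := hR1.trans hu
    have h1 := h u ((le_max_left _ _).trans hu) (by linarith) x
    have h2 : |u| ^ (-1 - ε) ≤ 2 ^ (1 + ε) * (1 + |u|) ^ (-1 - ε) := by
      have h3 : |u| ^ (-1 - ε) ≤ ((1 + |u|) / 2) ^ (-1 - ε) :=
        Real.rpow_le_rpow_of_nonpos (by positivity) (by linarith) (by linarith)
      rw [Real.div_rpow hp.le (by norm_num)] at h3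
      have h4 : (2 : ℝ) ^ (-1 - ε) = (2 ^ (1 + ε))⁻¹ := by
        rw [← Real.rpow_neg (by norm_num)]; congr 1; ring
      rw [h4, div_inv_eq_mul, mul_comm] at h3
      exact h3
    have h5 : 0 ≤ |u| ^ (-1 - ε) := by positivity
    calc |g u x| ≤ K * |u| ^ (-1 - ε) := h1
      _ ≤ |K| * |u| ^ (-1 - ε) := by gcongr; exact le_abs_self K
      _ ≤ |K| * (2 ^ (1 + ε) * (1 + |u|) ^ (-1 - ε)) := by gcongr
      _ = |K| * 2 ^ (1 + ε) * (1 + |u|) ^ (-1 - ε) := by ring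
      _ ≤ _ := le_add_of_nonneg_right (by positivity)
  · have h1 : |g u x| ≤ M := hM (u, x) ⟨abs_le.1 hu, Set.mem_univ x⟩
    have h2 : 1 ≤ (1 + R') ^ (1 + ε) * (1 + |u|) ^ (-1 - ε) := by
      have h3 : (1 + |u|) ^ (-1 - ε) = ((1 + |u|) ^ (1 + ε))⁻¹ := by
        rw [← Real.rpow_neg hp.le]; congr 1; ring
      rw [h3, ← div_eq_mul_inv, one_le_div (by positivity)]
      exact Real.rpow_le_rpow hp.le (by linarith) (by linarith)
    calc |g u x| ≤ |M| * 1 := by rw [mul_one]; exact h1.trans (le_abs_self M)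
      _ ≤ |M| * ((1 + R') ^ (1 + ε) * (1 + |u|) ^ (-1 - ε)) := by gcongr
      _ = |M| * (1 + R') ^ (1 + ε) * (1 + |u|) ^ (-1 - ε) := by ring
      _ ≤ _ := le_add_of_nonneg_left (by positivity)

theorem integrable_weight (hε : 0 < ε) : Integrable fun u : ℝ => (1 + |u|) ^ (-1 - ε) := by
  have := integrable_one_add_norm (E := ℝ) (μ := volume) (r := 1 + ε) (by simp; linarith)
  convert this using 2 with u
  rw [Real.norm_eq_abs]; congr 1; ring

theorem tendsto_weight (hε : 0 < ε) (l : Filter ℝ) (hl : Tendsto (fun u : ℝ => |u|) l atTop) :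
    Tendsto (fun u : ℝ => (1 + |u|) ^ (-1 - ε)) l (𝓝 0) := by
  have h1 : Tendsto (fun y : ℝ => y ^ (-(1 + ε))) atTop (𝓝 0) :=
    tendsto_rpow_neg_atTop (by linarith)
  have h2 := h1.comp (tendsto_atTop_add_const_left l 1 hl)
  refine h2.congr fun u => ?_
  simp only [Function.comp]
  congr 1; ring

theorem Decays.conv_zero (hε : 0 < ε) (hg : Decays ε g) {l : Filter ℝ}
    (hl : Tendsto (fun u : ℝ => |u|) l atTop) : Conv l g fun _ => 0 := by
  refine ⟨hg.bounded hε, fun x => ?_⟩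
  obtain ⟨K, hK, h1⟩ := hg
  refine squeeze_zero_norm (fun u => h1 u x) ?_
  simpa using (tendsto_weight hε l hl).const_mul K

/-- The primitive in `u` of a continuous decaying function converges as `u → ±∞`. -/
theorem Decays.conv_primitive (hε : 0 < ε) (hg : Decays ε g)
    (hc : Continuous fun p : ℝ × S2 => g p.1 p.2) :
    (∃ gl, Continuous gl ∧ Conv atTop (fun u x => ∫ s in (0 : ℝ)..u, g s x) gl) ∧
    (∃ gl, Continuous gl ∧ Conv atBot (fun u x => ∫ s in (0 : ℝ)..u, g s x) gl) := by
  obtain ⟨K, hK, h1⟩ := hg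
  have hφ : Integrable fun u : ℝ => K * (1 + |u|) ^ (-1 - ε) := (integrable_weight hε).const_mul K
  have hs : ∀ x, Continuous fun u => g u x := fun x =>
    hc.comp (continuous_id.prodMk continuous_const)
  have hu : ∀ u, Continuous fun x => g u x := fun u =>
    hc.comp (continuous_const.prodMk continuous_id)
  have hi : ∀ x, Integrable fun u => g u x := fun x =>
    hφ.mono' (hs x).aestronglyMeasurable (ae_of_all _ fun u => h1 u x)
  have hb : BoundedOnScri fun u x => ∫ s in (0 : ℝ)..u, g s x := by
    refine ⟨∫ u : ℝ, K * (1 + |u|) ^ (-1 - ε), integral_nonneg fun u => by positivity,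
      fun u x => ?_⟩
    rw [← Real.norm_eq_abs]
    calc ‖∫ s in (0 : ℝ)..u, g s x‖ ≤ ∫ s in Set.uIoc 0 u, ‖g s x‖ :=
          intervalIntegral.norm_integral_le_integral_norm_uIoc
      _ ≤ ∫ s in Set.uIoc 0 u, K * (1 + |s|) ^ (-1 - ε) :=
          integral_mono (hi x).norm.integrableOn hφ.integrableOn fun s => h1 s x
      _ ≤ ∫ s, K * (1 + |s|) ^ (-1 - ε) :=
          setIntegral_le_integral hφ (ae_of_all _ fun s => by positivity)
  have hcont : ∀ S : Set ℝ, Continuous fun x => ∫ s in S, g s x := fun S =>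
    continuous_of_dominated (fun x => (hs x).aestronglyMeasurable)
      (fun x => ae_of_all _ fun s => h1 s x) hφ.integrableOn (ae_of_all _ fun s => hu s)
  constructor
  · exact ⟨fun x => ∫ s in Set.Ioi 0, g s x, hcont _, hb, fun x =>
      intervalIntegral_tendsto_integral_Ioi 0 (hi x).integrableOn tendsto_id⟩
  · refine ⟨fun x => - ∫ s in Set.Iic 0, g s x, (hcont _).neg, hb, fun x => ?_⟩
    have := (intervalIntegral_tendsto_integral_Iic 0 (hi x).integrableOn tendsto_id).neg
    refine this.congr fun u => ?_
    rw [intervalIntegral.integral_symm]; simp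

/-- A function with decaying derivative converges as `u → ±∞`. -/
theorem conv_of_decays_deriv (hε : 0 < ε) (hg : SmoothOnScri g)
    (hd : Decays ε fun u x => deriv (fun s => g s x) u) :
    (∃ gl, Continuous gl ∧ Conv atTop g gl) ∧ (∃ gl, Continuous gl ∧ Conv atBot g gl) := by
  have h0 := (hg.slice 0).c1.continuous
  have hs : ∀ u x, g u x = g 0 x + ∫ s in (0 : ℝ)..u, deriv (fun s => g s x) s := by
    intro u x
    rw [intervalIntegral.integral_eq_sub_of_hasDerivAt (fun s _ => hg.hasDerivAt s x)
      ((hg.deriv.continuous.comp (continuous_id.prodMk continuous_const)).intervalIntegrable _ _)]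
    ring
  have hg' : g = fun u x => g 0 x + ∫ s in (0 : ℝ)..u, deriv (fun s => g s x) s :=
    funext fun u => funext fun x => hs u x
  obtain ⟨⟨p, hpc, hp⟩, ⟨q, hqc, hq⟩⟩ := hd.conv_primitive hε hg.deriv.continuous
  rw [hg']
  exact ⟨⟨fun x => g 0 x + p x, h0.add hpc, (Conv.of_continuous h0).add hp⟩,
    ⟨fun x => g 0 x + q x, h0.add hqc, (Conv.of_continuous h0).add hq⟩⟩

end Decay

/-! ### Transformation of fluxes under a supertranslation. -/

/-- The function `X̃^k f + ∇^A X̃^k ∇_A f`. -/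
def translationKernel (k : Fin 3) (f : S2 → ℝ) (x : S2) : ℝ := x.1 k * f x + pd k f x

theorem smoothOnS2_translationKernel {f : S2 → ℝ} (hf : SmoothOnS2 f) (k : Fin 3) :
    SmoothOnS2 (translationKernel k f) := ((smoothOnS2_coord k).mul hf).add (hf.pd k)

theorem SmoothOnScri.continuous_u {g : ℝ → S2 → ℝ} (hg : SmoothOnScri g) (x : S2) :
    Continuous fun u => g u x := hg.continuous.comp (continuous_id.prodMk continuous_const)

theorem SmoothOnScri.continuous_slice {g : ℝ → S2 → ℝ} (hg : SmoothOnScri g) (u : ℝ) :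
    Continuous (g u) := (hg.slice u).c1.continuous

theorem SmoothOnScri.hasDerivAt_primitive {g : ℝ → S2 → ℝ} (hg : SmoothOnScri g) (u : ℝ) (x : S2) :
    HasDerivAt (fun t => ∫ s in (0 : ℝ)..t, g s x) (g u x) u :=
  ((hg.continuous_u x).integral_hasStrictDerivAt 0 u).hasDerivAt

theorem SmoothOnScri.continuous_primitive {g : ℝ → S2 → ℝ} (hg : SmoothOnScri g) {f : S2 → ℝ}
    (hf : Continuous f) : Continuous fun x => ∫ s in (0 : ℝ)..f x, g s x :=
  intervalIntegral.continuous_parametric_intervalIntegral_of_continuous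
    (f := fun x s => g s x) (hg.continuous.comp continuous_swap) hf

namespace Data

variable (D : Data)

/-- `∇^A ∇^B C_{AB}`. -/
def divDivC (u : ℝ) (x : S2) : ℝ := ∑ j, pd j (fun y => divTensor (D.C u) y j) x

/-- A primitive in `u` of `N_{AB} N^{AB}`. -/
def newsEnergy (u : ℝ) (x : S2) : ℝ := ∫ s in (0 : ℝ)..u, pair (D.news s x) (D.news s x)

/-- A primitive in `u` of the flux density. -/
def fluxPrimitive (k : Fin 3) (u : ℝ) (x : S2) : ℝ := ∫ s in (0 : ℝ)..u, D.fluxDensity k s x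

/-- The shear stress after the supertranslation `f`. -/
def shiftedStress (f : S2 → ℝ) (k : Fin 3) (u : ℝ) (x : S2) : ℝ :=
  ∑ d, (D.C (u + f x) x k d + shearShift f x k d) *
    (divTensor (D.C (u + f x)) x d + ∑ i, D.news (u + f x) x i d * pd i f x
      + divTensor (shearShift f) x d)

/-- A primitive in `u` of the flux density after the supertranslation `f`. -/
def shiftedPrimitive (f : S2 → ℝ) (k : Fin 3) (u : ℝ) (x : S2) : ℝ :=
  D.fluxPrimitive k (u + f x) x - 1 / 4 * (translationKernel k f x * D.newsEnergy (u + f x) x)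
    - 1 / 2 * ∑ d, D.C (u + f x) x k d * divTensor (shearShift f) x d

/-- The density whose integral is the center of mass after the supertranslation `f`, up to a
constant in `u`. -/
def fluxPotential (f : S2 → ℝ) (k : Fin 3) (u : ℝ) (x : S2) : ℝ :=
  D.shiftedPrimitive f k u x + 1 / 4 * D.shiftedStress f k u x

variable {D}

theorem IsVacuum.smooth_divDivC (hD : D.IsVacuum) : SmoothOnScri D.divDivC :=
  SmoothOnScri.sum fun j _ => (hD.smooth_divC j).pd j

theorem IsVacuum.hasDerivAt_divDivC (hD : D.IsVacuum) (u : ℝ) (x : S2) :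
    HasDerivAt (fun s => D.divDivC s x) (divForm (divTensor (D.news u)) x) u := by
  rw [divForm_eq fun l => ((hD.smooth_divNews l).slice u).c1]
  refine HasDerivAt.fun_sum fun j _ => ?_
  have h := ((hD.smooth_divC j).pd j).hasDerivAt u x
  rw [(hD.smooth_divC j).deriv_pd] at h
  simpa only [(hD.hasDerivAt_divC u _ j).deriv] using h

/-- The evolution of m integrated from 0: the combination m + ⅛ B - ¼ div div C is conserved. -/
theorem IsVacuum.mass_eq (hD : D.IsVacuum) (u : ℝ) (x : S2) :
    D.m u x = D.m 0 x - 1 / 8 * D.newsEnergy u x + 1 / 4 * (D.divDivC u x - D.divDivC 0 x) := by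
  have h : ∀ s, HasDerivAt
      (fun s => D.m s x + 1 / 8 * D.newsEnergy s x - 1 / 4 * D.divDivC s x) 0 s := by
    intro s
    have h1 := hD.smooth_m.hasDerivAt s x
    rw [hD.evolution_m] at h1
    have h2 : HasDerivAt (fun t => D.newsEnergy t x) _ s :=
      hD.smooth_pair_news.hasDerivAt_primitive s x
    have h3 := (h1.add (h2.const_mul (1 / 8))).sub ((hD.hasDerivAt_divDivC s x).const_mul (1 / 4))
    refine h3.congr_deriv ?_
    ring
  have h0 : D.newsEnergy 0 x = 0 := by simp [newsEnergy]
  have := is_const_of_deriv_eq_zero (fun s => (h s).differentiableAt) (fun s => (h s).deriv) u 0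
  simp only [h0] at this
  linarith

/-- Two derivatives along the sphere are needed only for div div N, which drives m and div div C. -/
theorem NewsDecay.exists_decays (hD : D.IsVacuum) (hN : D.NewsDecay) : ∃ ε : ℝ, 0 < ε ∧
    (∀ i j, Decays ε fun u x => D.news u x i j) ∧
    (∀ j, Decays ε fun u x => divTensor (D.news u) x j) ∧
    Decays ε fun u x => divForm (divTensor (D.news u)) x := by
  obtain ⟨ε, K, R, hε, h⟩ := hN
  have h2 : ∀ a b i j, Decays ε fun u x => pd a (pd b fun y => D.news u y i j) x :=
    fun a b i j => Decays.of_eventually hε (((hD.smooth_news i j).pd b).pd a).continuous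
      fun u hu hu0 x => (h u hu hu0 x i j).2.2 a b
  refine ⟨ε, hε, fun i j => ?_, fun j => ?_, ?_⟩
  · exact Decays.of_eventually hε (hD.smooth_news i j).continuous
      fun u hu hu0 x => (h u hu hu0 x i j).1
  · simp only [(hD.isSTF_news _).divTensor_eq]
    exact Decays.sum fun i _ => Decays.of_eventually hε ((hD.smooth_news i j).pd i).continuous
      fun u hu hu0 x => (h u hu hu0 x i j).2.1 i
  · have e : ∀ u x, divForm (divTensor (D.news u)) x
        = ∑ j, ∑ i, pd j (pd i fun y => D.news u y i j) x := by
      intro u x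
      rw [divForm_eq fun l => ((hD.smooth_divNews l).slice u).c1]
      refine Finset.sum_congr rfl fun j _ => ?_
      simp only [(hD.isSTF_news _).divTensor_eq]
      rw [pd_sum _ _ fun i _ => (((hD.smooth_news i j).pd i).slice u).c1]
    simp only [e]
    exact Decays.sum fun j _ => Decays.sum fun i _ => h2 j i i j

/-- Limits of the data and of the fluxes along the filter `l`. -/
structure ScriLimit (D : Data) (l : Filter ℝ) where
  flux : Fin 3 → S2 → ℝ
  newsEnergy : S2 → ℝ
  shear : Fin 3 → Fin 3 → S2 → ℝ
  shearDiv : Fin 3 → S2 → ℝ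
  shearDivDiv : S2 → ℝ
  mass : S2 → ℝ
  conv_flux : ∀ k, Conv l (D.fluxPrimitive k) (flux k)
  conv_newsEnergy : Conv l D.newsEnergy newsEnergy
  conv_shear : ∀ i j, Conv l (fun u x => D.C u x i j) (shear i j)
  conv_news : ∀ i j, Conv l (fun u x => D.news u x i j) fun _ => 0
  conv_shearDiv : ∀ j, Conv l (fun u x => divTensor (D.C u) x j) (shearDiv j)
  conv_shearDivDiv : Conv l D.divDivC shearDivDiv
  conv_mass : Conv l D.m mass
  continuous_mass : Continuous mass

theorem exists_scriLimit (hD : D.IsVacuum) (hN : D.NewsDecay) {l : Filter ℝ}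
    (hl : l = atTop ∨ l = atBot) : Nonempty (ScriLimit D l) := by
  obtain ⟨ε, hε, h0, h1, h2⟩ := NewsDecay.exists_decays hD hN
  have habs : Tendsto (fun u : ℝ => |u|) l atTop := by
    rcases hl with rfl | rfl
    · exact tendsto_abs_atTop_atTop
    · exact tendsto_abs_atBot_atTop
  have conv : ∀ {g : ℝ → S2 → ℝ}, SmoothOnScri g → (Decays ε fun u x => deriv (fun s => g s x) u) →
      ∃ gl, Continuous gl ∧ Conv l g gl := by
    intro g hg hd
    have := conv_of_decays_deriv hε hg hd
    rcases hl with rfl | rfl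
    exacts [this.1, this.2]
  have prim : ∀ {g : ℝ → S2 → ℝ}, SmoothOnScri g → Decays ε g →
      ∃ gl, Continuous gl ∧ Conv l (fun u x => ∫ s in (0 : ℝ)..u, g s x) gl := by
    intro g hg hd
    have := hd.conv_primitive hε hg.continuous
    rcases hl with rfl | rfl
    exacts [this.1, this.2]
  have hC : ∀ i j, ∃ gl, Continuous gl ∧ Conv l (fun u x => D.C u x i j) gl := fun i j =>
    conv (hD.smooth_C i j) (h0 i j)
  have hc : ∀ j, ∃ gl, Continuous gl ∧ Conv l (fun u x => divTensor (D.C u) x j) gl := fun j =>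
    conv (hD.smooth_divC j) (by simpa only [(hD.hasDerivAt_divC _ _ _).deriv] using h1 j)
  have hd : ∃ gl, Continuous gl ∧ Conv l D.divDivC gl :=
    conv hD.smooth_divDivC (by simpa only [(hD.hasDerivAt_divDivC _ _).deriv] using h2)
  have hNN : Decays ε fun u x => pair (D.news u x) (D.news u x) :=
    Decays.sum fun i _ => Decays.sum fun j _ => Decays.bounded_mul ((h0 i j).bounded hε) (h0 i j)
  have huNN : Decays ε fun u x => u * pair (D.news u x) (D.news u x) := by
    simp only [pair, Finset.mul_sum]
    exact Decays.sum fun i _ => Decays.sum fun j _ => Decays.u_mul_mul hε (h0 i j) (h0 i j)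
  have hm : ∃ gl, Continuous gl ∧ Conv l D.m gl := by
    refine conv hD.smooth_m ?_
    simp only [hD.evolution_m]
    exact (hNN.const_mul _).add (h2.const_mul _)
  choose C hCc hC using hC
  choose c hcc hc using hc
  obtain ⟨d, hdc, hd⟩ := hd
  obtain ⟨m, hmc, hm⟩ := hm
  have hB : ∃ gl, Continuous gl ∧ Conv l D.newsEnergy gl := prim hD.smooth_pair_news hNN
  have hA : ∀ k, ∃ gl, Continuous gl ∧ Conv l (D.fluxPrimitive k) gl := by
    intro k
    refine prim (hD.smooth_fluxDensity k) ?_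
    -- Arranged as bounded times decaying: div C is bounded because it converges, so N_k · div C
    -- decays like the news.
    have e : D.fluxDensity k = fun u x => (1 / 4 * x.1 k) * (u * pair (D.news u x) (D.news u x))
        + (-(1 / 2)) * ∑ d, divTensor (D.C u) x d * D.news u x k d := by
      funext u x
      simp only [fluxDensity, mul_comm (divTensor _ _ _)]
      ring
    rw [e]
    exact (Decays.bounded_mul (BoundedOnScri.of_continuous
      ((C1.const (1 / 4)).mul (c1_coord k)).continuous) huNN).add
      (Decays.const_mul _ (Decays.sum fun d _ => Decays.bounded_mul (hc d).bdd (h0 k d)))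
  choose A hAc hA using hA
  obtain ⟨B, hBc, hB⟩ := hB
  exact ⟨⟨A, B, C, c, d, m, hA, hB, hC, fun i j => (h0 i j).conv_zero hε habs, hc, hd, hm, hmc⟩⟩

section Supertranslation

variable {D' : Data} {f : S2 → ℝ}

theorem IsSupertranslate.C_eq' (h : D.IsSupertranslate f D') (u : ℝ) (x : S2) (i j : Fin 3) :
    D'.C u x i j = D.C (u + f x) x i j + shearShift f x i j := by
  rw [h.C_eq, shearShift]; ring

theorem IsSupertranslate.news_eq (h : D.IsSupertranslate f D') (u : ℝ) (x : S2) (i j : Fin 3) :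
    D'.news u x i j = D.news (u + f x) x i j := by
  simp only [news, h.C_eq']
  rw [deriv_add_const, deriv_comp_add_const (fun s => D.C s x i j)]

/-- The term N · ∇f is the chain rule for C evaluated at u + f(x). -/
theorem IsSupertranslate.divTensor_C_eq (hD : D.IsVacuum) (hf : SmoothOnS2 f)
    (h : D.IsSupertranslate f D') (u : ℝ) (x : S2) (j : Fin 3) :
    divTensor (D'.C u) x j = divTensor (D.C (u + f x)) x j
      + ∑ i, D.news (u + f x) x i j * pd i f x + divTensor (shearShift f) x j := by
  rw [(h.vacuum.isSTF_C u).divTensor_eq, (hD.isSTF_C _).divTensor_eq,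
    (isSTF_shearShift hf).divTensor_eq, ← Finset.sum_add_distrib, ← Finset.sum_add_distrib]
  refine Finset.sum_congr rfl fun i _ => ?_
  simp only [h.C_eq']
  rw [pd_add i (((hD.smooth_C i j).shift hf).slice u).c1 ((isSTF_shearShift hf).c1 i j),
    (hD.smooth_C i j).pd_shift hf.c1]
  rfl

theorem IsSupertranslate.shearStress_eq (hD : D.IsVacuum) (hf : SmoothOnS2 f)
    (h : D.IsSupertranslate f D') (k : Fin 3) (u : ℝ) (x : S2) :
    D'.shearStress k u x = D.shiftedStress f k u x := by
  simp only [shearStress, shiftedStress, h.C_eq', h.divTensor_C_eq hD hf]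

/-- The kernel φ has two sources: writing the explicit u as (u + f) - f gives the part X̃^k f, and
N_k · (N · ∇f) = ½ |N|² ∂_k f, by `IsSTF.sum_mul_self`, gives the part ∂_k f. -/
theorem IsSupertranslate.fluxDensity_eq (hD : D.IsVacuum) (hf : SmoothOnS2 f)
    (h : D.IsSupertranslate f D') (k : Fin 3) (u : ℝ) (x : S2) :
    D'.fluxDensity k u x = D.fluxDensity k (u + f x) x
      - 1 / 4 * (translationKernel k f x * pair (D.news (u + f x) x) (D.news (u + f x) x))
      - 1 / 2 * ∑ d, D.news (u + f x) x k d * divTensor (shearShift f) x d := by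
  have hN := hD.isSTF_news (u + f x)
  have e : D'.news u x = D.news (u + f x) x := by
    funext i j; exact h.news_eq u x i j
  have t : ∑ d, D.news (u + f x) x k d * ∑ i, D.news (u + f x) x i d * pd i f x
      = 1 / 2 * pair (D.news (u + f x) x) (D.news (u + f x) x) * pd k f x := by
    simp only [Finset.mul_sum]
    rw [Finset.sum_comm]
    simp only [← mul_assoc, ← Finset.sum_mul, hN.sum_mul_self]
    rw [← sum_σ_mul_of_tangential x k (sum_coord_mul_pd hf.c1 x), Finset.mul_sum]
    exact Finset.sum_congr rfl fun i _ => by ring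
  simp only [fluxDensity, e, h.divTensor_C_eq hD hf, mul_add, Finset.sum_add_distrib, t,
    translationKernel]
  ring

theorem hasDerivAt_shiftedPrimitive (hD : D.IsVacuum) (hf : SmoothOnS2 f)
    (h : D.IsSupertranslate f D') (k : Fin 3) (u : ℝ) (x : S2) :
    HasDerivAt (fun s => D.shiftedPrimitive f k s x) (D'.fluxDensity k u x) u := by
  have h1 := ((hD.smooth_fluxDensity k).hasDerivAt_primitive (u + f x) x).comp_add_const u (f x)
  have h2 := (hD.smooth_pair_news.hasDerivAt_primitive (u + f x) x).comp_add_const u (f x)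
  have h3 := fun d => (hD.hasDerivAt_C (u + f x) x k d).comp_add_const u (f x)
  have h4 := (h1.sub ((h2.const_mul (translationKernel k f x)).const_mul (1 / 4))).sub
    ((HasDerivAt.fun_sum fun d (_ : d ∈ Finset.univ) =>
      (h3 d).mul_const (divTensor (shearShift f) x d)).const_mul (1 / 2))
  rw [h.fluxDensity_eq hD hf]
  exact h4

theorem continuous_fluxPotential (hD : D.IsVacuum) (hf : SmoothOnS2 f) (k : Fin 3) (u : ℝ) :
    Continuous (D.fluxPotential f k u) := by
  have hs : Continuous fun x => u + f x := continuous_const.add hf.c1.continuous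
  have c1 : Continuous fun x => D.fluxPrimitive k (u + f x) x :=
    (hD.smooth_fluxDensity k).continuous_primitive hs
  have c2 : Continuous fun x => D.newsEnergy (u + f x) x :=
    hD.smooth_pair_news.continuous_primitive hs
  have c3 := fun i j => ((hD.smooth_C i j).shift hf).continuous_slice u
  have c4 := fun i j => ((hD.smooth_news i j).shift hf).continuous_slice u
  have c5 := fun j => ((hD.smooth_divC j).shift hf).continuous_slice u
  have c6 := fun i => hf.c1.continuous_pd i
  have c7 := fun i j => ((isSTF_shearShift hf).c1 i j).continuous
  have c8 := fun j => ((isSTF_shearShift hf).smoothOnS2_divTensor j).c1.continuous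
  have c9 := (smoothOnS2_translationKernel hf k).c1.continuous
  unfold fluxPotential shiftedPrimitive shiftedStress
  fun_prop

/-- The angular momentum aspect of D' enters only through the value at u = 0, so the choice of
solution cannot affect the flux. -/
theorem IsSupertranslate.centerOfMass_eq (hD : D.IsVacuum) (hf : SmoothOnS2 f)
    (h : D.IsSupertranslate f D') (k : Fin 3) (u : ℝ) :
    D'.centerOfMass k u = D'.centerOfMass k 0 - (∫ x, D.fluxPotential f k 0 x ∂area)
      + ∫ x, D.fluxPotential f k u x ∂area := by
  have h1 := h.vacuum.centerOfMass_sub k 0 u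
  have h2 : ∀ x, (∫ s in (0 : ℝ)..u, D'.fluxDensity k s x)
      + 1 / 4 * (D'.shearStress k u x - D'.shearStress k 0 x)
      = D.fluxPotential f k u x - D.fluxPotential f k 0 x := by
    intro x
    rw [intervalIntegral.integral_eq_sub_of_hasDerivAt
      (fun s _ => hasDerivAt_shiftedPrimitive hD hf h k s x)
      (((h.vacuum.smooth_fluxDensity k).continuous_u x).intervalIntegrable _ _),
      h.shearStress_eq hD hf, h.shearStress_eq hD hf]
    simp only [fluxPotential]
    ring
  simp only [h2] at h1
  rw [integral_sub (Continuous.integrable_area (continuous_fluxPotential hD hf k u))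
    (Continuous.integrable_area (continuous_fluxPotential hD hf k 0))] at h1
  linarith

end Supertranslation

end Data

theorem integral_add_four {a b c d : S2 → ℝ} (ha : Integrable a area) (hb : Integrable b area)
    (hc : Integrable c area) (hd : Integrable d area) :
    ∫ x, (a x + b x + c x + d x) ∂area
      = (∫ x, a x ∂area) + (∫ x, b x ∂area) + (∫ x, c x ∂area) + ∫ x, d x ∂area := by
  have hab : Integrable (fun x => a x + b x) area := ha.add hb
  have habc : Integrable (fun x => a x + b x + c x) area := hab.add hc
  rw [integral_add habc hd, integral_add hab hc, integral_add ha hb]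

/-! ### The limiting center of mass and the flux formula. -/

namespace Data

variable {D D' : Data} {f : S2 → ℝ} {l : Filter ℝ}

/-- The limit of the flux potential. -/
def ScriLimit.potential (L : ScriLimit D l) (f : S2 → ℝ) (k : Fin 3) (x : S2) : ℝ :=
  L.flux k x - 1 / 4 * (translationKernel k f x * L.newsEnergy x)
    - 1 / 2 * ∑ d, L.shear k d x * divTensor (shearShift f) x d
    + 1 / 4 * ∑ d, (L.shear k d x + shearShift f x k d) *
      -- The factor 0 is the limit of the news, kept so that this is literally the limit produced by
      -- the `Conv` combinators.
      (L.shearDiv d x + ∑ i, 0 * pd i f x + divTensor (shearShift f) x d)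

theorem ScriLimit.conv_fluxPotential (L : ScriLimit D l) (hf : SmoothOnS2 f)
    (hl : ∀ c : ℝ, Tendsto (fun u => u + c) l l) (k : Fin 3) :
    Conv l (D.fluxPotential f k) (L.potential f k) := by
  have hh := fun j => Conv.of_continuous (l := l)
    ((isSTF_shearShift hf).smoothOnS2_divTensor j).c1.continuous
  have hH := fun i j => Conv.of_continuous (l := l) ((isSTF_shearShift hf).c1 i j).continuous
  have hφ := Conv.of_continuous (l := l) (smoothOnS2_translationKernel hf k).c1.continuous
  have hp := fun i => Conv.of_continuous (l := l) (hf.c1.continuous_pd i)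
  have hC := fun i j => (L.conv_shear i j).shift hl f
  exact ((((L.conv_flux k).shift hl f).sub ((Conv.const _).mul
    (hφ.mul (L.conv_newsEnergy.shift hl f)))).sub
    ((Conv.const _).mul (Conv.sum fun d _ => (hC k d).mul (hh d)))).add
    ((Conv.const _).mul (Conv.sum fun d _ => ((hC k d).add (hH k d)).mul
      ((((L.conv_shearDiv d).shift hl f).add
        (Conv.sum fun i _ => ((L.conv_news i d).shift hl f).mul (hp i))).add (hh d))))

/-- The part of the limiting center of mass that does not depend on `f`. -/
def ScriLimit.com (L : ScriLimit D l) (k : Fin 3) : ℝ :=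
  ∫ x, (L.flux k x + 1 / 4 * ∑ d, L.shear k d x * L.shearDiv d x) ∂area

/-- The part of the limiting center of mass after a supertranslation that does not depend on the
end of null infinity. -/
def comConstant (D D' : Data) (f : S2 → ℝ) (k : Fin 3) : ℝ :=
  D'.centerOfMass k 0 - (∫ x, D.fluxPotential f k 0 x ∂area)
    + ∫ x, (1 / 4 * ∑ d, shearShift f x k d * divTensor (shearShift f) x d
      - 2 * translationKernel k f x * (D.m 0 x - 1 / 4 * D.divDivC 0 x)) ∂area

theorem ScriLimit.mass_eq [l.NeBot] (L : ScriLimit D l) (hD : D.IsVacuum) (x : S2) :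
    L.mass x = D.m 0 x - 1 / 8 * L.newsEnergy x + 1 / 4 * (L.shearDivDiv x - D.divDivC 0 x) := by
  have h1 := (((L.conv_newsEnergy.tendsto x).const_mul (1 / 8)).const_sub (D.m 0 x)).add
    (((L.conv_shearDivDiv.tendsto x).sub_const (D.divDivC 0 x)).const_mul (1 / 4))
  simp only [← hD.mass_eq] at h1
  exact tendsto_nhds_unique (L.conv_mass.tendsto x) h1

/-- The limiting shear is not known to be differentiable, and `shearDiv` is a limit of divergences.
So the identity is applied at each finite u and passed to the limit by bounded convergence. -/
theorem ScriLimit.integral_shearShift [l.NeBot] [l.IsCountablyGenerated] (L : ScriLimit D l)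
    (hD : D.IsVacuum) (hf : SmoothOnS2 f) (k : Fin 3) :
    Integrable (fun x => ∑ j, (shearShift f x k j * L.shearDiv j x
      - L.shear k j x * divTensor (shearShift f) x j)
      - 2 * translationKernel k f x * L.shearDivDiv x) area ∧
    ∫ x, (∑ j, (shearShift f x k j * L.shearDiv j x
      - L.shear k j x * divTensor (shearShift f) x j)
      - 2 * translationKernel k f x * L.shearDivDiv x) ∂area = 0 := by
  have hh := fun j => ((isSTF_shearShift hf).smoothOnS2_divTensor j).c1.continuous
  have hH := fun i j => ((isSTF_shearShift hf).c1 i j).continuous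
  have hφ := (smoothOnS2_translationKernel hf k).c1.continuous
  have s1 : Conv l (fun u x => ∑ j, (shearShift f x k j * divTensor (D.C u) x j
      - D.C u x k j * divTensor (shearShift f) x j)) (fun x => ∑ j,
      (shearShift f x k j * L.shearDiv j x - L.shear k j x * divTensor (shearShift f) x j)) :=
    Conv.sum fun j _ => ((Conv.of_continuous (hH k j)).mul (L.conv_shearDiv j)).sub
      ((L.conv_shear k j).mul (Conv.of_continuous (hh j)))
  have s2 : Conv l (fun u x => 2 * translationKernel k f x * D.divDivC u x)
      (fun x => 2 * translationKernel k f x * L.shearDivDiv x) :=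
    (Conv.of_continuous (continuous_const.mul hφ)).mul L.conv_shearDivDiv
  have hc := s1.sub s2
  have hcont : ∀ u, Continuous fun x => ∑ j, (shearShift f x k j * divTensor (D.C u) x j
      - D.C u x k j * divTensor (shearShift f) x j)
      - 2 * translationKernel k f x * D.divDivC u x := by
    intro u
    have h1 := fun j => (hD.smooth_divC j).continuous_slice u
    have h2 := fun i j => (hD.smooth_C i j).continuous_slice u
    exact (continuous_finsetSum _ fun j _ => ((hH k j).mul (h1 j)).sub ((h2 k j).mul (hh j))).sub
      ((continuous_const.mul hφ).mul (hD.smooth_divDivC.continuous_slice u))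
  refine ⟨hc.integrable hcont, ?_⟩
  have ht := hc.tendsto_integral hcont
  have h0 : ∀ u, ∫ x, (∑ j, (shearShift f x k j * divTensor (D.C u) x j
      - D.C u x k j * divTensor (shearShift f) x j)
      - 2 * translationKernel k f x * D.divDivC u x) ∂area = 0 := fun u => by
    have h5 := integral_shearShift_mul_divTensor hf (hD.isSTF_C u) k
    unfold translationKernel divDivC
    exact h5
  simp only [h0] at ht
  exact tendsto_nhds_unique ht tendsto_const_nhds

theorem ScriLimit.integral_potential [l.NeBot] [l.IsCountablyGenerated] (L : ScriLimit D l)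
    (hD : D.IsVacuum) (hf : SmoothOnS2 f) (k : Fin 3) :
    ∫ x, L.potential f k x ∂area = L.com k
      + (∫ x, (1 / 4 * ∑ d, shearShift f x k d * divTensor (shearShift f) x d
        - 2 * translationKernel k f x * (D.m 0 x - 1 / 4 * D.divDivC 0 x)) ∂area)
      + ∫ x, 2 * translationKernel k f x * L.mass x ∂area := by
  have hh := fun j => ((isSTF_shearShift hf).smoothOnS2_divTensor j).c1.continuous
  have hH := fun i j => ((isSTF_shearShift hf).c1 i j).continuous
  have hφ := (smoothOnS2_translationKernel hf k).c1.continuous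
  have hm0 := hD.smooth_m.continuous_slice 0
  have hd0 := hD.smooth_divDivC.continuous_slice 0
  obtain ⟨i4, h4⟩ := L.integral_shearShift hD hf k
  -- Expanding the stress leaves ¼ C·c + ¼ H·h + ¼ (H·c - C·h), with c and h the divergences of C
  -- and H; `mass_eq` trades the news energy for the mass, and its term in div div C completes the
  -- last bracket to the integrand that integrates to zero.
  have e : ∀ x, L.potential f k x = (((L.flux k x + 1 / 4 * ∑ d, L.shear k d x * L.shearDiv d x)
      + (1 / 4 * ∑ d, shearShift f x k d * divTensor (shearShift f) x d
        - 2 * translationKernel k f x * (D.m 0 x - 1 / 4 * D.divDivC 0 x)))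
      + 2 * translationKernel k f x * L.mass x)
      + 1 / 4 * (∑ j, (shearShift f x k j * L.shearDiv j x
        - L.shear k j x * divTensor (shearShift f) x j)
        - 2 * translationKernel k f x * L.shearDivDiv x) := by
    intro x
    rw [L.mass_eq hD, ScriLimit.potential]
    simp only [zero_mul, Finset.sum_const_zero, add_zero, mul_add, add_mul,
      Finset.sum_add_distrib, Finset.sum_sub_distrib]
    ring
  have i1 : Integrable (fun x => L.flux k x + 1 / 4 * ∑ d, L.shear k d x * L.shearDiv d x) area := by
    have hc : Conv l (fun u x => D.fluxPrimitive k u x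
        + 1 / 4 * ∑ d, D.C u x k d * divTensor (D.C u) x d) _ :=
      (L.conv_flux k).add ((Conv.const (1 / 4)).mul
        (Conv.sum fun d _ => (L.conv_shear k d).mul (L.conv_shearDiv d)))
    refine hc.integrable fun u => ?_
    have h1 := fun j => (hD.smooth_divC j).continuous_slice u
    have h2 := fun i j => (hD.smooth_C i j).continuous_slice u
    have h3 : Continuous fun x => D.fluxPrimitive k u x :=
      (hD.smooth_fluxDensity k).continuous_primitive continuous_const
    fun_prop
  have i2 : Integrable (fun x => 1 / 4 * ∑ d, shearShift f x k d * divTensor (shearShift f) x d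
      - 2 * translationKernel k f x * (D.m 0 x - 1 / 4 * D.divDivC 0 x)) area := by
    refine Continuous.integrable_area ?_
    fun_prop
  have i3 : Integrable (fun x => 2 * translationKernel k f x * L.mass x) area := by
    have := L.continuous_mass
    refine Continuous.integrable_area ?_
    fun_prop
  simp only [e]
  rw [integral_add_four i1 i2 i3 (i4.const_mul _), integral_const_mul, h4, ScriLimit.com]
  ring

theorem ScriLimit.tendsto_centerOfMass [l.NeBot] [l.IsCountablyGenerated] (L : ScriLimit D l)
    (hl : ∀ c : ℝ, Tendsto (fun u => u + c) l l) (hD : D.IsVacuum) (hf : SmoothOnS2 f)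
    (h : D.IsSupertranslate f D') (k : Fin 3) :
    Tendsto (D'.centerOfMass k) l (𝓝 (L.com k + comConstant D D' f k
      + ∫ x, 2 * translationKernel k f x * L.mass x ∂area)) := by
  have h1 := ((L.conv_fluxPotential hf hl k).tendsto_integral
    (continuous_fluxPotential hD hf k)).const_add
    (D'.centerOfMass k 0 - (∫ x, D.fluxPotential f k 0 x ∂area))
  simp only [← h.centerOfMass_eq hD hf] at h1
  rw [L.integral_potential hD hf] at h1
  convert h1 using 2
  rw [comConstant]; ring

theorem isSupertranslate_zero (hD : D.IsVacuum) : D.IsSupertranslate (fun _ => 0) D where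
  vacuum := hD
  m_eq u x := by
    have h2 : ∀ i, pd i (fun _ => (0 : ℝ)) = fun _ => 0 := fun i => funext fun y => pd_const i 0 y
    simp [grad, hess_eq (SmoothOnS2.const 0), pair, h2]
  C_eq u x i j := by
    have h2 : ∀ i, pd i (fun _ => (0 : ℝ)) = fun _ => 0 := fun i => funext fun y => pd_const i 0 y
    simp [hess_eq (SmoothOnS2.const 0), lap_eq (SmoothOnS2.const 0), h2]

/-- The center of mass flux and its change under supertranslations. -/
theorem exists_flux (hD : D.IsVacuum) (Lp : ScriLimit D atTop) (Lm : ScriLimit D atBot) :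
    ∃ F : Fin 3 → ℝ, (∀ k, HasTotalFlux (D.centerOfMass k) (F k)) ∧
      ∀ f, SmoothOnS2 f → ∀ D', D.IsSupertranslate f D' → ∀ k,
        HasTotalFlux (D'.centerOfMass k)
          (F k + ∫ x, 2 * translationKernel k f x * (Lp.mass x - Lm.mass x) ∂area) := by
  have key : ∀ f, SmoothOnS2 f → ∀ D', D.IsSupertranslate f D' → ∀ k,
      HasTotalFlux (D'.centerOfMass k) (Lp.com k - Lm.com k
        + ∫ x, 2 * translationKernel k f x * (Lp.mass x - Lm.mass x) ∂area) := by
    intro f hf D' h k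
    refine ⟨_, _, Lp.tendsto_centerOfMass (fun c => tendsto_atTop_add_const_right _ c tendsto_id)
      hD hf h k, Lm.tendsto_centerOfMass
      (fun c => tendsto_atBot_add_const_right _ c tendsto_id) hD hf h k, ?_⟩
    have hφ := (smoothOnS2_translationKernel hf k).c1.continuous
    have i1 : Integrable (fun x => 2 * translationKernel k f x * Lp.mass x) area :=
      Continuous.integrable_area ((continuous_const.mul hφ).mul Lp.continuous_mass)
    have i2 : Integrable (fun x => 2 * translationKernel k f x * Lm.mass x) area :=
      Continuous.integrable_area ((continuous_const.mul hφ).mul Lm.continuous_mass)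
    simp only [mul_sub]
    rw [integral_sub i1 i2]
    ring
  refine ⟨fun k => Lp.com k - Lm.com k, fun k => ?_, key⟩
  -- The flux of D itself is the case f = 0, where the kernel vanishes.
  have := key _ (SmoothOnS2.const 0) D (isSupertranslate_zero hD) k
  simpa [translationKernel, pd_const] using this

end Data

/-! ### Existence of supertranslated data. -/

/-- Smoothness of a primitive that depends on parameters. -/
theorem SmoothOnScri.primitive {g : ℝ → S2 → ℝ} (hg : SmoothOnScri g) :
    SmoothOnScri fun u x => ∫ s in (0 : ℝ)..u, g s x := by
  let χ : ContDiffBump (0 : ℝ) := ⟨1, 2, one_pos, one_lt_two⟩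
  let w : ℝ → ℝ := Set.indicator (Set.Ioc 0 1) fun _ => 1
  -- The primitive is u ∫₀¹ g(ut) dt, and this integral is the convolution at 0 of the indicator of
  -- (0, 1] with χ(z) g(-uz). The bump χ makes the second factor compactly supported and equals 1 on
  -- the points -t that are used.
  let G : ℝ × E3 → ℝ → ℝ := fun p z => χ z * scriExt g (p.1 * (-z), p.2)
  have hG : ContDiffOn ℝ ∞ ↿G (punctured ×ˢ Set.univ) := by
    have h1 : ContDiff ℝ ∞ fun q : (ℝ × E3) × ℝ => χ q.2 := χ.contDiff.comp contDiff_snd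
    have h2 : ContDiff ℝ ∞ fun q : (ℝ × E3) × ℝ => (q.1.1 * (-q.2), q.1.2) := by fun_prop
    have h3 : ContDiffOn ℝ ∞ (fun q : (ℝ × E3) × ℝ => scriExt g (q.1.1 * (-q.2), q.1.2))
        (punctured ×ˢ Set.univ) :=
      (smoothOnScri_iff.1 hg).comp h2.contDiffOn fun q hq => hq.1
    exact h1.contDiffOn.mul h3
  have hw : LocallyIntegrable w volume :=
    ((integrable_indicator_iff measurableSet_Ioc).2
      (integrableOn_const (by simp))).locallyIntegrable
  have hconv := contDiffOn_convolution_right_with_param (n := ⊤) (μ := volume)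
    (ContinuousLinearMap.mul ℝ ℝ) isOpen_punctured (isCompact_closedBall (0 : ℝ) 2) (g := G)
    (fun p z _ hz => by
      have : χ z = 0 := χ.zero_of_le_dist (by
        have : ¬ dist z 0 ≤ 2 := hz
        exact (not_le.1 this).le)
      simp [G, this]) hw hG
  have h0 : ContDiffOn ℝ ∞ (fun p : ℝ × E3 => p.1 *
      (MeasureTheory.convolution w (G p) (ContinuousLinearMap.mul ℝ ℝ) volume) 0) punctured := by
    have hι : ContDiff ℝ ∞ fun p : ℝ × E3 => (p, (0 : ℝ)) := by fun_prop
    exact contDiff_fst.contDiffOn.mul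
      (hconv.comp hι.contDiffOn fun p hp => ⟨hp, Set.mem_univ _⟩)
  rw [smoothOnScri_iff]
  refine h0.congr fun p hp => ?_
  have hp' : p.2 ≠ 0 := hp
  have h1 : (MeasureTheory.convolution w (G p) (ContinuousLinearMap.mul ℝ ℝ) volume) 0
      = ∫ t in (0 : ℝ)..1, g (p.1 * t) (toS2 p.2 hp') := by
    rw [MeasureTheory.convolution, intervalIntegral.integral_of_le zero_le_one,
      ← integral_indicator measurableSet_Ioc]
    refine integral_congr_ae (ae_of_all _ fun t => ?_)
    by_cases ht : t ∈ Set.Ioc (0 : ℝ) 1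
    · have hχ : χ (-t) = 1 := by
        refine χ.one_of_mem_closedBall ?_
        rw [mem_closedBall_zero_iff, norm_neg, Real.norm_eq_abs, abs_of_pos ht.1]
        exact ht.2
      simp only [ContinuousLinearMap.mul_apply', w, G, hχ, Set.indicator_of_mem ht, scriExt,
        radialExt_of_ne hp', zero_sub, neg_neg, one_mul]
    · simp [w, Set.indicator_of_notMem ht]
  rw [h1, radialExt_of_ne hp', ← smul_eq_mul,
    intervalIntegral.smul_integral_comp_mul_left (fun s => g s (toS2 p.2 hp'))]
  simp

section Closure

theorem smoothOnScri_σ (i j : Fin 3) : SmoothOnScri fun _ x => σ x i j :=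
  (smoothOnS2_σ i j).const_u

theorem SmoothOnScri.covForm {w : ℝ → S2 → Fin 3 → ℝ} (hw : ∀ l, SmoothOnScri fun u x => w u x l)
    (i j : Fin 3) : SmoothOnScri fun u x => covForm (w u) x i j :=
  SmoothOnScri.sum fun l _ => (smoothOnScri_σ j l).mul ((hw l).pd i)

theorem SmoothOnScri.divTensor {T : ℝ → S2 → Fin 3 → Fin 3 → ℝ}
    (hT : ∀ i j, SmoothOnScri fun u x => T u x i j) (j : Fin 3) :
    SmoothOnScri fun u x => divTensor (T u) x j :=
  SmoothOnScri.sum fun i _ => SmoothOnScri.sum fun a _ => SmoothOnScri.sum fun b _ =>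
    ((smoothOnScri_σ i a).mul (smoothOnScri_σ j b)).mul ((hT a b).pd i)

theorem SmoothOnScri.pair {S T : ℝ → S2 → Fin 3 → Fin 3 → ℝ}
    (hS : ∀ i j, SmoothOnScri fun u x => S u x i j)
    (hT : ∀ i j, SmoothOnScri fun u x => T u x i j) :
    SmoothOnScri fun u x => pair (S u x) (T u x) :=
  SmoothOnScri.sum fun i _ => SmoothOnScri.sum fun j _ => (hS i j).mul (hT i j)

end Closure

namespace Data

/-- The right-hand side of the evolution equation of the angular momentum aspect. -/
def evolutionNA (D : Data) (u : ℝ) (x : S2) (i : Fin 3) : ℝ :=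
  grad (D.m u) x i
    - 1 / 4 * divTensor (fun y d a =>
        covForm (divTensor (D.C u)) y d a - covForm (divTensor (D.C u)) y a d) x i
    + 1 / 4 * grad (fun y => pair (D.C u y) (D.news u y)) x i
    - 1 / 4 * divTensor (fun y b a => ∑ d, D.C u y b d * D.news u y d a) x i
    + 1 / 2 * ∑ b, D.C u x i b * divTensor (D.news u) x b

theorem smooth_evolutionNA {D : Data} (hm : SmoothOnScri D.m)
    (hC : ∀ i j, SmoothOnScri fun u x => D.C u x i j) (i : Fin 3) :
    SmoothOnScri fun u x => D.evolutionNA u x i := by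
  have hN : ∀ i j, SmoothOnScri fun u x => D.news u x i j := fun i j => (hC i j).deriv
  have hc : ∀ d a, SmoothOnScri fun u x => covForm (divTensor (D.C u)) x d a :=
    SmoothOnScri.covForm (w := fun u => divTensor (D.C u)) (SmoothOnScri.divTensor hC)
  exact ((((hm.pd i).sub ((SmoothOnScri.const _).mul
    (SmoothOnScri.divTensor (T := fun u y d a => covForm (divTensor (D.C u)) y d a
      - covForm (divTensor (D.C u)) y a d) (fun d a => (hc d a).sub (hc a d)) i))).add
    ((SmoothOnScri.const _).mul ((SmoothOnScri.pair hC hN).pd i))).sub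
    ((SmoothOnScri.const _).mul (SmoothOnScri.divTensor
      (T := fun u y b a => ∑ d, D.C u y b d * D.news u y d a) (fun b a =>
        SmoothOnScri.sum fun d _ => (hC b d).mul (hN d a)) i))).add
    ((SmoothOnScri.const _).mul (SmoothOnScri.sum fun b _ =>
      (hC i b).mul (SmoothOnScri.divTensor hN b)))

/-- Tangentiality passes to the u-integral, so the angular momentum aspect built from it is a
1-form. -/
theorem evolutionNA_tangential {D : Data} (hm : SmoothOnScri D.m)
    (hC : ∀ i j, SmoothOnScri fun u x => D.C u x i j)
    (ht : ∀ u x j, ∑ i, x.1 i * D.C u x i j = 0) (u : ℝ) (x : S2) :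
    ∑ i, x.1 i * D.evolutionNA u x i = 0 := by
  have hN : ∀ i j, SmoothOnScri fun u x => D.news u x i j := fun i j => (hC i j).deriv
  have h1 := grad_tangential (hm.slice u).c1 x
  have h2 := divTensor_tangential (fun y d a =>
    covForm (divTensor (D.C u)) y d a - covForm (divTensor (D.C u)) y a d) x
  have h3 := grad_tangential ((SmoothOnScri.pair hC hN).slice u).c1 x
  have h4 := divTensor_tangential (fun y b a => ∑ d, D.C u y b d * D.news u y d a) x
  have h5 : ∑ i, x.1 i * ∑ b, D.C u x i b * divTensor (D.news u) x b = 0 := by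
    simp only [Finset.mul_sum]
    rw [Finset.sum_comm]
    simp only [← mul_assoc, ← Finset.sum_mul, ht, zero_mul, Finset.sum_const_zero]
  have e : ∀ i, x.1 i * D.evolutionNA u x i = x.1 i * grad (D.m u) x i
      - 1 / 4 * (x.1 i * divTensor (fun y d a =>
        covForm (divTensor (D.C u)) y d a - covForm (divTensor (D.C u)) y a d) x i)
      + 1 / 4 * (x.1 i * grad (fun y => pair (D.C u y) (D.news u y)) x i)
      - 1 / 4 * (x.1 i * divTensor (fun y b a => ∑ d, D.C u y b d * D.news u y d a) x i)
      + 1 / 2 * (x.1 i * ∑ b, D.C u x i b * divTensor (D.news u) x b) := fun i => by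
    rw [evolutionNA]; ring
  simp only [e, Finset.sum_add_distrib, Finset.sum_sub_distrib, ← Finset.mul_sum, h1, h2, h3, h4,
    h5]
  ring

/-- The mass aspect after the supertranslation `f`. -/
def shiftedMass (D : Data) (f : S2 → ℝ) (u : ℝ) (x : S2) : ℝ :=
  D.m (u + f x) x
    + 1 / 2 * ∑ d, divTensor (D.news (u + f x)) x d * grad f x d
    + 1 / 4 * ∑ b, ∑ d,
        deriv (fun s => D.news s x b d) (u + f x) * grad f x b * grad f x d
    + 1 / 4 * pair (D.news (u + f x) x) (hess f x)

/-- The shear after the supertranslation `f`. -/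
def shiftedShear (D : Data) (f : S2 → ℝ) (u : ℝ) (x : S2) (i j : Fin 3) : ℝ :=
  D.C (u + f x) x i j - 2 * hess f x i j + lap f x * σ x i j

/-- The data after the supertranslation `f` whose angular momentum aspect vanishes at `u = 0`. -/
def supertranslate (D : Data) (f : S2 → ℝ) : Data where
  m := D.shiftedMass f
  C := D.shiftedShear f
  NA u x i := ∫ s in (0 : ℝ)..u, evolutionNA ⟨D.shiftedMass f, 0, D.shiftedShear f⟩ s x i

section

variable {D : Data} {f : S2 → ℝ} (hD : D.IsVacuum) (hf : SmoothOnS2 f)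

theorem shiftedShear_eq (u : ℝ) (x : S2) (i j : Fin 3) :
    D.shiftedShear f u x i j = D.C (u + f x) x i j + shearShift f x i j := by
  rw [shiftedShear, shearShift]; ring

theorem news_supertranslate (u : ℝ) (x : S2) (i j : Fin 3) :
    (D.supertranslate f).news u x i j = D.news (u + f x) x i j := by
  simp only [news, supertranslate, shiftedShear_eq]
  rw [deriv_add_const, deriv_comp_add_const (fun s => D.C s x i j)]

include hD hf

theorem smooth_shiftedShear (i j : Fin 3) : SmoothOnScri fun u x => D.shiftedShear f u x i j := by
  simp only [shiftedShear_eq]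
  exact ((hD.smooth_C i j).shift hf).add ((isSTF_shearShift hf).smooth i j).const_u

theorem smooth_shiftedMass : SmoothOnScri (D.shiftedMass f) := by
  have hg := fun d => (hf.pd d).const_u
  exact (((hD.smooth_m.shift hf).add ((SmoothOnScri.const _).mul (SmoothOnScri.sum fun d _ =>
    ((hD.smooth_divNews d).shift hf).mul (hg d)))).add
    ((SmoothOnScri.const _).mul (SmoothOnScri.sum fun b _ => SmoothOnScri.sum fun d _ =>
      (((hD.smooth_news b d).deriv.shift hf).mul (hg b)).mul (hg d)))).add
    ((SmoothOnScri.const _).mul (SmoothOnScri.sum fun b _ => SmoothOnScri.sum fun d _ =>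
      ((hD.smooth_news b d).shift hf).mul (smoothOnS2_hess hf b d).const_u))

theorem isSTF_shiftedShear (u : ℝ) : IsSTF (D.shiftedShear f u) where
  smooth i j := (smooth_shiftedShear hD hf i j).slice u
  tangential x j := by
    simp only [shiftedShear_eq, mul_add, Finset.sum_add_distrib, hD.tangential_C,
      (isSTF_shearShift hf).tangential, add_zero]
  symm x i j := by
    simp only [shiftedShear_eq, hD.symm_C _ x i j, (isSTF_shearShift hf).symm x i j]
  traceless x := by
    simp only [shiftedShear_eq, Finset.sum_add_distrib, hD.traceless_C,
      (isSTF_shearShift hf).traceless, add_zero]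

theorem isSTF_news_supertranslate (u : ℝ) : IsSTF ((D.supertranslate f).news u) where
  smooth i j := by
    simp only [news_supertranslate]
    exact ((hD.smooth_news i j).shift hf).slice u
  tangential x j := by
    simp only [news_supertranslate, (hD.isSTF_news _).tangential]
  symm x i j := by
    simp only [news_supertranslate, (hD.isSTF_news _).symm x i j]
  traceless x := by
    simp only [news_supertranslate, (hD.isSTF_news _).traceless]

theorem divTensor_news_supertranslate (u : ℝ) (x : S2) (j : Fin 3) :
    divTensor ((D.supertranslate f).news u) x j = divTensor (D.news (u + f x)) x j
      + ∑ i, deriv (fun s => D.news s x i j) (u + f x) * pd i f x := by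
  rw [(isSTF_news_supertranslate hD hf u).divTensor_eq, (hD.isSTF_news _).divTensor_eq,
    ← Finset.sum_add_distrib]
  refine Finset.sum_congr rfl fun i _ => ?_
  simp only [news_supertranslate]
  rw [(hD.smooth_news i j).pd_shift hf.c1]

omit hf in
theorem sum_coord_mul_deriv_news (u : ℝ) (x : S2) (i : Fin 3) :
    ∑ j, x.1 j * deriv (fun s => D.news s x i j) u = 0 := by
  have h : HasDerivAt (fun s => ∑ j, x.1 j * D.news s x i j) _ u :=
    HasDerivAt.fun_sum fun j _ => ((hD.smooth_news i j).hasDerivAt u x).const_mul (x.1 j)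
  simp only [(hD.isSTF_news _).tangential_right] at h
  exact h.unique (hasDerivAt_const u 0)

omit hf in
theorem deriv_divTensor_news (u : ℝ) (x : S2) (j : Fin 3) :
    deriv (fun s => divTensor (D.news s) x j) u
      = ∑ i, pd i (fun y => deriv (fun s => D.news s y i j) u) x := by
  have h : HasDerivAt (fun s => ∑ i, pd i (fun y => D.news s y i j) x) _ u :=
    HasDerivAt.fun_sum fun i _ => ((hD.smooth_news i j).pd i).hasDerivAt u x
  simp only [(hD.isSTF_news _).divTensor_eq]
  rw [h.deriv]
  exact Finset.sum_congr rfl fun i _ => (hD.smooth_news i j).deriv_pd i u x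

/-- Each derivative along the sphere of N(u + f(x), x) adds a ∂_u N contracted with ∇f. A quarter of
the three extra terms is the u-derivative of the three corrections in `shiftedMass`, which is why
the mass transforms by that formula. -/
theorem divForm_divTensor_news_supertranslate (u : ℝ) (x : S2) :
    divForm (divTensor ((D.supertranslate f).news u)) x
      = divForm (divTensor (D.news (u + f x))) x
        + 2 * ∑ d, deriv (fun s => divTensor (D.news s) x d) (u + f x) * pd d f x
        + ∑ b, ∑ d, deriv (fun t => deriv (fun s => D.news s x b d) t) (u + f x)
          * pd b f x * pd d f x
        + ∑ b, ∑ d, deriv (fun s => D.news s x b d) (u + f x) * hess f x b d := by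
  have hN2 := fun i j => (hD.smooth_news i j).deriv
  have hp := fun i => (hf.pd i).c1
  have hs2 : ∀ i j, C1 fun y => deriv (fun s => D.news s y i j) (u + f y) := fun i j =>
    ((hN2 i j).shift hf).slice u |>.c1
  have hs1 : ∀ j, C1 fun y => divTensor (D.news (u + f y)) y j := fun j =>
    ((hD.smooth_divNews j).shift hf).slice u |>.c1
  have hsum : ∀ j, C1 fun y => ∑ i, deriv (fun s => D.news s y i j) (u + f y) * pd i f y :=
    fun j => C1.sum fun i _ => (hs2 i j).mul (hp i)
  have hdn : ∀ j, C1 fun y => divTensor ((D.supertranslate f).news u) y j := fun j =>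
    ((isSTF_news_supertranslate hD hf u).smoothOnS2_divTensor j).c1
  rw [divForm_eq hdn, divForm_eq fun l => ((hD.smooth_divNews l).slice _).c1]
  simp only [divTensor_news_supertranslate hD hf]
  have e : ∀ j, pd j (fun y => divTensor (D.news (u + f y)) y j
      + ∑ i, deriv (fun s => D.news s y i j) (u + f y) * pd i f y) x
      = pd j (fun y => divTensor (D.news (u + f x)) y j) x
        + deriv (fun s => divTensor (D.news s) x j) (u + f x) * pd j f x
        + ∑ i, (pd j (fun y => deriv (fun s => D.news s y i j) (u + f x)) x * pd i f x
          + deriv (fun t => deriv (fun s => D.news s x i j) t) (u + f x) * pd i f x * pd j f x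
          + deriv (fun s => D.news s x i j) (u + f x) * pd j (pd i f) x) := by
    intro j
    rw [pd_add j (hs1 j) (hsum j), (hD.smooth_divNews j).pd_shift hf.c1,
      pd_sum _ _ fun i _ => (hs2 i j).mul (hp i)]
    congr 1
    refine Finset.sum_congr rfl fun i _ => ?_
    rw [pd_mul j (hs2 i j) (hp i), (hN2 i j).pd_shift hf.c1]
    ring
  simp only [e, Finset.sum_add_distrib]
  have t1 : ∑ j, ∑ i, pd j (fun y => deriv (fun s => D.news s y i j) (u + f x)) x * pd i f x
      = ∑ d, deriv (fun s => divTensor (D.news s) x d) (u + f x) * pd d f x := by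
    rw [Finset.sum_comm]
    refine Finset.sum_congr rfl fun i _ => ?_
    rw [← Finset.sum_mul, deriv_divTensor_news hD]
    refine congrArg (· * _) (Finset.sum_congr rfl fun j _ => ?_)
    simp only [(hD.isSTF_news _).symm _ i j]
  have t2 : ∑ j, ∑ i, deriv (fun s => D.news s x i j) (u + f x) * pd j (pd i f) x
      = ∑ b, ∑ d, deriv (fun s => D.news s x b d) (u + f x) * hess f x b d := by
    refine Finset.sum_congr rfl fun b _ => ?_
    simp only [hess_eq hf, mul_add, Finset.sum_add_distrib]
    have : ∑ d, deriv (fun s => D.news s x b d) (u + f x) * (x.1 d * pd b f x)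
        = (∑ d, x.1 d * deriv (fun s => D.news s x b d) (u + f x)) * pd b f x := by
      rw [Finset.sum_mul]; exact Finset.sum_congr rfl fun d _ => by ring
    rw [this, sum_coord_mul_deriv_news hD, zero_mul, add_zero]
    refine Finset.sum_congr rfl fun d _ => ?_
    simp only [(hD.isSTF_news _).symm x b d]
  have t3 : ∑ j, ∑ i, deriv (fun t => deriv (fun s => D.news s x i j) t) (u + f x)
        * pd i f x * pd j f x
      = ∑ b, ∑ d, deriv (fun t => deriv (fun s => D.news s x b d) t) (u + f x)
        * pd b f x * pd d f x := Finset.sum_comm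
  rw [t1, t2, t3]
  ring

omit hf in
theorem deriv_shiftedMass (u : ℝ) (x : S2) :
    deriv (fun s => D.shiftedMass f s x) u = deriv (fun s => D.m s x) (u + f x)
      + 1 / 2 * ∑ d, deriv (fun s => divTensor (D.news s) x d) (u + f x) * grad f x d
      + 1 / 4 * ∑ b, ∑ d, deriv (fun t => deriv (fun s => D.news s x b d) t) (u + f x)
          * grad f x b * grad f x d
      + 1 / 4 * ∑ b, ∑ d, deriv (fun s => D.news s x b d) (u + f x) * hess f x b d := by
  have h1 := (hD.smooth_m.hasDerivAt (u + f x) x).comp_add_const u (f x)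
  have h2 := fun d => ((hD.smooth_divNews d).hasDerivAt (u + f x) x).comp_add_const u (f x)
  have h3 := fun i j =>
    ((hD.smooth_news i j).deriv.hasDerivAt (u + f x) x).comp_add_const u (f x)
  have h4 := fun i j => ((hD.smooth_news i j).hasDerivAt (u + f x) x).comp_add_const u (f x)
  have h : HasDerivAt (fun s => D.shiftedMass f s x) _ u :=
    ((h1.add ((HasDerivAt.fun_sum fun d (_ : d ∈ Finset.univ) =>
      (h2 d).mul_const (grad f x d)).const_mul (1 / 2))).add
    ((HasDerivAt.fun_sum fun b (_ : b ∈ Finset.univ) =>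
      HasDerivAt.fun_sum fun d (_ : d ∈ Finset.univ) =>
        ((h3 b d).mul_const (grad f x b)).mul_const (grad f x d)).const_mul (1 / 4))).add
    ((HasDerivAt.fun_sum fun b (_ : b ∈ Finset.univ) =>
      HasDerivAt.fun_sum fun d (_ : d ∈ Finset.univ) =>
        (h4 b d).mul_const (hess f x b d)).const_mul (1 / 4))
  rw [h.deriv]

/-- Only the evolution of m needs a computation: `deriv_shiftedMass` is matched with the chain rule
for div div N, and |N|² is simply translated. -/
theorem isVacuum_supertranslate : (D.supertranslate f).IsVacuum := by
  have hm := smooth_shiftedMass hD hf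
  have hC := smooth_shiftedShear hD hf
  have ht : ∀ u x j, ∑ i, x.1 i * D.shiftedShear f u x i j = 0 := fun u =>
    (isSTF_shiftedShear hD hf u).tangential
  have hR := smooth_evolutionNA (D := ⟨D.shiftedMass f, 0, D.shiftedShear f⟩) hm hC
  have hRt := evolutionNA_tangential (D := ⟨D.shiftedMass f, 0, D.shiftedShear f⟩) hm hC ht
  refine
    { smooth_m := hm
      smooth_NA := fun i => (hR i).primitive
      smooth_C := hC
      tangential_NA := fun u x => ?_
      tangential_C := ht
      symm_C := fun u => (isSTF_shiftedShear hD hf u).symm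
      traceless_C := fun u => (isSTF_shiftedShear hD hf u).traceless
      evolution_m := fun u x => ?_
      evolution_NA := fun u x i => ((hR i).hasDerivAt_primitive u x).deriv }
  · simp only [supertranslate, ← intervalIntegral.integral_const_mul]
    rw [← intervalIntegral.integral_finsetSum fun i _ =>
      ((((hR i).continuous_u x).const_mul _).intervalIntegrable _ _)]
    simp only [hRt, intervalIntegral.integral_zero]
  · have e : (D.supertranslate f).news u x = D.news (u + f x) x := by
      funext i j; exact news_supertranslate u x i j
    rw [divForm_divTensor_news_supertranslate hD hf, e]
    refine (deriv_shiftedMass hD u x).trans ?_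
    rw [hD.evolution_m]
    simp only [grad]
    ring

theorem isSupertranslate_supertranslate : D.IsSupertranslate f (D.supertranslate f) where
  vacuum := isVacuum_supertranslate hD hf
  m_eq _ _ := rfl
  C_eq _ _ _ _ := rfl

end

end Data

/-! ### Integrals of the translation kernel. -/

theorem HasTotalFlux.unique {Q : ℝ → ℝ} {F F' : ℝ} (h : HasTotalFlux Q F)
    (h' : HasTotalFlux Q F') : F = F' := by
  obtain ⟨a, b, ha, hb, rfl⟩ := h
  obtain ⟨a', b', ha', hb', rfl⟩ := h'
  rw [tendsto_nhds_unique ha ha', tendsto_nhds_unique hb hb']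

theorem two_mul_translationKernel {f : S2 → ℝ} (hf : C1 f) (k : Fin 3) (x : S2) :
    2 * X k x * f x + 2 * ∑ i, grad (X k) x i * grad f x i = 2 * translationKernel k f x := by
  rw [sum_grad_X_mul x k (grad_tangential hf x), translationKernel, X, grad]
  ring

/-- The gradient part contributes twice the first part, by `integral_pd`. -/
theorem integral_translationKernel {f : S2 → ℝ} (hf : C1 f) (k : Fin 3) :
    ∫ x, translationKernel k f x ∂area = 3 * ∫ x, x.1 k * f x ∂area := by
  simp only [translationKernel]
  rw [integral_add ((c1_coord k).mul hf).integrable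
    (Continuous.integrable_area (hf.continuous_pd k)), integral_pd hf]
  ring

/-- Integration by parts of the flux formula. -/
theorem integral_translationKernel_mul {f δ : S2 → ℝ} (hf : C1 f) (hδ : C1 δ) (k : Fin 3) :
    ∫ x, 2 * translationKernel k f x * δ x ∂area
      = ∫ x, (6 * X k x * δ x - 2 * ∑ i, grad (X k) x i * grad δ x i) * f x ∂area := by
  -- Subtracting twice this vanishing integral moves the derivative from f to δ.
  have h := integral_pd_sub (hf.mul hδ) k
  have i1 : Integrable (fun x => 2 * translationKernel k f x * δ x) area :=
    Continuous.integrable_area ((continuous_const.mul (((c1_coord k).mul hf).continuous.add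
      (hf.continuous_pd k))).mul hδ.continuous)
  have i2 : Integrable (fun x => pd k (fun y => f y * δ y) x - 2 * (x.1 k * (f x * δ x))) area :=
    (Continuous.integrable_area ((hf.mul hδ).continuous_pd k)).sub
      (((c1_coord k).mul (hf.mul hδ)).integrable.const_mul 2)
  have h2 : ∫ x, 2 * translationKernel k f x * δ x ∂area
      = ∫ x, 2 * translationKernel k f x * δ x
        - 2 * (pd k (fun y => f y * δ y) x - 2 * (x.1 k * (f x * δ x))) ∂area := by
    rw [integral_sub i1 (i2.const_mul 2), integral_const_mul, h, mul_zero, sub_zero]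
  rw [h2]
  refine integral_congr_ae (ae_of_all _ fun x => ?_)
  simp only
  rw [sum_grad_X_mul x k (grad_tangential hδ x), pd_mul k hf hδ, translationKernel, X, grad]
  ring

/-! ### Higher modes and the determination of constants. -/

/-- The part of a function in the modes `ℓ ≥ 2`. -/
def higherPart (q : S2 → ℝ) (x : S2) : ℝ :=
  -- The factor 3 normalizes x_i, whose square has integral `totalArea / 3`.
  q x - ((∫ y, q y ∂area) / totalArea + ∑ i, 3 * (∫ y, q y * y.1 i ∂area) / totalArea * x.1 i)

section HigherPart

variable {q : S2 → ℝ} (hq : SmoothOnS2 q)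
include hq

theorem smoothOnS2_higherPart : SmoothOnS2 (higherPart q) :=
  hq.sub ((SmoothOnS2.const _).add (SmoothOnS2.sum fun i _ =>
    (SmoothOnS2.const _).mul (smoothOnS2_coord i)))

theorem supportedInHigherModes_higherPart : SupportedInHigherModes (higherPart q) := by
  have hA := totalArea_pos.ne'
  constructor
  · simp only [higherPart]
    rw [integral_sub hq.c1.integrable (Integrable.fun_add (integrable_const _)
        (integrable_finsetSum _ fun i _ => (c1_coord i).integrable.const_mul _)),
      integral_add (integrable_const _) (integrable_finsetSum _
        fun i _ => (c1_coord i).integrable.const_mul _),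
      integral_finsetSum _ fun i _ => (c1_coord i).integrable.const_mul _]
    simp only [integral_const_mul, integral_coord, mul_zero, Finset.sum_const_zero, add_zero,
      integral_const, smul_eq_mul]
    change _ - totalArea * _ = 0
    field_simp
    ring
  · intro j
    have e : ∀ x, higherPart q x * X j x = q x * x.1 j
        - ((∫ y, q y ∂area) / totalArea * x.1 j
          + ∑ i, 3 * (∫ y, q y * y.1 i ∂area) / totalArea * (x.1 i * x.1 j)) := by
      intro x
      rw [higherPart, X, sub_mul, add_mul, Finset.sum_mul]
      simp only [mul_assoc]
    have hij := fun i => ((c1_coord i).mul (c1_coord j)).integrable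
    simp only [e]
    rw [integral_sub (hq.c1.mul (c1_coord j)).integrable (((c1_coord j).integrable.const_mul _).fun_add
        (integrable_finsetSum _ fun i _ => (hij i).const_mul _)),
      integral_add ((c1_coord j).integrable.const_mul _) (integrable_finsetSum _
        fun i _ => (hij i).const_mul _),
      integral_finsetSum _ fun i _ => (hij i).const_mul _]
    simp only [integral_const_mul, integral_coord, integral_coord_mul_coord, mul_ite, mul_zero,
      Finset.sum_ite_eq', Finset.mem_univ, if_true]
    field_simp
    ring

/-- The kernel of the constant 1 is x_k, and that of x_i is x_k x_i + σ_ki = δ_ki; removing the low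
modes only subtracts such terms. -/
theorem translationKernel_higherPart (k : Fin 3) (x : S2) :
    translationKernel k (higherPart q) x = translationKernel k q x
      - (∫ y, q y ∂area) / totalArea * x.1 k - 3 * (∫ y, q y * y.1 k ∂area) / totalArea := by
  have hs : ∀ i ∈ (Finset.univ : Finset (Fin 3)),
      C1 fun x => 3 * (∫ y, q y * y.1 i ∂area) / totalArea * x.1 i := fun i _ =>
    (C1.const _).mul (c1_coord i)
  have h : pd k (higherPart q) x = pd k q x
      - ∑ i, 3 * (∫ y, q y * y.1 i ∂area) / totalArea * σ x k i := by
    unfold higherPart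
    rw [pd_sub k hq.c1 ((C1.const _).add (C1.sum hs)), pd_add k (C1.const _) (C1.sum hs),
      pd_const, zero_add, pd_sum _ _ hs]
    simp only [pd_const_mul k _ (c1_coord _), pd_coord]
  rw [translationKernel, h, higherPart, translationKernel]
  have : ∑ i, 3 * (∫ y, q y * y.1 i ∂area) / totalArea * σ x k i
      = 3 * (∫ y, q y * y.1 k ∂area) / totalArea
        - x.1 k * ∑ i, 3 * (∫ y, q y * y.1 i ∂area) / totalArea * x.1 i := by
    simp only [mul_comm _ (σ x k _)]
    rw [sum_σ_mul]
    simp only [mul_comm (x.1 _)]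
  rw [this]
  ring

end HigherPart

/-- The three terms sum to |x|² g = g, tr σ · g = 2 g, and x · ∇g = 0. The kernels thus recover an
arbitrary test function g. -/
theorem sum_translationKernel_coord_mul {g : S2 → ℝ} (hg : C1 g) (x : S2) :
    ∑ k, translationKernel k (fun y => y.1 k * g y) x = 3 * g x := by
  have e : ∀ k, translationKernel k (fun y => y.1 k * g y) x
      = x.1 k * x.1 k * g x + σ x k k * g x + x.1 k * pd k g x := by
    intro k
    rw [translationKernel, pd_mul k (c1_coord k) hg, pd_coord]
    ring
  simp only [e, Finset.sum_add_distrib, ← Finset.sum_mul, S2.sum_sq, sum_σ_self,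
    sum_coord_mul_pd hg]
  ring

theorem sum_translationKernel_higherPart {g : S2 → ℝ} (hg : SmoothOnS2 g) (x : S2) :
    ∑ k, translationKernel k (higherPart fun y => y.1 k * g y) x = 3 * g x
      - (∑ k, (∫ y, y.1 k * g y ∂area) / totalArea * x.1 k) - 3 * (∫ y, g y ∂area) / totalArea := by
  have hs : ∑ k : Fin 3, ∫ y : S2, y.1 k * g y * y.1 k ∂area = ∫ y, g y ∂area := by
    rw [← integral_finsetSum _ fun k _ =>
      (((c1_coord k).mul hg.c1).mul (c1_coord k)).integrable]
    refine integral_congr_ae (ae_of_all _ fun y => ?_)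
    simp only [mul_right_comm _ (g y), ← Finset.sum_mul, S2.sum_sq, one_mul]
  simp only [translationKernel_higherPart ((smoothOnS2_coord _).mul hg), Finset.sum_sub_distrib,
    sum_translationKernel_coord_mul hg.c1, ← Finset.sum_div, ← Finset.mul_sum, hs]

/-- A continuous function on the sphere to which the translation kernels of all higher modes are
orthogonal is constant. -/
theorem exists_const_of_integral_translationKernel {δ : S2 → ℝ} (hδ : Continuous δ)
    (h : ∀ q, SmoothOnS2 q → SupportedInHigherModes q → ∀ k,
      ∫ x, 2 * translationKernel k q x * δ x ∂area = 0) : ∃ c, ∀ x, δ x = c := by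
  have hA := totalArea_pos.ne'
  -- The hypothesis is applied to the higher parts of x_k g and summed over k; the low modes removed
  -- leave only the moments of δ against x_k and 1.
  have key : ∀ g, SmoothOnS2 g → 3 * ∫ x, g x * δ x ∂area
      = (∑ k, (∫ y, y.1 k * g y ∂area) / totalArea * ∫ x, x.1 k * δ x ∂area)
        + 3 * (∫ y, g y ∂area) / totalArea * ∫ x, δ x ∂area := by
    intro g hg
    have hs := fun k => smoothOnS2_higherPart ((smoothOnS2_coord k).mul hg)
    have h0 : ∑ k,
        ∫ x, 2 * translationKernel k (higherPart fun y => y.1 k * g y) x * δ x ∂area = 0 :=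
      Finset.sum_eq_zero fun k _ =>
        h _ (hs k) (supportedInHigherModes_higherPart ((smoothOnS2_coord k).mul hg)) k
    have hi : ∀ k, Integrable (fun x =>
        2 * translationKernel k (higherPart fun y => y.1 k * g y) x * δ x) area := fun k =>
      Continuous.integrable_area ((continuous_const.mul
        (smoothOnS2_translationKernel (hs k) k).c1.continuous).mul hδ)
    rw [← integral_finsetSum _ fun k _ => hi k] at h0
    have e : ∀ x, ∑ k, 2 * translationKernel k (higherPart fun y => y.1 k * g y) x * δ x
        = 2 * (3 * (g x * δ x) - ((∑ k, (∫ y, y.1 k * g y ∂area) / totalArea * (x.1 k * δ x))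
          + 3 * (∫ y, g y ∂area) / totalArea * δ x)) := by
      intro x
      simp only [← Finset.sum_mul, ← Finset.mul_sum, sum_translationKernel_higherPart hg,
        ← mul_assoc]
      ring
    have i1 : Integrable (fun x => g x * δ x) area :=
      Continuous.integrable_area (hg.c1.continuous.mul hδ)
    have i2 : ∀ k : Fin 3, Integrable (fun x => x.1 k * δ x) area := fun k =>
      Continuous.integrable_area ((c1_coord k).continuous.mul hδ)
    have i3 : Integrable δ area := Continuous.integrable_area hδ
    simp only [e] at h0
    rw [integral_const_mul, integral_sub (i1.const_mul 3) ((integrable_finsetSum _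
        fun k _ => (i2 k).const_mul _).fun_add (i3.const_mul _)),
      integral_add (integrable_finsetSum _ fun k _ => (i2 k).const_mul _) (i3.const_mul _),
      integral_finsetSum _ fun k _ => (i2 k).const_mul _] at h0
    simp only [integral_const_mul] at h0
    linarith
  -- For g = x_j the relation reads 3 M = M / 3, where M is the moment of δ against x_j.
  have hM : ∀ j : Fin 3, ∫ x, x.1 j * δ x ∂area = 0 := by
    intro j
    have := key _ (smoothOnS2_coord j)
    simp only [integral_coord_mul_coord, integral_coord, ite_div, zero_div, ite_mul, zero_mul,
      Finset.sum_ite_eq', Finset.mem_univ, if_true, mul_zero, add_zero] at this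
    have e : totalArea / 3 / totalArea = 1 / 3 := by field_simp
    rw [e] at this
    linarith
  refine ⟨(∫ x, δ x ∂area) / totalArea, ?_⟩
  -- With these moments zero, δ minus its mean is orthogonal to every smooth g.
  have hz : ∀ᵐ x ∂area, δ x - (∫ x, δ x ∂area) / totalArea = 0 := by
    refine ae_eq_zero_of_integral_contMDiff_smul_eq_zero (𝓡 2)
      (Continuous.integrable_area (hδ.sub continuous_const)).locallyIntegrable fun g hg _ => ?_
    have hg' : SmoothOnS2 g := hg
    have := key g hg'
    simp only [hM, mul_zero, Finset.sum_const_zero, zero_add] at this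
    simp only [smul_eq_mul, mul_sub]
    have i1 : Integrable (fun x => g x * δ x) area :=
      Continuous.integrable_area (hg'.c1.continuous.mul hδ)
    rw [integral_sub i1 (hg'.c1.integrable.mul_const _), integral_mul_const]
    linear_combination this / 3
  have hc := (Continuous.ae_eq_iff_eq area (hδ.sub continuous_const)
    (continuous_const (y := (0 : ℝ)))).1 hz
  exact fun x => sub_eq_zero.1 (congrFun hc x)

theorem integral_coord_mul_modes (α₀ : ℝ) (α : Fin 3 → ℝ) {h : S2 → ℝ} (hs : SmoothOnS2 h)
    (hh : SupportedInHigherModes h) (k : Fin 3) :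
    ∫ x, x.1 k * (α₀ + ∑ i, α i * X i x + h x) ∂area = α k * (totalArea / 3) := by
  have e : ∀ x : S2, x.1 k * (α₀ + ∑ i, α i * X i x + h x)
      = α₀ * x.1 k + ∑ i, α i * (x.1 i * x.1 k) + h x * X k x := by
    intro x
    simp only [mul_add, Finset.mul_sum, X]
    refine congrArg₂ _ (congrArg₂ _ (mul_comm _ _) (Finset.sum_congr rfl fun i _ => by ring))
      (mul_comm _ _)
  have i1 := (c1_coord k).integrable.const_mul α₀
  have i2 := fun i => (((c1_coord i).mul (c1_coord k)).integrable).const_mul (α i)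
  have i3 : Integrable (fun x => h x * X k x) area := (hs.c1.mul (c1_coord k)).integrable
  simp only [e]
  rw [integral_add (i1.fun_add (integrable_finsetSum _ fun i _ => i2 i)) i3,
    integral_add i1 (integrable_finsetSum _ fun i _ => i2 i),
    integral_finsetSum _ fun i _ => i2 i, hh.2 k]
  simp only [integral_const_mul, integral_coord, integral_coord_mul_coord, mul_ite, mul_zero,
    Finset.sum_ite_eq', Finset.mem_univ, if_true, zero_add, add_zero]

theorem smoothOnS2_modes (α₀ : ℝ) (α : Fin 3 → ℝ) {h : S2 → ℝ} (hs : SmoothOnS2 h) :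
    SmoothOnS2 fun x => α₀ + ∑ i, α i * X i x + h x :=
  ((SmoothOnS2.const _).add (SmoothOnS2.sum fun i _ =>
    (SmoothOnS2.const _).mul (smoothOnS2_X i))).add hs

/-! ### The equivalence with constancy of the mass difference. -/

namespace Data

variable {D : Data}

theorem hasTotalFlux_momentum (hD : D.IsVacuum) (Lp : ScriLimit D atTop) (Lm : ScriLimit D atBot)
    (k : Fin 3) :
    HasTotalFlux (D.momentum k) (∫ x, 2 * (Lp.mass x - Lm.mass x) * X k x ∂area) := by
  have hX : Continuous (X k) := (c1_coord k).continuous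
  have hc : ∀ u, Continuous fun x => 2 * D.m u x * X k x := fun u =>
    (continuous_const.mul (hD.smooth_m.continuous_slice u)).mul hX
  refine ⟨_, _, (((Conv.const 2).mul Lp.conv_mass).mul (Conv.of_continuous hX)).tendsto_integral hc,
    (((Conv.const 2).mul Lm.conv_mass).mul (Conv.of_continuous hX)).tendsto_integral hc, ?_⟩
  have hi : ∀ {g : S2 → ℝ}, Continuous g → Integrable (fun x => 2 * g x * X k x) area := fun hg =>
    Continuous.integrable_area ((continuous_const.mul hg).mul hX)
  rw [← integral_sub (hi Lp.continuous_mass) (hi Lm.continuous_mass)]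
  exact integral_congr_ae (ae_of_all _ fun x => by ring)

theorem hasTotalFlux_energy (hD : D.IsVacuum) (Lp : ScriLimit D atTop) (Lm : ScriLimit D atBot) :
    HasTotalFlux D.energy (∫ x, 2 * (Lp.mass x - Lm.mass x) ∂area) := by
  have hc : ∀ u, Continuous fun x => 2 * D.m u x := fun u =>
    continuous_const.mul (hD.smooth_m.continuous_slice u)
  refine ⟨_, _, ((Conv.const 2).mul Lp.conv_mass).tendsto_integral hc,
    ((Conv.const 2).mul Lm.conv_mass).tendsto_integral hc, ?_⟩
  rw [← integral_sub ((Continuous.integrable_area Lp.continuous_mass).const_mul 2)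
    ((Continuous.integrable_area Lm.continuous_mass).const_mul 2)]
  exact integral_congr_ae (ae_of_all _ fun x => by ring)

theorem centerOfMassFluxInvariant_iff (hD : D.IsVacuum) (Lp : ScriLimit D atTop)
    (Lm : ScriLimit D atBot) :
    D.CenterOfMassFluxInvariant ↔ ∃ c : ℝ, ∀ x, Lp.mass x - Lm.mass x = c := by
  obtain ⟨F, hF, hf⟩ := exists_flux hD Lp Lm
  constructor
  · rintro ⟨F', P, E, hF', -, -, h⟩
    refine exists_const_of_integral_translationKernel
      (Lp.continuous_mass.sub Lm.continuous_mass) fun q hq hqs k => ?_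
    have e : (fun x => 0 + ∑ i, (0 : Fin 3 → ℝ) i * X i x + q x) = q := by
      funext x; simp
    -- Invariance quantifies over given supertranslated data, so it yields information only through
    -- the explicit `supertranslate`.
    have h1 := h 0 0 q hq hqs (D.supertranslate q)
      (by rw [e]; exact isSupertranslate_supertranslate hD hq) k
    have h2 := hf q hq _ (isSupertranslate_supertranslate hD hq) k
    have h3 := h1.unique h2
    rw [(hF k).unique (hF' k)] at h3
    simpa using h3
  -- With δm = c the momentum flux vanishes because ∫ X̃^k = 0, and the change 6 c ∫ X̃^k f = 2 c
  -- α_k · `totalArea` is α_k times the energy flux.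
  · rintro ⟨c, hc⟩
    refine ⟨F, _, _, hF, hasTotalFlux_momentum hD Lp Lm, hasTotalFlux_energy hD Lp Lm, ?_⟩
    intro α₀ α h hs hh D' hD' k
    have hφ := smoothOnS2_modes α₀ α hs
    have h1 := hf _ hφ D' hD' k
    convert h1 using 1
    have e : ∫ x, X k x ∂area = 0 := integral_coord k
    have e1 : ∫ _ : S2, 2 * c ∂area = totalArea * (2 * c) := by
      simp only [integral_const, smul_eq_mul, totalArea]
    simp only [hc, integral_const_mul, integral_mul_const, e, e1,
      integral_translationKernel hφ.c1, integral_coord_mul_modes α₀ α hs hh]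
    ring

end Data

end NullInfinity

end

theorem mainTheorem4 (D : NullInfinity.Data) (hD : D.IsVacuum) (hN : D.NewsDecay) :
    ∃ mPlus mMinus : NullInfinity.S2 → ℝ,
      (∀ x, Tendsto (fun u => D.m u x) atTop (𝓝 (mPlus x))) ∧
      (∀ x, Tendsto (fun u => D.m u x) atBot (𝓝 (mMinus x))) ∧
      (D.CenterOfMassFluxInvariant ↔ ∃ c : ℝ, ∀ x, mPlus x - mMinus x = c) ∧
      ∃ F : Fin 3 → ℝ, (∀ k, NullInfinity.HasTotalFlux (D.centerOfMass k) (F k)) ∧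
        ∀ f : NullInfinity.S2 → ℝ, NullInfinity.SmoothOnS2 f →
          ∀ D' : NullInfinity.Data, D.IsSupertranslate f D' →
            ∀ k, ∃ F' : ℝ, NullInfinity.HasTotalFlux (D'.centerOfMass k) F' ∧
              F' - F k = ∫ x, (2 * NullInfinity.X k x * f x
                  + 2 * ∑ i, NullInfinity.grad (NullInfinity.X k) x i * NullInfinity.grad f x i)
                  * (mPlus x - mMinus x) ∂NullInfinity.area ∧
              (ContMDiff (𝓡 2) 𝓘(ℝ, ℝ) 1 (fun x => mPlus x - mMinus x) →
                F' - F k = ∫ x, (6 * NullInfinity.X k x * (mPlus x - mMinus x)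
                  - 2 * ∑ i, NullInfinity.grad (NullInfinity.X k) x i
                      * NullInfinity.grad (fun y => mPlus y - mMinus y) x i)
                  * f x ∂NullInfinity.area) := by
  obtain ⟨Lp⟩ := NullInfinity.Data.exists_scriLimit hD hN (Or.inl rfl)
  obtain ⟨Lm⟩ := NullInfinity.Data.exists_scriLimit hD hN (Or.inr rfl)
  obtain ⟨F, hF, h⟩ := NullInfinity.Data.exists_flux hD Lp Lm
  refine ⟨Lp.mass, Lm.mass, Lp.conv_mass.tendsto, Lm.conv_mass.tendsto,
    NullInfinity.Data.centerOfMassFluxInvariant_iff hD Lp Lm, F, hF,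
    fun f hf D' hD' k => ⟨_, h f hf D' hD' k, ?_, fun hδ => ?_⟩⟩
  · simp only [NullInfinity.two_mul_translationKernel hf.c1, add_sub_cancel_left]
  · rw [add_sub_cancel_left, NullInfinity.integral_translationKernel_mul hf.c1 hδ]
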